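/- **Setting.** Let $\mathcal X$ be a Hilbert space over $\mathbb K\in\{\mathbb R,\mathbb C\}$ with norm $\|\cdot\|$, let $\mathcal A:\mathcal X\to\mathcal X'$ satisfy, with constants $0<\alpha\le L$, $\alpha\|w-v\|^2\le\mathrm{Re}\,\langle\mathcal Aw-\mathcal Av,w-v\rangle$ and $\|\mathcal Aw-\mathcal Av\|\le L\|w-v\|$ for all $v,w\in\mathcal X$, and let $\mathcal A$ have a potential $P:\mathcal X\to\mathbb K$, i.e. $\mathrm{Re}\,\langle\mathcal Aw,v\rangle=\lim_{t\to0,\,t\in\mathbb R}\mathrm{Re}\,\frac{P(w+tv)-P(w)}{t}$. Let $F\in\mathcal X'$, and let $u^\star\in\mathcal X$ be the unique solution of $\langle\mathcal Au^\star,v\rangle=F(v)$ for all $v\in\mathcal X$. A mesh is a finite set of elements. From a nonempty initial mesh $\mathcal T_0$, a refinement strategy produces $\mathtt{refine}(\mathcal T,\mathcal M)$ for $\mathcal M\subseteq\mathcal T$, in which all elements of $\mathcal M$ are refined, i.e. $\mathcal M\subseteq\mathcal T\setminus\mathtt{refine}(\mathcal T,\mathcal M)$. Let $\mathtt{refine}(\mathcal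 T)$ be the set of meshes obtained from $\mathcal T$ by finitely many (possibly zero) such steps, and let $\mathbb T=\mathtt{refine}(\mathcal T_0)$. To each $\mathcal T_H\in\mathbb T$ belong a finite-dimensional space $\mathcal X_H\subsetneq\mathcal X$, with $\mathcal X_H\subseteq\mathcal X_h$ if $\mathcal T_h\in\mathtt{refine}(\mathcal T_H)$, the solution $u_H^\star\in\mathcal X_H$ of $\langle\mathcal Au_H^\star,v\rangle=F(v)$ for all $v\in\mathcal X_H$, and indicators $\eta_H(T,v)\ge0$ for $T\in\mathcal T_H$, $v\in\mathcal X_H$. Write $\eta_H(\mathcal V,v)=(\sum_{T\in\mathcal V}\eta_H(T,v)^2)^{1/2}$ and $\eta_H(v)=\eta_H(\mathcal T_H,v)$. With constants $C_{\rm son}\ge2$, $C_{\rm mesh},C_{\rm stab},C_{\rm rel}>0$ and $0<q_{\rm red}<1$, assume: - (R1) $\#(\mathcal T_H\setminus\mathcal T_h)+\#\mathcal T_H\le\#\mathcal T_h\le C_{\rm son}\#(\mathcal T_H\setminus\mathcal T_h)+\#(\mathcal T_H\cap\mathcal T_h)$ for $\mathcal T_H\in\mathbb T$, $\mathcal M_H\subseteq\mathcal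 T_H$ and $\mathcal T_h=\mathtt{refine}(\mathcal T_H,\mathcal M_H)$; - (R2) for $\mathcal T\in\mathbb T$ and $\mathcal T_H,\mathcal T_h\in\mathtt{refine}(\mathcal T)$ there is a common refinement in $\mathtt{refine}(\mathcal T_H)\cap\mathtt{refine}(\mathcal T_h)$ with at most $\#\mathcal T_H+\#\mathcal T_h-\#\mathcal T$ elements; - (R3) $\#\mathcal T_\ell-\#\mathcal T_0\le C_{\rm mesh}\sum_{i<\ell}\#\mathcal M_i$ whenever $\mathcal T_{i+1}=\mathtt{refine}(\mathcal T_i,\mathcal M_i)$ with $\mathcal M_i\subseteq\mathcal T_i$ for all $i\in\mathbb N_0$; and for all $\mathcal T_H\in\mathbb T$ and $\mathcal T_h\in\mathtt{refine}(\mathcal T_H)$: - (A1) $|\eta_h(\mathcal V,v_h)-\eta_H(\mathcal V,v_H)|\le C_{\rm stab}\|v_h-v_H\|$ for all $v_h\in\mathcal X_h$, $v_H\in\mathcal X_H$, $\mathcal V\subseteq\mathcal T_H\cap\mathcal T_h$; - (A2) $\eta_h(\mathcal T_h\setminus\mathcal T_H,v_H)\le q_{\rm red}\,\eta_H(\mathcal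 T_H\setminus\mathcal T_h,v_H)$ for all $v_H\in\mathcal X_H$; - (A3) $\|u^\star-u_H^\star\|\le C_{\rm rel}\,\eta_H(u_H^\star)$; - (A4) $\|u_h^\star-u_H^\star\|\le C_{\rm rel}\,\eta_H(\mathcal T_H\setminus\mathcal T_h,u_H^\star)$. **Algorithm.** The parameters are $\theta,\lambda_{\rm alg},\lambda_{\rm Pic}>0$ and $C_{\rm mark}\ge1$, and an initial guess $u_0^{0,0}\in\mathcal X_0$ is given. On the mesh $\mathcal T_\ell$, starting from $u_\ell^{0,0}$, for $k=1,2,\dots$ let $u_\ell^{k,0}$ be the last computed iterate, and let $u_\ell^{k,\star}\in\mathcal X_\ell$ solve $(u_\ell^{k,\star},v)=(u_\ell^{k,0},v)-\frac{\alpha}{L^2}\langle\mathcal Au_\ell^{k,0}-F,v\rangle$ for all $v\in\mathcal X_\ell$. A contractive algebraic solver computes $u_\ell^{k,j}\in\mathcal X_\ell$, $j=1,2,\dots$, with $\|u_\ell^{k,\star}-u_\ell^{k,j}\|\le q_{\rm alg}\|u_\ell^{k,\star}-u_\ell^{k,j-1}\|$, where $0<q_{\rm alg}<1$ is fixed, until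 $\|u_\ell^{k,j}-u_\ell^{k,j-1}\|\le\lambda_{\rm alg}[\eta_\ell(u_\ell^{k,j})+\|u_\ell^{k,j}-u_\ell^{k,0}\|]$. The $k$-loop ends at the first $k$ whose final $u_\ell^{k,j}$ satisfies $\|u_\ell^{k,j}-u_\ell^{k,0}\|\le\lambda_{\rm Pic}\eta_\ell(u_\ell^{k,j})$. If then $\eta_\ell(u_\ell^{k,j})=0$, the algorithm stops. Otherwise choose $\mathcal M_\ell\subseteq\mathcal T_\ell$ with $\theta\,\eta_\ell(u_\ell^{k,j})\le\eta_\ell(\mathcal M_\ell,u_\ell^{k,j})$ whose cardinality is at most $C_{\rm mark}$ times the minimal one, and continue with $\mathcal T_{\ell+1}=\mathtt{refine}(\mathcal T_\ell,\mathcal M_\ell)$ and $u_{\ell+1}^{0,0}=u_\ell^{k,j}$. Let $\mathcal Q$ be the set of all index triples used, namely $(\ell,0,0)$ and $(\ell,k,j)$ with $k\ge1$, $j\ge0$, ordered by appearance (any of the loops may be infinite). Let $|(\ell,k,j)|$ be the number of earlier triples and $\underline\ell\in\mathbb N_0\cup\{\infty\}$ the supremum of all used $\ell$. With $u_\ell^{0,\star}:=u_\ell^{0,0}$,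 put $$\Delta_\ell^{k,j}=\|u^\star-u_\ell^{k,j}\|+\|u_\ell^{k,\star}-u_\ell^{k,j}\|+\eta_\ell(u_\ell^{k,j}).$$ For $s>0$ put $$\|u^\star\|_{\mathbb A_s}=\sup_{N\in\mathbb N_0}(N+1)^s\inf\{\|u^\star-u_{\rm opt}^\star\|+\eta_{\rm opt}(u_{\rm opt}^\star):\mathcal T_{\rm opt}\in\mathbb T,\ \#\mathcal T_{\rm opt}-\#\mathcal T_0\le N\}\in[0,\infty].$$ Let $q_{\rm Pic}=(1-\alpha^2/L^2)^{1/2}$, $C_{\rm Pic}=q_{\rm Pic}/(1-q_{\rm Pic})$ and $C_{\rm alg}=q_{\rm alg}/(1-q_{\rm alg})$. **Theorem 4 (optimal decay rate with respect to the overall computational cost).** There exist thresholds $\lambda_{\rm alg}^\star>0$ (depending only on $q_{\rm Pic},q_{\rm alg}$), $\lambda_{\rm Pic}^\star>0$ (depending only on $C_{\rm stab},q_{\rm Pic},q_{\rm alg}$) and $\theta^\star>0$ (depending only on $C_{\rm stab},C_{\rm rel},q_{\rm Pic},q_{\rm alg}$) such that, for all $0<\theta<\min\{1,\theta^\star\}$,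 $0<\lambda_{\rm alg}<1$ and $\lambda_{\rm Pic}>0$ with $\lambda_{\rm alg}+\lambda_{\rm alg}/\lambda_{\rm Pic}<\lambda_{\rm alg}^\star$ and $\lambda_{\rm Pic}/\theta<\lambda_{\rm Pic}^\star$, and for all $s>0$, the following holds. - $$0<\frac{\theta+C_{\rm stab}\big((1+C_{\rm Pic})C_{\rm alg}\lambda_{\rm alg}+[C_{\rm Pic}+(1+C_{\rm Pic})C_{\rm alg}\lambda_{\rm alg}]\lambda_{\rm Pic}\big)}{1-\lambda_{\rm Pic}/\lambda_{\rm Pic}^\star}<\frac1{1+C_{\rm stab}^2C_{\rm rel}^2}.$$ - There are constants $C_{\rm lin}\ge1$ and $0<q_{\rm lin}<1$ of linear convergence: $\Delta_{\ell'}^{k',j'}\le C_{\rm lin}\,q_{\rm lin}^{|(\ell',k',j')|-|(\ell,k,j)|}\Delta_\ell^{k,j}$ for all $(\ell,k,j)\le(\ell',k',j')$ in $\mathcal Q$. They depend only on $C_{\rm rel},C_{\rm stab},q_{\rm red},\theta,q_{\rm alg},\lambda_{\rm alg},q_{\rm Pic},\lambda_{\rm Pic},\alpha,L$. - There are constants $c_{\rm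 opt},C_{\rm opt}>0$ of optimality with respect to the degrees of freedom: $$c_{\rm opt}^{-1}\|u^\star\|_{\mathbb A_s}\le\sup_{(\ell,k,j)\in\mathcal Q}(\#\mathcal T_\ell-\#\mathcal T_0+1)^s\Delta_\ell^{k,j}\le C_{\rm opt}\max\{\|u^\star\|_{\mathbb A_s},\Delta_0^{0,0}\},$$ where the maximum can be replaced by $\|u^\star\|_{\mathbb A_s}$ if the supremum is restricted to $\ell\ge1$. Here $c_{\rm opt}$ depends only on $L/\alpha$, $C_{\rm stab}$, $C_{\rm rel}$, $C_{\rm son}$, $\#\mathcal T_0$, $s$ and $\underline\ell$; and $C_{\rm opt}$ depends only on $C_{\rm stab}$, $C_{\rm rel}$, $C_{\rm mark}$, $1-\lambda_{\rm Pic}/\lambda_{\rm Pic}^\star$, $L/\alpha$, $q_{\rm alg}$, $\lambda_{\rm alg}$, $q_{\rm Pic}$, $\lambda_{\rm Pic}$, $C_{\rm mesh}$, $C_{\rm lin}$, $q_{\rm lin}$, $\#\mathcal T_0$ and $s$. - With these constants and $C_{\rm opt}'=(\#\mathcal T_0)^s\,C_{\rm opt}\,C_{\rm lin}\,(1-q_{\rm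 lin}^{1/s})^{-s}$, $$c_{\rm opt}^{-1}\|u^\star\|_{\mathbb A_s}\le\sup_{(\ell',k',j')\in\mathcal Q}\Big(\sum_{\substack{(\ell,k,j)\in\mathcal Q\\(\ell,k,j)\le(\ell',k',j')}}\#\mathcal T_\ell\Big)^s\Delta_{\ell'}^{k',j'}\le C_{\rm opt}'\max\{\|u^\star\|_{\mathbb A_s},\Delta_0^{0,0}\},$$ and if the supremum and the sum are restricted to indices with $\ell'\ge1$ and $\ell\ge1$, the upper bound holds with $\|u^\star\|_{\mathbb A_s}$ in place of the maximum. -/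

import Mathlib

open Filter Topology
open scoped ENNReal

namespace AdaptiveFEM

/-! ## Galerkin solutions, linearized problems, mesh refinement -/

section Basics

variable {𝕜 V E : Type*}

/-- `A` is the derivative of the potential `P`: for all `w, v`, the difference quotients of `P`
at `w` in direction `v` (with real increments) converge to `A w v`, in the sense of real parts.
(For `𝕜 = ℝ` this is Gateaux differentiability with `dP = A`.) -/
def IsPotential [RCLike 𝕜] [NormedAddCommGroup V] [InnerProductSpace 𝕜 V]
    (P : V → 𝕜) (A : V → StrongDual 𝕜 V) : Prop :=
  ∀ w v : V, Tendsto (fun t : ℝ => RCLike.re ((P (w + (t : 𝕜) • v) - P w) / (t : 𝕜)))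
    (𝓝[≠] 0) (𝓝 (RCLike.re (A w v)))

/-- `u ∈ W` solves `⟨A u, v⟩ = F v` for all `v ∈ W`. -/
def IsSolution [RCLike 𝕜] [NormedAddCommGroup V] [InnerProductSpace 𝕜 V]
    (A : V → StrongDual 𝕜 V) (F : StrongDual 𝕜 V) (W : Submodule 𝕜 V) (u : V) : Prop :=
  u ∈ W ∧ ∀ v ∈ W, A u v = F v

/-- The solution `u ∈ W` of `⟨A u, v⟩ = F v` for all `v ∈ W` (it exists and is unique if `A` is
strongly monotone and Lipschitz continuous and `W` is closed). -/
noncomputable def solution [RCLike 𝕜] [NormedAddCommGroup V] [InnerProductSpace 𝕜 V]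
    (A : V → StrongDual 𝕜 V) (F : StrongDual 𝕜 V) (W : Submodule 𝕜 V) : V :=
  Classical.epsilon (IsSolution A F W)

/-- `w ∈ W` solves the linear system
`(w, v) = (u, v) - α / L² ⟨A u - F, v⟩` for all `v ∈ W`. -/
def IsPicardSolution [RCLike 𝕜] [NormedAddCommGroup V] [InnerProductSpace 𝕜 V]
    (A : V → StrongDual 𝕜 V) (F : StrongDual 𝕜 V) (α L : ℝ) (W : Submodule 𝕜 V) (u w : V) :
    Prop :=
  w ∈ W ∧ ∀ v ∈ W, inner 𝕜 w v = inner 𝕜 u v - ((α / L ^ 2 : ℝ) : 𝕜) * (A u - F) v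

/-- The exact solution `w ∈ W` of one step of the Banach--Picard linearization at `u`
(it exists and is unique if `W` is finite-dimensional). -/
noncomputable def picardSolution [RCLike 𝕜] [NormedAddCommGroup V] [InnerProductSpace 𝕜 V]
    (A : V → StrongDual 𝕜 V) (F : StrongDual 𝕜 V) (α L : ℝ) (W : Submodule 𝕜 V) (u : V) : V :=
  Classical.epsilon (IsPicardSolution A F α L W u)

/-- `Refines refine T T'`: the mesh `T'` is obtained from `T` by finitely many (possibly zero)
steps `T ↦ refine T M` with arbitrary marked elements `M ⊆ T`. -/
def Refines (refine : Finset E → Finset E → Finset E) : Finset E → Finset E → Prop :=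
  Relation.ReflTransGen fun T T' => ∃ M ⊆ T, T' = refine T M

end Basics

/-! ## The abstract setting -/

/-- The data of the problem and of its discretization: the operator `A`, the right-hand side `F`,
the initial mesh `T0`, the refinement strategy `refine T M` (a mesh is a finite set of elements),
the discrete space `X T` of a mesh `T`, and the refinement indicators `eta T t v` of the element
`t ∈ T` and the discrete function `v ∈ X T`. -/
structure Discretization (𝕜 V E : Type*) [RCLike 𝕜] [NormedAddCommGroup V]
    [InnerProductSpace 𝕜 V] where
  A : V → StrongDual 𝕜 V
  F : StrongDual 𝕜 V
  T0 : Finset E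
  refine : Finset E → Finset E → Finset E
  X : Finset E → Submodule 𝕜 V
  eta : Finset E → E → V → ℝ

namespace Discretization

variable {𝕜 V E : Type*} [RCLike 𝕜] [NormedAddCommGroup V] [InnerProductSpace 𝕜 V]
  (D : Discretization 𝕜 V E)

/-- The set of all meshes that can be generated from the initial mesh. -/
def meshes : Set (Finset E) := {T | Refines D.refine D.T0 T}

/-- The error estimator on a set `S` of elements of the mesh `T`. -/
noncomputable def estOn (T S : Finset E) (v : V) : ℝ := √(∑ t ∈ S, D.eta T t v ^ 2)

/-- The error estimator on the whole mesh `T`. -/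
noncomputable def est (T : Finset E) (v : V) : ℝ := D.estOn T T v

/-- The exact solution. -/
noncomputable def uStar : V := solution D.A D.F ⊤

/-- The exact discrete solution on the mesh `T`. -/
noncomputable def uStarOn (T : Finset E) : V := solution D.A D.F (D.X T)

/-- The approximation seminorm
`sup_N (N+1)^s inf { ‖u⋆ - u_T⋆‖ + η_T(u_T⋆) | T a mesh with #T - #T0 ≤ N }`. -/
noncomputable def approxNorm (s : ℝ) : ℝ≥0∞ :=
  ⨆ N : ℕ, ((N : ℝ≥0∞) + 1) ^ s *
    ⨅ T ∈ {T | T ∈ D.meshes ∧ T.card ≤ D.T0.card + N},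
      ENNReal.ofReal (‖D.uStar - D.uStarOn T‖ + D.est T (D.uStarOn T))

/-- The assumptions on the operator, on the mesh refinement, on the discrete spaces and on the
error estimator, with their constants. -/
structure Assumptions [DecidableEq E] (α L Cson Cmesh Cstab Crel qred : ℝ) : Prop where
  /-- `A` has a potential -/
  potential : ∃ P : V → 𝕜, IsPotential P D.A
  /-- strong monotonicity -/
  monotone : ∀ w v : V, α * ‖w - v‖ ^ 2 ≤ RCLike.re ((D.A w - D.A v) (w - v))
  /-- Lipschitz continuity -/
  lipschitz : ∀ w v : V, ‖D.A w - D.A v‖ ≤ L * ‖w - v‖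
  /-- the initial mesh is nonempty -/
  nonempty : D.T0.Nonempty
  /-- marked elements are refined -/
  marked_refined : ∀ T ∈ D.meshes, ∀ M ⊆ T, M ⊆ T \ D.refine T M
  /-- the discrete spaces are finite-dimensional -/
  finiteDimensional : ∀ T ∈ D.meshes, FiniteDimensional 𝕜 (D.X T)
  /-- the discrete spaces are proper subspaces -/
  proper : ∀ T ∈ D.meshes, D.X T ≠ ⊤
  /-- the discrete spaces are nested -/
  nested : ∀ T ∈ D.meshes, ∀ T', Refines D.refine T T' → D.X T ≤ D.X T'
  /-- the indicators are nonnegative -/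
  eta_nonneg : ∀ T ∈ D.meshes, ∀ t ∈ T, ∀ v ∈ D.X T, 0 ≤ D.eta T t v
  /-- splitting property -/
  splitting : ∀ T ∈ D.meshes, ∀ M ⊆ T,
    (T \ D.refine T M).card + T.card ≤ (D.refine T M).card ∧
    ((D.refine T M).card : ℝ) ≤
      Cson * ((T \ D.refine T M).card : ℝ) + ((T ∩ D.refine T M).card : ℝ)
  /-- overlay estimate -/
  overlay : ∀ T ∈ D.meshes, ∀ T₁ T₂, Refines D.refine T T₁ → Refines D.refine T T₂ →
    ∃ T₃, Refines D.refine T₁ T₃ ∧ Refines D.refine T₂ T₃ ∧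
      T₃.card + T.card ≤ T₁.card + T₂.card
  /-- mesh-closure estimate -/
  closure : ∀ T M : ℕ → Finset E, T 0 = D.T0 →
    (∀ l, M l ⊆ T l ∧ T (l + 1) = D.refine (T l) (M l)) →
    ∀ l, ((T l).card : ℝ) - (D.T0.card : ℝ) ≤ Cmesh * ∑ i ∈ Finset.range l, ((M i).card : ℝ)
  /-- stability -/
  stability : ∀ T ∈ D.meshes, ∀ T', Refines D.refine T T' → ∀ S ⊆ T ∩ T',
    ∀ v' ∈ D.X T', ∀ v ∈ D.X T, |D.estOn T' S v' - D.estOn T S v| ≤ Cstab * ‖v' - v‖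
  /-- reduction -/
  reduction : ∀ T ∈ D.meshes, ∀ T', Refines D.refine T T' →
    ∀ v ∈ D.X T, D.estOn T' (T' \ T) v ≤ qred * D.estOn T (T \ T') v
  /-- reliability -/
  reliability : ∀ T ∈ D.meshes, ‖D.uStar - D.uStarOn T‖ ≤ Crel * D.est T (D.uStarOn T)
  /-- discrete reliability -/
  discrete_reliability : ∀ T ∈ D.meshes, ∀ T', Refines D.refine T T' →
    ‖D.uStarOn T' - D.uStarOn T‖ ≤ Crel * D.estOn T (T \ T') (D.uStarOn T)

end Discretization

/-! ## The adaptive algorithm -/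

/-- The objects generated by the algorithm: the meshes `mesh l`, the sets `marked l` of marked
elements, and the iterates `u l k j` with mesh index `l`, linearization index `k`, and algebraic
solver index `j`. Only the values at indices that the algorithm uses are relevant. -/
structure Iterates (V E : Type*) where
  mesh : ℕ → Finset E
  marked : ℕ → Finset E
  u : ℕ → ℕ → ℕ → V

namespace Iterates

variable {𝕜 V E : Type*} [RCLike 𝕜] [NormedAddCommGroup V] [InnerProductSpace 𝕜 V]
  (D : Discretization 𝕜 V E) (lamAlg lamPic : ℝ) (R : Iterates V E)

/-- Stopping criterion of the algebraic solver (used for `k, j ≥ 1`). Here `R.u l k 0` is the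
final iterate of the previous linearization step (nested iteration). -/
def AlgStop (l k j : ℕ) : Prop :=
  ‖R.u l k j - R.u l k (j - 1)‖ ≤
    lamAlg * (D.est (R.mesh l) (R.u l k j) + ‖R.u l k j - R.u l k 0‖)

/-- Stopping criterion of the linearization (used for `k, j ≥ 1` if the algebraic solver stops at
`j`). Here `R.u l k 0` is the final iterate of the previous linearization step. -/
def PicStop (l k j : ℕ) : Prop :=
  ‖R.u l k j - R.u l k 0‖ ≤ lamPic * D.est (R.mesh l) (R.u l k j)

open Classical in
/-- The index triple that the algorithm uses after `(l, k, j)`, or `none` if it stops there. -/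
noncomputable def next : ℕ × ℕ × ℕ → Option (ℕ × ℕ × ℕ)
  | (l, k, j) =>
    if k = 0 then some (l, 1, 0)
    else if j = 0 then some (l, k, 1)
    else if ¬ R.AlgStop D lamAlg l k j then some (l, k, j + 1)
    else if ¬ R.PicStop D lamPic l k j then some (l, k + 1, 0)
    else if D.est (R.mesh l) (R.u l k j) = 0 then none
    else some (l + 1, 0, 0)

/-- The index triple that the algorithm uses in its `n`-th step, or `none` if it has stopped. -/
noncomputable def step : ℕ → Option (ℕ × ℕ × ℕ)
  | 0 => some (0, 0, 0)
  | n + 1 => (step n).bind (R.next D lamAlg lamPic)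

/-- The set of all index triples that the algorithm uses. -/
def Q : Set (ℕ × ℕ × ℕ) := {q | ∃ n, R.step D lamAlg lamPic n = some q}

/-- The triple `q` appears earlier in the algorithm than `q'`. -/
def Before (q q' : ℕ × ℕ × ℕ) : Prop :=
  ∃ m n, m < n ∧ R.step D lamAlg lamPic m = some q ∧ R.step D lamAlg lamPic n = some q'

/-- The triple `q` appears earlier in the algorithm than `q'`, or they are equal. -/
def BeforeEq (q q' : ℕ × ℕ × ℕ) : Prop := R.Before D lamAlg lamPic q q' ∨ q = q'

/-- The total step number of a triple: the number of triples that appear earlier. -/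
noncomputable def stepNumber (q : ℕ × ℕ × ℕ) : ℕ :=
  {q' | q' ∈ R.Q D lamAlg lamPic ∧ R.Before D lamAlg lamPic q' q}.ncard

/-- The supremum of all mesh indices that the algorithm uses. -/
noncomputable def lastLevel : ℕ∞ := ⨆ l ∈ {l : ℕ | (l, 0, 0) ∈ R.Q D lamAlg lamPic}, (l : ℕ∞)

/-- The exact solution of the linear system of the linearization step `k` on the mesh `l`; by
convention the initial iterate if `k = 0`. -/
noncomputable def uLin (α L : ℝ) (l k : ℕ) : V :=
  if k = 0 then R.u l 0 0 else picardSolution D.A D.F α L (D.X (R.mesh l)) (R.u l k 0)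

/-- The quasi-error: overall error plus algebraic error plus error estimator. -/
noncomputable def Delta (α L : ℝ) : ℕ × ℕ × ℕ → ℝ
  | (l, k, j) => ‖D.uStar - R.u l k j‖ + ‖R.uLin D α L l k - R.u l k j‖ +
      D.est (R.mesh l) (R.u l k j)

/-- The cumulative cost up to `q`: the sum of the number of elements of the mesh over all steps
of the algorithm up to and including `q`. -/
noncomputable def cost (q : ℕ × ℕ × ℕ) : ℝ≥0∞ :=
  ∑' p : {p : ℕ × ℕ × ℕ // p ∈ R.Q D lamAlg lamPic ∧ R.BeforeEq D lamAlg lamPic p q},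
    ((R.mesh p.1.1).card : ℝ≥0∞)

/-- The cumulative cost up to `q` without the steps on the initial mesh. -/
noncomputable def costAfterZero (q : ℕ × ℕ × ℕ) : ℝ≥0∞ :=
  ∑' p : {p : ℕ × ℕ × ℕ // p ∈ R.Q D lamAlg lamPic ∧ R.BeforeEq D lamAlg lamPic p q ∧ 1 ≤ p.1},
    ((R.mesh p.1.1).card : ℝ≥0∞)

/-- `sup (#T_l - #T_0 + 1)^s Δ` over all triples `(l, k, j)` of the set `S`. -/
noncomputable def dofRate (α L s : ℝ) (S : Set (ℕ × ℕ × ℕ)) : ℝ≥0∞ :=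
  ⨆ q ∈ S, ENNReal.ofReal
    ((((R.mesh q.1).card : ℝ) - (D.T0.card : ℝ) + 1) ^ s * R.Delta D α L q)

end Iterates

/-- `R` is generated by the adaptive algorithm with the parameters `θ`, `lamAlg`, `lamPic`,
`Cmark` and an algebraic solver with contraction factor `qalg`. -/
structure IsRun {𝕜 V E : Type*} [RCLike 𝕜] [NormedAddCommGroup V] [InnerProductSpace 𝕜 V]
    (D : Discretization 𝕜 V E) (α L θ lamAlg lamPic Cmark qalg : ℝ) (R : Iterates V E) :
    Prop where
  /-- initial mesh -/
  mesh_zero : R.mesh 0 = D.T0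
  /-- initial guess -/
  u_zero : R.u 0 0 0 ∈ D.X D.T0
  /-- passing to the next linearization step: nested iteration -/
  next_linearization : ∀ l k j, (l, k, j) ∈ R.Q D lamAlg lamPic →
    R.next D lamAlg lamPic (l, k, j) = some (l, k + 1, 0) → R.u l (k + 1) 0 = R.u l k j
  /-- one step of the contractive algebraic solver for the current linear system -/
  solver_step : ∀ l k j, (l, k, j) ∈ R.Q D lamAlg lamPic →
    R.next D lamAlg lamPic (l, k, j) = some (l, k, j + 1) →
    R.u l k (j + 1) ∈ D.X (R.mesh l) ∧
    ‖R.uLin D α L l k - R.u l k (j + 1)‖ ≤ qalg * ‖R.uLin D α L l k - R.u l k j‖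
  /-- passing to the next mesh: Doerfler marking with quasi-minimal cardinality, refinement,
  nested iteration -/
  next_mesh : ∀ l k j, (l, k, j) ∈ R.Q D lamAlg lamPic →
    R.next D lamAlg lamPic (l, k, j) = some (l + 1, 0, 0) →
    R.marked l ⊆ R.mesh l ∧
    θ * D.est (R.mesh l) (R.u l k j) ≤ D.estOn (R.mesh l) (R.marked l) (R.u l k j) ∧
    (∀ M ⊆ R.mesh l, θ * D.est (R.mesh l) (R.u l k j) ≤ D.estOn (R.mesh l) M (R.u l k j) →
      ((R.marked l).card : ℝ) ≤ Cmark * (M.card : ℝ)) ∧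
    R.mesh (l + 1) = D.refine (R.mesh l) (R.marked l) ∧
    R.u (l + 1) 0 0 = R.u l k j

/-! ## Constants -/

/-- The contraction factor of the exact Banach--Picard iteration. -/
noncomputable def qPicard (α L : ℝ) : ℝ := √(1 - α ^ 2 / L ^ 2)

/-- The perturbed marking parameter `θ'`, with `CPic = qPic / (1 - qPic)`,
`Calg = qalg / (1 - qalg)`, and `lamPicS` the upper threshold for `lamPic / θ`. -/
noncomputable def thetaPrime (Cstab CPic Calg θ lamAlg lamPic lamPicS : ℝ) : ℝ :=
  (θ + Cstab * ((1 + CPic) * Calg * lamAlg + (CPic + (1 + CPic) * Calg * lamAlg) * lamPic)) /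
    (1 - lamPic / lamPicS)

end AdaptiveFEM

/-! The proof has three parts.

*Linear convergence.* It suffices to bound all tail sums of the quasi-error over the steps of the
algorithm by a multiple of their first term (`le_geometric_of_sum_le`). The three nested loops are
treated one by one (`sum_le_of_triple_loop`). As long as the algebraic solver does not stop, the
quasi-error is dominated by the algebraic error, which contracts (`Delta_le_of_not_algStop`). As long
as the linearization does not stop, the quasi-error at the start of an inner loop is dominated by the
distance of the iterate to the Galerkin solution, and for small `lamAlg + lamAlg / lamPic` the inexact
Picard iteration still contracts that distance (`picard_contraction`). When both stop, everything is
dominated by the estimator of the final iterate, which is equivalent to the estimator of the Galerkin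
solution; if `lamPic / θ` is small, then the latter also satisfies a Dörfler criterion
(`doerfler_uStarOn`). Estimator reduction and the quasi-orthogonality of Galerkin solutions, which
comes from the energy associated with the potential, then show that these estimators are square
summable over the levels, hence decay linearly, hence are summable (`exists_sum_est_uStarOn_le`).

*Upper bounds.* Overlaying the current mesh with a nearly optimal coarse mesh produces a small set of
elements that satisfies the Dörfler criterion for the Galerkin solution with the parameter
`(1 + Cstab² Crel²)⁻¹` (`exists_doerfler_card_le`), so that quasi-minimal marking marks few elements
(`card_marked_le`). The closure estimate and linear convergence sum this up to the rate with respect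
to the degrees of freedom (`dof_rpow_mul_Delta_le`); by linear convergence once more, this rate is
equivalent to the one with respect to the cumulative cost (`sum_card_rpow_mul_Delta_le`). Both
summations are instances of `sum_rpow_mul_le_of_linear_convergence`.

*Lower bounds.* The generated meshes compete in the definition of the approximation seminorm, and one
refinement step increases the number of elements at most by the factor `Cson`. If the number of
elements stays bounded, then the quasi-error becomes arbitrarily small on admissible meshes
(`approxNorm_le`).
-/

namespace AdaptiveFEM

/-! ### Decay of sequences generated by nested loops -/

theorem geom_sum_le_inv {r : ℝ} (h0 : 0 ≤ r) (h1 : r < 1) (n : ℕ) :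
    ∑ i ∈ Finset.range n, r ^ i ≤ (1 - r)⁻¹ := by
  have := geom_sum_Ico_le_of_lt_one (m := 0) (n := n) h0 h1
  simpa using this

/-- If all tail sums up to `N` are bounded by a multiple of their first term, then the sequence
decays linearly: each tail sum is a fixed factor smaller than the preceding one. -/
theorem le_geometric_of_sum_le {a : ℕ → ℝ} {K : ℝ} {N : ℕ} (hK : 1 ≤ K)
    (h : ∀ n ≤ N, ∑ i ∈ Finset.Ico n (N + 1), a i ≤ K * a n) {n : ℕ} (hn : n ≤ N) :
    a N ≤ K * (1 - K⁻¹) ^ (N - n) * a n := by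
  have hK0 : 0 < K := by linarith
  have hq : 0 ≤ 1 - K⁻¹ := by
    have := inv_le_one_of_one_le₀ hK
    linarith
  have key : ∀ d, n + d ≤ N → ∑ i ∈ Finset.Ico (n + d) (N + 1), a i ≤
      (1 - K⁻¹) ^ d * ∑ i ∈ Finset.Ico n (N + 1), a i := by
    intro d
    induction d with
    | zero => intro _; simp
    | succ d ih =>
      intro hd
      have h1 := ih (by omega)
      have h2 := h (n + d) (by omega)
      have h3 := Finset.sum_eq_sum_Ico_succ_bot (show n + d < N + 1 by omega) a
      have h4 : K⁻¹ * ∑ i ∈ Finset.Ico (n + d) (N + 1), a i ≤ a (n + d) := by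
        rw [inv_mul_le_iff₀ hK0]; exact h2
      calc ∑ i ∈ Finset.Ico (n + (d + 1)) (N + 1), a i
          ≤ (1 - K⁻¹) * ∑ i ∈ Finset.Ico (n + d) (N + 1), a i := by
            rw [show n + (d + 1) = n + d + 1 by ring]; linarith
        _ ≤ (1 - K⁻¹) * ((1 - K⁻¹) ^ d * ∑ i ∈ Finset.Ico n (N + 1), a i) := by gcongr
        _ = _ := by ring
  have h1 := key (N - n) (by omega)
  rw [show n + (N - n) = N by omega] at h1
  simp only [Nat.Ico_succ_singleton, Finset.sum_singleton] at h1
  calc a N ≤ _ := h1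
    _ ≤ (1 - K⁻¹) ^ (N - n) * (K * a n) := by gcongr; exact h n hn
    _ = _ := by ring

theorem sum_le_of_sum_sq_le {g : ℕ → ℝ} {K : ℝ} {N : ℕ} (hK : 1 ≤ K) (hg : ∀ n, 0 ≤ g n)
    (h : ∀ n m, n ≤ m → m ≤ N → ∑ i ∈ Finset.Ico n (m + 1), g i ^ 2 ≤ K * g n ^ 2)
    {n : ℕ} (hn : n ≤ N) :
    ∑ i ∈ Finset.Ico n (N + 1), g i ≤ √K * (1 - √(1 - K⁻¹))⁻¹ * g n := by
  have hq : 0 ≤ 1 - K⁻¹ := by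
    have := inv_le_one_of_one_le₀ hK
    linarith
  have hq1 : √(1 - K⁻¹) < 1 := by
    rw [Real.sqrt_lt' one_pos]
    have : 0 < K⁻¹ := by positivity
    linarith
  have h1 : ∀ d, n + d ≤ N → g (n + d) ≤ √K * √(1 - K⁻¹) ^ d * g n := by
    intro d hd
    have := le_geometric_of_sum_le (a := fun i => g i ^ 2) (N := n + d) hK
      (fun i hi => h i (n + d) hi hd) (n := n) (by omega)
    rw [show n + d - n = d by omega] at this
    refine abs_le_of_sq_le_sq' ?_ (by have := hg n; positivity) |>.2
    rw [mul_pow, mul_pow, Real.sq_sqrt (by linarith), ← pow_mul, mul_comm d 2, pow_mul,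
      Real.sq_sqrt hq]
    exact this
  rw [Finset.sum_Ico_eq_sum_range]
  calc ∑ i ∈ Finset.range (N + 1 - n), g (n + i)
      ≤ ∑ i ∈ Finset.range (N + 1 - n), √K * √(1 - K⁻¹) ^ i * g n := by
        refine Finset.sum_le_sum fun i hi => h1 i ?_
        have := Finset.mem_range.1 hi
        omega
    _ = √K * (∑ i ∈ Finset.range (N + 1 - n), √(1 - K⁻¹) ^ i) * g n := by
        rw [Finset.mul_sum, Finset.sum_mul]
    _ ≤ _ := by
        gcongr
        · exact hg n
        · exact geom_sum_le_inv (Real.sqrt_nonneg _) hq1 _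

/-- Bounds for the sums over parts of blocks of indices, where `B` marks the first index of a block,
reduce the bound of a sum to the bound of a sum over the first indices of blocks. -/
theorem sum_le_of_blocks {x : ℕ → ℝ} {N : ℕ} {K : ℝ} (B : ℕ → Prop) [DecidablePred B]
    (h : ∀ n m, n ≤ m → m ≤ N → (∀ i, n < i → i ≤ m → ¬ B i) →
      ∑ i ∈ Finset.Ico n (m + 1), x i ≤ K * x n) {n : ℕ} (hn : n ≤ N) :
    ∑ i ∈ Finset.Ico n (N + 1), x i ≤
      K * (x n + ∑ i ∈ Finset.Ioc n N with B i, x i) := by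
  induction hd : N - n using Nat.strong_induction_on generalizing n with
  | _ d ih =>
  by_cases hB : ∃ i, n < i ∧ i ≤ N ∧ B i
  · classical
    obtain ⟨h1, h2, h3⟩ := Nat.find_spec hB
    have hmin : ∀ i, n < i → i < Nat.find hB → ¬ B i := fun i hi hlt hb =>
      Nat.find_min hB hlt ⟨hi, by omega, hb⟩
    generalize Nat.find hB = b at h1 h2 h3 hmin
    have e1 := ih (N - b) (by omega) h2 rfl
    have e2 := h n (b - 1) (by omega) (by omega) (fun i hi hi' => hmin i hi (by omega))
    rw [show b - 1 + 1 = b by omega] at e2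
    rw [← Finset.sum_Ico_consecutive x (show n ≤ b by omega) (show b ≤ N + 1 by omega)]
    have e3 : ∑ i ∈ Finset.Ioc n N with B i, x i =
        x b + ∑ i ∈ Finset.Ioc b N with B i, x i := by
      have : (Finset.Ioc n N).filter B = insert b ((Finset.Ioc b N).filter B) := by
        ext i
        simp only [Finset.mem_filter, Finset.mem_Ioc, Finset.mem_insert]
        constructor
        · rintro ⟨⟨hi1, hi2⟩, hi3⟩
          have : ¬ i < b := fun hlt => hmin i hi1 hlt hi3
          rcases (show i = b ∨ b < i by omega) with h | h
          · exact Or.inl h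
          · exact Or.inr ⟨⟨h, hi2⟩, hi3⟩
        · rintro (rfl | ⟨⟨hi1, hi2⟩, hi3⟩)
          · exact ⟨⟨h1, h2⟩, h3⟩
          · exact ⟨⟨by omega, hi2⟩, hi3⟩
      rw [this, Finset.sum_insert (by simp)]
    rw [e3]
    linarith
  · push Not at hB
    have e2 := h n N hn le_rfl hB
    have : (Finset.Ioc n N).filter B = ∅ := by
      ext i
      simp only [Finset.mem_filter, Finset.mem_Ioc, Finset.notMem_empty, iff_false]
      rintro ⟨⟨h1, h2⟩, h3⟩
      exact hB i h1 h2 h3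
    rw [this]
    simpa using e2

/-- One step of a triple loop, with bounds for the quantity `x` whose decay is studied, the error `a`
of the inner loop, the error `f` of the middle loop, and the error `g` of the outer loop. A step
proceeds in the inner loop, starts the next inner loop, or starts the next middle loop; that the
inner loop was continued bounds `x` by the error `a` of the preceding inner step. -/
def LoopStep (C q : ℝ) (x a : ℕ × ℕ × ℕ → ℝ) (f : ℕ → ℕ → ℝ) (g : ℕ → ℝ) :
    ℕ × ℕ × ℕ → ℕ × ℕ × ℕ → Prop
  | (l, k, j), t =>
    (t = (l, k, j + 1) ∧ x t ≤ C * x (l, k, j) ∧ a t ≤ q * a (l, k, j) ∧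
      (1 ≤ j → x t ≤ C * a (l, k, j - 1))) ∨
    (t = (l, k + 1, 0) ∧ x t ≤ C * x (l, k, j) ∧ f l (k + 1) ≤ C * x t ∧
      (1 ≤ k → x t ≤ C * f l k ∧ f l (k + 1) ≤ q * f l k)) ∨
    (t = (l + 1, 0, 0) ∧ x t ≤ C * g l)

section Loops

variable {C q : ℝ} {N : ℕ} {p : ℕ → ℕ × ℕ × ℕ} {x a : ℕ × ℕ × ℕ → ℝ} {f : ℕ → ℕ → ℝ} {g : ℕ → ℝ}

/-- From the second step on, `x` is dominated by the contracting error `a` of two steps before. -/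
theorem sum_le_of_inner_loop (hC : 1 ≤ C) (hq1 : q < 1) (hx : ∀ t, 0 ≤ x t)
    (ha : ∀ t, 0 ≤ a t) (hax : ∀ m ≤ N, a (p m) ≤ x (p m))
    (hstep : ∀ m < N, LoopStep C q x a f g (p m) (p (m + 1))) {n m : ℕ} (hnm : n ≤ m)
    (hm : m ≤ N) (hB : ∀ i, n < i → i ≤ m → (p i).2.2 ≠ 0) :
    ∑ i ∈ Finset.Ico n (m + 1), x (p i) ≤ (1 + C + C * (1 - q)⁻¹) * x (p n) ∧
      (p m).1 = (p n).1 ∧ (p m).2.1 = (p n).2.1 := by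
  have hq : 0 < 1 - q := by linarith
  have step : ∀ i, n ≤ i → i < m → p (i + 1) = ((p i).1, (p i).2.1, (p i).2.2 + 1) ∧
      x (p (i + 1)) ≤ C * x (p i) ∧ a (p (i + 1)) ≤ q * a (p i) ∧
      (1 ≤ (p i).2.2 → x (p (i + 1)) ≤ C * a ((p i).1, (p i).2.1, (p i).2.2 - 1)) := by
    intro i hi him
    have h0 := hB (i + 1) (by omega) (by omega)
    rcases hstep i (by omega) with h | h | h
    · exact h
    · rw [h.1] at h0; exact absurd rfl h0
    · rw [h.1] at h0; exact absurd rfl h0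
  have pos : ∀ d, n + d ≤ m → p (n + d) = ((p n).1, (p n).2.1, (p n).2.2 + d) := by
    intro d
    induction d with
    | zero => intro _; rfl
    | succ d ih =>
      intro hd
      have h1 := ih (by omega)
      have h2 := (step (n + d) (by omega) (by omega)).1
      rw [h1] at h2
      exact h2
  have hpm := pos (m - n) (by omega)
  rw [show n + (m - n) = m by omega] at hpm
  refine ⟨?_, by rw [hpm], by rw [hpm]⟩
  have hc : 0 ≤ C * (1 - q)⁻¹ := by positivity
  have key : ∀ d, n + d + 1 ≤ m → ∑ i ∈ Finset.Ico n (n + d + 1 + 1), x (p i) +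
      C * (1 - q)⁻¹ * a (p (n + d)) ≤ (1 + C + C * (1 - q)⁻¹) * x (p n) := by
    intro d
    induction d with
    | zero =>
      intro hd
      have h1 := (step n le_rfl (by omega)).2.1
      have h2 := hax n (by omega)
      rw [Finset.sum_Ico_succ_top (by omega), Finset.sum_Ico_succ_top (by omega)]
      simp only [Finset.Ico_self, Finset.sum_empty, add_zero]
      have := mul_le_mul_of_nonneg_left h2 hc
      linarith
    | succ d ih =>
      intro hd
      have h1 := ih (by omega)
      have h2 := step (n + d) (by omega) (by omega)
      have h3 := step (n + d + 1) (by omega) (by omega)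
      have h4 : x (p (n + d + 1 + 1)) ≤ C * a (p (n + d)) := by
        have := h3.2.2.2
        rw [h2.1] at this
        exact this (by simp)
      rw [show n + (d + 1) + 1 = n + d + 1 + 1 by ring, show n + (d + 1) = n + d + 1 by ring,
        Finset.sum_Ico_succ_top (by omega)]
      have h5 : C * (1 - q)⁻¹ * a (p (n + d + 1)) ≤ C * (1 - q)⁻¹ * (q * a (p (n + d))) :=
        mul_le_mul_of_nonneg_left h2.2.2.1 hc
      have h6 : C * a (p (n + d)) + C * (1 - q)⁻¹ * (q * a (p (n + d))) =
          C * (1 - q)⁻¹ * a (p (n + d)) := by field_simp; ring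
      linarith
  rcases eq_or_lt_of_le hnm with rfl | hlt
  · simp only [Nat.Ico_succ_singleton, Finset.sum_singleton]
    have := mul_nonneg hc (hx (p n))
    have := mul_nonneg (by linarith : 0 ≤ C) (hx (p n))
    linarith
  · have h1 := key (m - n - 1) (by omega)
    rw [show n + (m - n - 1) + 1 = m by omega] at h1
    have := mul_nonneg hc (ha (p (n + (m - n - 1))))
    linarith

theorem sum_le_of_middle_loop (hC : 1 ≤ C) (hq1 : q < 1) (hx : ∀ t, 0 ≤ x t)
    (ha : ∀ t, 0 ≤ a t) (hf : ∀ l k, 0 ≤ f l k) (hax : ∀ m ≤ N, a (p m) ≤ x (p m))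
    (hstep : ∀ m < N, LoopStep C q x a f g (p m) (p (m + 1))) :
    ∃ K, K = (1 + C + C * (1 - q)⁻¹) *
      (1 + (1 + C * C * (1 - q)⁻¹) * C * (1 + C + C * (1 - q)⁻¹)) ∧
    ∀ {n m : ℕ}, n ≤ m → m ≤ N →
    (∀ i, n < i → i ≤ m → ¬ ((p i).2.1 = 0 ∧ (p i).2.2 = 0)) →
    ∑ i ∈ Finset.Ico n (m + 1), x (p i) ≤ K * x (p n) ∧ (p m).1 = (p n).1 := by
  have hq : 0 < 1 - q := by linarith
  have hqi : 0 < (1 - q)⁻¹ := by positivity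
  refine ⟨_, rfl, fun {n m} hnm hm hB => ?_⟩
  set K1 := 1 + C + C * (1 - q)⁻¹ with hK1
  have hK1pos : 1 ≤ K1 := by
    have : 0 ≤ C * (1 - q)⁻¹ := by positivity
    linarith
  have inner := fun {n m : ℕ} => sum_le_of_inner_loop (n := n) (m := m) hC hq1 hx ha hax hstep
  -- the sum of `x` over the starts of inner loops telescopes once the initial one has been left
  have key : ∀ d, n + d ≤ m → (p (n + d)).1 = (p n).1 ∧
      ((∀ i, n < i → i ≤ n + d → (p i).2.2 ≠ 0) ∨
      ((p n).2.1 < (p (n + d)).2.1 ∧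
        ∑ i ∈ Finset.Ioc n (n + d) with (p i).2.2 = 0, x (p i) +
        C * (1 - q)⁻¹ * f (p n).1 (p (n + d)).2.1 ≤
          (1 + C * C * (1 - q)⁻¹) * C * K1 * x (p n))) := by
    intro d
    induction d with
    | zero => exact fun _ => ⟨rfl, Or.inl fun i h1 h2 => by omega⟩
    | succ d ih =>
      intro hd
      obtain ⟨hl, hcase⟩ := ih (by omega)
      have hB' := hB (n + d + 1) (by omega) (by omega)
      have hsplit : ∑ i ∈ Finset.Ioc n (n + d + 1) with (p i).2.2 = 0, x (p i) =
          ∑ i ∈ Finset.Ioc n (n + d) with (p i).2.2 = 0, x (p i) +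
            if (p (n + d + 1)).2.2 = 0 then x (p (n + d + 1)) else 0 := by
        rw [Finset.sum_filter, Finset.sum_filter, Finset.sum_Ioc_succ_top (by omega)]
      rw [show n + (d + 1) = n + d + 1 by ring, hsplit]
      rcases hstep (n + d) (by omega) with h | h | h
      · -- a step of the inner loop
        have e1 : (p (n + d + 1)).1 = (p (n + d)).1 := by rw [h.1]
        have e2 : (p (n + d + 1)).2.1 = (p (n + d)).2.1 := by rw [h.1]
        have e3 : (p (n + d + 1)).2.2 ≠ 0 := by rw [h.1]; simp
        refine ⟨e1.trans hl, ?_⟩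
        rcases hcase with hc | hc
        · left
          intro i hi1 hi2
          rcases (show i ≤ n + d ∨ i = n + d + 1 by omega) with hi | rfl
          · exact hc i hi1 hi
          · exact e3
        · right
          rw [e2, if_neg e3, add_zero]
          exact hc
      · -- the start of an inner loop
        have e1 : (p (n + d + 1)).1 = (p (n + d)).1 := by rw [h.1]
        have e2 : (p (n + d + 1)).2.1 = (p (n + d)).2.1 + 1 := by rw [h.1]
        have e3 : (p (n + d + 1)).2.2 = 0 := by rw [h.1]
        refine ⟨e1.trans hl, Or.inr ?_⟩
        obtain ⟨-, h1, h2, h3⟩ := h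
        change x _ ≤ C * x (p (n + d)) at h1
        rw [if_pos e3, e2]
        rw [hl] at h2 h3
        rcases hcase with hc | hc
        · have hin := inner (n := n) (m := n + d) (by omega) (by omega) hc
          rw [hin.2.2]
          refine ⟨by omega, ?_⟩
          have hz : ∑ i ∈ Finset.Ioc n (n + d) with (p i).2.2 = 0, x (p i) = 0 := by
            refine Finset.sum_eq_zero fun i hi => ?_
            simp only [Finset.mem_filter, Finset.mem_Ioc] at hi
            exact absurd hi.2 (hc i hi.1.1 hi.1.2)
          have hx1 : x (p (n + d)) ≤ K1 * x (p n) :=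
            (Finset.single_le_sum (f := fun i => x (p i)) (fun i _ => hx _)
              (Finset.mem_Ico.2 ⟨by omega, by omega⟩)).trans hin.1
          rw [hin.2.2] at h2
          have hx2 : x (p (n + d + 1)) ≤ C * K1 * x (p n) := by
            calc _ ≤ C * x (p (n + d)) := h1
              _ ≤ C * (K1 * x (p n)) := by gcongr
              _ = _ := by ring
          have hc0 : 0 ≤ C * (1 - q)⁻¹ := by positivity
          calc _ ≤ 0 + x (p (n + d + 1)) + C * (1 - q)⁻¹ * (C * x (p (n + d + 1))) := by
                rw [hz]; gcongr
            _ = (1 + C * C * (1 - q)⁻¹) * x (p (n + d + 1)) := by ring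
            _ ≤ (1 + C * C * (1 - q)⁻¹) * (C * K1 * x (p n)) := by gcongr
            _ = _ := by ring
        · obtain ⟨hk, hc⟩ := hc
          refine ⟨by omega, ?_⟩
          obtain ⟨h3, h4⟩ := h3 (lt_of_le_of_lt (Nat.zero_le _) hk)
          have h5 : C * (1 - q)⁻¹ * f (p n).1 ((p (n + d)).2.1 + 1) ≤
              C * (1 - q)⁻¹ * (q * f (p n).1 (p (n + d)).2.1) := by gcongr
          have h6 : C * f (p n).1 (p (n + d)).2.1 +
              C * (1 - q)⁻¹ * (q * f (p n).1 (p (n + d)).2.1) =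
              C * (1 - q)⁻¹ * f (p n).1 (p (n + d)).2.1 := by field_simp; ring
          linarith
      · exact absurd ⟨by rw [h.1], by rw [h.1]⟩ hB'
  have hsum : ∀ d, n + d ≤ m → ∑ i ∈ Finset.Ioc n (n + d) with (p i).2.2 = 0, x (p i) ≤
      (1 + C * C * (1 - q)⁻¹) * C * K1 * x (p n) := by
    intro d hd
    have hxn := hx (p n)
    have hc0 : 0 ≤ C * (1 - q)⁻¹ := by positivity
    rcases (key d hd).2 with hc | hc
    · rw [Finset.sum_eq_zero]
      · positivity
      · intro i hi
        simp only [Finset.mem_filter, Finset.mem_Ioc] at hi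
        exact absurd hi.2 (hc i hi.1.1 hi.1.2)
    · have := mul_nonneg hc0 (hf (p n).1 (p (n + d)).2.1)
      linarith [hc.2]
  have hnm' : n + (m - n) = m := by omega
  have h1 := hsum (m - n) (by omega)
  have h2 := (key (m - n) (by omega)).1
  rw [hnm'] at h1 h2
  refine ⟨?_, h2⟩
  have h3 := sum_le_of_blocks (x := fun i => x (p i)) (N := m) (K := K1) (fun i => (p i).2.2 = 0)
    (fun n' m' h1 h2 h3 => (inner h1 (by omega) h3).1) hnm
  calc _ ≤ _ := h3
    _ ≤ K1 * (x (p n) + (1 + C * C * (1 - q)⁻¹) * C * K1 * x (p n)) := by gcongr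
    _ = _ := by ring

/-- The sum of `x` over the steps of a triple loop is bounded by a multiple of its first term, if the
errors `g` of the outer loop are summable in this sense. -/
theorem sum_le_of_triple_loop (hC : 1 ≤ C) (hq1 : q < 1) (hx : ∀ t, 0 ≤ x t)
    (ha : ∀ t, 0 ≤ a t) (hf : ∀ l k, 0 ≤ f l k) (hax : ∀ m ≤ N, a (p m) ≤ x (p m))
    (hgx : ∀ m ≤ N, g (p m).1 ≤ C * x (p m))
    (hstep : ∀ m < N, LoopStep C q x a f g (p m) (p (m + 1)))
    (hg : ∀ n m, n ≤ m → m ≤ N → ∑ i ∈ Finset.Ico (p n).1 (p m).1, g i ≤ C * g (p n).1)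
    {n : ℕ} (hn : n ≤ N) :
    ∑ i ∈ Finset.Ico n (N + 1), x (p i) ≤ (1 + C + C * (1 - q)⁻¹) *
      (1 + (1 + C * C * (1 - q)⁻¹) * C * (1 + C + C * (1 - q)⁻¹)) * (1 + C ^ 3) * x (p n) := by
  obtain ⟨K, hK, hmid⟩ := sum_le_of_middle_loop hC hq1 hx ha hf hax hstep
  rw [← hK]
  have hK0 : 0 ≤ K := by
    have hq : 0 < 1 - q := by linarith
    have hqi : 0 < (1 - q)⁻¹ := by positivity
    rw [hK]; positivity
  have h1 := sum_le_of_blocks (x := fun i => x (p i)) (K := K)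
    (fun i => (p i).2.1 = 0 ∧ (p i).2.2 = 0) (fun n' m' h1 h2 h3 => (hmid h1 h2 h3).1) hn
  have key : ∀ d, n + d ≤ N → (p n).1 ≤ (p (n + d)).1 ∧
      ∑ i ∈ Finset.Ioc n (n + d) with ((p i).2.1 = 0 ∧ (p i).2.2 = 0), x (p i) ≤
        C * ∑ i ∈ Finset.Ico (p n).1 (p (n + d)).1, g i := by
    intro d
    induction d with
    | zero => intro _; simp
    | succ d ih =>
      intro hd
      obtain ⟨hl, ih⟩ := ih (by omega)
      have hsplit : ∑ i ∈ Finset.Ioc n (n + d + 1) with ((p i).2.1 = 0 ∧ (p i).2.2 = 0), x (p i) =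
          ∑ i ∈ Finset.Ioc n (n + d) with ((p i).2.1 = 0 ∧ (p i).2.2 = 0), x (p i) +
            if ((p (n + d + 1)).2.1 = 0 ∧ (p (n + d + 1)).2.2 = 0)
              then x (p (n + d + 1)) else 0 := by
        rw [Finset.sum_filter, Finset.sum_filter, Finset.sum_Ioc_succ_top (by omega)]
      rw [show n + (d + 1) = n + d + 1 by ring, hsplit]
      rcases hstep (n + d) (by omega) with h | h | h
      · have e1 : (p (n + d + 1)).1 = (p (n + d)).1 := by rw [h.1]
        rw [e1, if_neg (by rw [h.1]; simp), add_zero]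
        exact ⟨hl, ih⟩
      · have e1 : (p (n + d + 1)).1 = (p (n + d)).1 := by rw [h.1]
        rw [e1, if_neg (by rw [h.1]; simp), add_zero]
        exact ⟨hl, ih⟩
      · have e1 : (p (n + d + 1)).1 = (p (n + d)).1 + 1 := by rw [h.1]
        rw [e1, if_pos (by rw [h.1]; simp), Finset.sum_Ico_succ_top hl, mul_add]
        exact ⟨by omega, add_le_add ih h.2⟩
  have h2 := (key (N - n) (by omega)).2
  rw [show n + (N - n) = N by omega] at h2
  have h3 := hg n N hn le_rfl
  have h4 := hgx n hn
  calc _ ≤ _ := h1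
    _ ≤ K * (x (p n) + C * (C * (C * x (p n)))) := by
      gcongr
      refine h2.trans ?_
      gcongr
      refine h3.trans ?_
      gcongr
    _ = _ := by ring

end Loops

/-! ### Strongly monotone operators: Picard iteration, Céa's lemma, energy -/

/-- `A` is strongly monotone with constant `α > 0` and Lipschitz continuous with constant `L ≥ α`. -/
structure IsMonotoneLipschitz {𝕜 V : Type*} [RCLike 𝕜] [NormedAddCommGroup V]
    [InnerProductSpace 𝕜 V] (A : V → StrongDual 𝕜 V) (α L : ℝ) : Prop where
  pos : 0 < α
  le : α ≤ L
  monotone : ∀ w v : V, α * ‖w - v‖ ^ 2 ≤ RCLike.re ((A w - A v) (w - v))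
  lipschitz : ∀ w v : V, ‖A w - A v‖ ≤ L * ‖w - v‖

theorem qPicard_nonneg (α L : ℝ) : 0 ≤ qPicard α L := Real.sqrt_nonneg _

theorem qPicard_lt_one {α L : ℝ} (hα : 0 < α) (hL : α ≤ L) : qPicard α L < 1 := by
  have hL0 : 0 < L := hα.trans_le hL
  rw [qPicard, Real.sqrt_lt' one_pos]
  have : 0 < α ^ 2 / L ^ 2 := by positivity
  linarith

theorem qPicard_sq {α L : ℝ} (hα : 0 < α) (hL : α ≤ L) :
    qPicard α L ^ 2 = 1 - α ^ 2 / L ^ 2 := by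
  have hL0 : 0 < L := hα.trans_le hL
  rw [qPicard, Real.sq_sqrt]
  rw [sub_nonneg, div_le_one (by positivity)]
  gcongr

section Hilbert

variable {𝕜 V : Type*} [RCLike 𝕜] [NormedAddCommGroup V] [InnerProductSpace 𝕜 V]
  {A : V → StrongDual 𝕜 V} {F : StrongDual 𝕜 V} {α L : ℝ} {W : Submodule 𝕜 V}

theorem IsMonotoneLipschitz.pos' (h : IsMonotoneLipschitz A α L) : 0 < L := h.pos.trans_le h.le

/-- One Picard step is a contraction on all of `V`: in terms of the Riesz representatives of the
residuals, expand `‖(u - u') - δ (r - r')‖ ^ 2` with `δ = α / L ^ 2`. -/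
theorem IsPicardSolution.norm_sub_le [CompleteSpace V] (h : IsMonotoneLipschitz A α L)
    {u u' w w' : V} (hw : IsPicardSolution A F α L W u w)
    (hw' : IsPicardSolution A F α L W u' w') : ‖w - w'‖ ≤ qPicard α L * ‖u - u'‖ := by
  have hL0 := h.pos'
  have hα := h.pos
  set δ : ℝ := α / L ^ 2 with hδ
  have hδ0 : 0 < δ := by positivity
  set r := (InnerProductSpace.toDual 𝕜 V).symm (A u - A u') with hr
  have hrn : ‖r‖ ≤ L * ‖u - u'‖ := by
    rw [hr, LinearIsometryEquiv.norm_map]; exact h.lipschitz u u'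
  have hrm : α * ‖u - u'‖ ^ 2 ≤ RCLike.re (inner 𝕜 (u - u') r) := by
    rw [inner_re_symm, hr, InnerProductSpace.toDual_symm_apply]; exact h.monotone u u'
  have hmem : w - w' ∈ W := W.sub_mem hw.1 hw'.1
  have hin : inner 𝕜 (w - w') (w - w') = inner 𝕜 ((u - u') - (δ : 𝕜) • r) (w - w') := by
    rw [inner_sub_left, inner_sub_left _ _ (w - w'), hw.2 _ hmem, hw'.2 _ hmem, inner_smul_left,
      hr, InnerProductSpace.toDual_symm_apply, inner_sub_left]
    simp only [sub_apply, RCLike.conj_ofReal]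
    ring
  have hcs : ‖w - w'‖ ^ 2 ≤ ‖(u - u') - (δ : 𝕜) • r‖ * ‖w - w'‖ := by
    have := re_inner_le_norm (𝕜 := 𝕜) ((u - u') - (δ : 𝕜) • r) (w - w')
    rw [← hin, inner_self_eq_norm_sq_to_K] at this
    have h2 : RCLike.re ((‖w - w'‖ : 𝕜) ^ 2) = ‖w - w'‖ ^ 2 := by
      rw [← RCLike.ofReal_pow, RCLike.ofReal_re]
    rwa [h2] at this
  have hle : ‖w - w'‖ ≤ ‖(u - u') - (δ : 𝕜) • r‖ := by
    rcases (norm_nonneg (w - w')).eq_or_lt with h0 | h0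
    · rw [← h0]; exact norm_nonneg _
    · rw [pow_two] at hcs
      exact le_of_mul_le_mul_right hcs h0
  refine hle.trans (abs_le_of_sq_le_sq' ?_
    (mul_nonneg (qPicard_nonneg _ _) (norm_nonneg _))).2
  rw [norm_sub_sq (𝕜 := 𝕜), mul_pow, qPicard_sq hα h.le, inner_smul_right, norm_smul,
    RCLike.norm_ofReal, abs_of_pos hδ0, RCLike.re_ofReal_mul]
  have h1 : (δ * ‖r‖) ^ 2 ≤ (δ * (L * ‖u - u'‖)) ^ 2 := by gcongr
  have h2 : δ * (α * ‖u - u'‖ ^ 2) ≤ δ * RCLike.re (inner 𝕜 (u - u') r) := by gcongr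
  have h3 : (δ * (L * ‖u - u'‖)) ^ 2 = α ^ 2 / L ^ 2 * ‖u - u'‖ ^ 2 := by
    rw [hδ]; field_simp
  have h4 : δ * (α * ‖u - u'‖ ^ 2) = α ^ 2 / L ^ 2 * ‖u - u'‖ ^ 2 := by
    rw [hδ]; field_simp
  linarith

theorem isPicardSolution_picardSolution [CompleteSpace V] (hW : IsComplete (W : Set V)) (u : V) :
    IsPicardSolution A F α L W u (picardSolution A F α L W u) := by
  have : CompleteSpace W := hW.completeSpace_coe
  refine Classical.epsilon_spec (p := IsPicardSolution A F α L W u) ⟨W.starProjection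
    (u - ((α / L ^ 2 : ℝ) : 𝕜) • (InnerProductSpace.toDual 𝕜 V).symm (A u - F)), ?_, ?_⟩
  · exact Submodule.starProjection_apply_mem _ _
  · intro v hv
    have := Submodule.starProjection_inner_eq_zero (K := W) (u - ((α / L ^ 2 : ℝ) : 𝕜) •
      (InnerProductSpace.toDual 𝕜 V).symm (A u - F)) v hv
    rw [inner_sub_left, sub_eq_zero] at this
    rw [← this, inner_sub_left, inner_smul_left, InnerProductSpace.toDual_symm_apply,
      RCLike.conj_ofReal]

/-- The solutions are the fixed points of the Picard step. -/
theorem isSolution_iff_isPicardSolution_self (h : IsMonotoneLipschitz A α L) {u : V} :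
    IsSolution A F W u ↔ IsPicardSolution A F α L W u u := by
  have hδ : ((α / L ^ 2 : ℝ) : 𝕜) ≠ 0 := by
    have := h.pos; have := h.pos'
    rw [RCLike.ofReal_ne_zero]; positivity
  refine and_congr_right fun _ => forall₂_congr fun v _ => ?_
  rw [eq_comm (a := inner 𝕜 u v), sub_eq_self, mul_eq_zero, or_iff_right hδ,
    sub_apply, sub_eq_zero]

theorem isSolution_solution [CompleteSpace V] (h : IsMonotoneLipschitz A α L)
    (hW : IsComplete (W : Set V)) : IsSolution A F W (solution A F W) := by
  have : CompleteSpace W := hW.completeSpace_coe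
  let f : W → W := fun u => ⟨picardSolution A F α L W u, (isPicardSolution_picardSolution hW _).1⟩
  have hf : ContractingWith ⟨qPicard α L, qPicard_nonneg _ _⟩ f := by
    refine ⟨?_, LipschitzWith.of_dist_le_mul fun u u' => ?_⟩
    · exact_mod_cast qPicard_lt_one h.pos h.le
    · rw [Subtype.dist_eq, Subtype.dist_eq, dist_eq_norm, dist_eq_norm]
      exact (isPicardSolution_picardSolution hW _).norm_sub_le h
        (isPicardSolution_picardSolution hW _)
  refine Classical.epsilon_spec (p := IsSolution A F W) ⟨(ContractingWith.fixedPoint f hf : W), ?_⟩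
  rw [isSolution_iff_isPicardSolution_self h]
  have h1 := congrArg Subtype.val hf.fixedPoint_isFixedPt
  have h2 := isPicardSolution_picardSolution (A := A) (F := F) (α := α) (L := L) hW
    (ContractingWith.fixedPoint f hf : W)
  change picardSolution A F α L W (ContractingWith.fixedPoint f hf : W) = _ at h1
  rwa [h1] at h2

/-- Céa's lemma. -/
theorem IsSolution.norm_sub_le (h : IsMonotoneLipschitz A α L) {u w v : V} {W' : Submodule 𝕜 V}
    (hu : IsSolution A F W' u) (hw : IsSolution A F W w) (hWW : W ≤ W') (hv : v ∈ W) :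
    ‖u - w‖ ≤ L / α * ‖u - v‖ := by
  have hα := h.pos
  have h1 := h.monotone u w
  have hvw : v - w ∈ W := W.sub_mem hv hw.1
  have h2 : (A u - A w) (u - w) = (A u - A w) (u - v) := by
    have : (A u - A w) (v - w) = 0 := by
      rw [sub_apply, hu.2 _ (hWW hvw), hw.2 _ hvw, sub_self]
    rw [← sub_eq_zero, ← map_sub, ← this]
    congr 1; abel
  rw [h2] at h1
  have h3 : RCLike.re ((A u - A w) (u - v)) ≤ L * ‖u - w‖ * ‖u - v‖ :=
    (RCLike.re_le_norm _).trans (((A u - A w).le_opNorm _).trans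
      (mul_le_mul_of_nonneg_right (h.lipschitz u w) (norm_nonneg _)))
  rcases (norm_nonneg (u - w)).eq_or_lt with h0 | h0
  · rw [← h0]
    exact mul_nonneg (div_nonneg h.pos'.le hα.le) (norm_nonneg _)
  · rw [div_mul_eq_mul_div, le_div_iff₀ hα]
    refine le_of_mul_le_mul_right ?_ h0
    calc _ = α * ‖u - w‖ ^ 2 := by ring
      _ ≤ _ := h1.trans h3
      _ = _ := by ring

/-- The energy, whose minimizer over `W` is the solution of the variational problem in `W`. -/
noncomputable def energy (P : V → 𝕜) (F : StrongDual 𝕜 V) (v : V) : ℝ :=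
  RCLike.re (P v) - RCLike.re (F v)

theorem hasDerivAt_energy {P : V → 𝕜} (hP : IsPotential P A) (u d : V) (t : ℝ) :
    HasDerivAt (fun t : ℝ => energy P F (u + (t : 𝕜) • d))
      (RCLike.re (A (u + (t : 𝕜) • d) d) - RCLike.re (F d)) t := by
  have h1 : HasDerivAt (fun t : ℝ => RCLike.re (P (u + (t : 𝕜) • d)))
      (RCLike.re (A (u + (t : 𝕜) • d) d)) t := by
    rw [hasDerivAt_iff_tendsto_slope_zero]
    refine (hP (u + (t : 𝕜) • d) d).congr fun τ => ?_
    rw [RCLike.div_re_ofReal, map_sub, smul_eq_mul, div_eq_inv_mul, RCLike.ofReal_add, add_smul,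
      add_assoc]
  have h2 : HasDerivAt (fun t : ℝ => RCLike.re (F (u + (t : 𝕜) • d))) (RCLike.re (F d)) t := by
    have : (fun t : ℝ => RCLike.re (F (u + (t : 𝕜) • d))) =
        fun t : ℝ => RCLike.re (F u) + t * RCLike.re (F d) := by
      funext t
      rw [map_add, map_add, map_smul, smul_eq_mul, RCLike.re_ofReal_mul]
    rw [this]
    simpa using ((hasDerivAt_id t).mul_const (RCLike.re (F d))).const_add (RCLike.re (F u))
  exact h1.sub h2

/-- The energy at `v ∈ W` exceeds the one at the solution in `W` by an amount that is equivalent to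
the squared distance: integrate the derivative along the segment. -/
theorem IsSolution.energy_bounds (h : IsMonotoneLipschitz A α L) {P : V → 𝕜}
    (hP : IsPotential P A) {u v : V} (hu : IsSolution A F W u) (hv : v ∈ W) :
    α / 2 * ‖v - u‖ ^ 2 ≤ energy P F v - energy P F u ∧
      energy P F v - energy P F u ≤ L / 2 * ‖v - u‖ ^ 2 := by
  set d := v - u with hd
  have hdW : d ∈ W := W.sub_mem hv hu.1
  have hder : ∀ c t : ℝ, HasDerivAt (fun t : ℝ => energy P F (u + (t : 𝕜) • d) - c / 2 * t ^ 2)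
      (RCLike.re ((A (u + (t : 𝕜) • d) - A u) d) - c * t) t := by
    intro c t
    refine ((hasDerivAt_energy hP u d t).sub (((hasDerivAt_pow 2 t).const_mul (c / 2)))).congr_deriv
      ?_
    rw [sub_apply, map_sub, hu.2 d hdW]
    simp; ring
  have hd1 : ∀ t : ℝ, 0 < t → α * ‖d‖ ^ 2 * t ≤ RCLike.re ((A (u + (t : 𝕜) • d) - A u) d) := by
    intro t ht
    have h1 := h.monotone (u + (t : 𝕜) • d) u
    rw [add_sub_cancel_left, map_smul, smul_eq_mul, RCLike.re_ofReal_mul, norm_smul,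
      RCLike.norm_ofReal, abs_of_pos ht] at h1
    refine le_of_mul_le_mul_left ?_ ht
    linarith
  have hd2 : ∀ t : ℝ, 0 < t → RCLike.re ((A (u + (t : 𝕜) • d) - A u) d) ≤ L * ‖d‖ ^ 2 * t := by
    intro t ht
    have h1 := h.lipschitz (u + (t : 𝕜) • d) u
    rw [add_sub_cancel_left, norm_smul, RCLike.norm_ofReal, abs_of_pos ht] at h1
    calc _ ≤ ‖(A (u + (t : 𝕜) • d) - A u) d‖ := RCLike.re_le_norm _
      _ ≤ ‖A (u + (t : 𝕜) • d) - A u‖ * ‖d‖ := ContinuousLinearMap.le_opNorm _ _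
      _ ≤ L * (t * ‖d‖) * ‖d‖ := by gcongr
      _ = _ := by ring
  have e0 : u + ((0 : ℝ) : 𝕜) • d = u := by simp
  have e1 : u + ((1 : ℝ) : 𝕜) • d = v := by simp [hd]
  constructor
  · have hm : MonotoneOn (fun t : ℝ => energy P F (u + (t : 𝕜) • d) - α * ‖d‖ ^ 2 / 2 * t ^ 2)
        (Set.Icc 0 1) := by
      refine monotoneOn_of_deriv_nonneg (convex_Icc 0 1)
        (fun t _ => (hder _ t).continuousAt.continuousWithinAt)
        (fun t _ => (hder _ t).differentiableAt.differentiableWithinAt) fun t ht => ?_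
      rw [interior_Icc] at ht
      rw [(hder _ t).deriv]
      linarith [hd1 t ht.1]
    have := hm (Set.left_mem_Icc.2 zero_le_one) (Set.right_mem_Icc.2 zero_le_one) zero_le_one
    simp only [e0, e1] at this
    linarith
  · have hm : AntitoneOn (fun t : ℝ => energy P F (u + (t : 𝕜) • d) - L * ‖d‖ ^ 2 / 2 * t ^ 2)
        (Set.Icc 0 1) := by
      refine antitoneOn_of_deriv_nonpos (convex_Icc 0 1)
        (fun t _ => (hder _ t).continuousAt.continuousWithinAt)
        (fun t _ => (hder _ t).differentiableAt.differentiableWithinAt) fun t ht => ?_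
      rw [interior_Icc] at ht
      rw [(hder _ t).deriv]
      linarith [hd2 t ht.1]
    have := hm (Set.left_mem_Icc.2 zero_le_one) (Set.right_mem_Icc.2 zero_le_one) zero_le_one
    simp only [e0, e1] at this
    linarith

end Hilbert

/-! ### Properties of the error estimator at Galerkin solutions -/

namespace Discretization

variable {𝕜 V E : Type*} [RCLike 𝕜] [NormedAddCommGroup V] [InnerProductSpace 𝕜 V]
  {D : Discretization 𝕜 V E}

theorem estOn_nonneg (T S : Finset E) (v : V) : 0 ≤ D.estOn T S v := Real.sqrt_nonneg _

theorem est_nonneg (T : Finset E) (v : V) : 0 ≤ D.est T v := Real.sqrt_nonneg _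

theorem estOn_sq (T S : Finset E) (v : V) : D.estOn T S v ^ 2 = ∑ t ∈ S, D.eta T t v ^ 2 :=
  Real.sq_sqrt (Finset.sum_nonneg fun _ _ => sq_nonneg _)

theorem estOn_mono (T : Finset E) {S S' : Finset E} (hS : S ⊆ S') (v : V) :
    D.estOn T S v ≤ D.estOn T S' v :=
  Real.sqrt_le_sqrt (Finset.sum_le_sum_of_subset_of_nonneg hS fun _ _ _ => sq_nonneg _)

theorem estOn_empty (T : Finset E) (v : V) : D.estOn T ∅ v = 0 := by simp [estOn]

theorem mem_meshes_of_refines {T T' : Finset E} (hT : T ∈ D.meshes) (hTT : Refines D.refine T T') :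
    T' ∈ D.meshes :=
  Relation.ReflTransGen.trans hT hTT

theorem refines_refine {T M : Finset E} (hM : M ⊆ T) : Refines D.refine T (D.refine T M) :=
  Relation.ReflTransGen.single ⟨M, hM, rfl⟩

variable [DecidableEq E]

theorem est_sq_split {T S : Finset E} (hS : S ⊆ T) (v : V) :
    D.est T v ^ 2 = D.estOn T (T \ S) v ^ 2 + D.estOn T S v ^ 2 := by
  rw [est, estOn_sq, estOn_sq, estOn_sq, Finset.sum_sdiff hS]

namespace Assumptions

variable {α L Cson Cmesh Cstab Crel qred : ℝ}

theorem isMonotoneLipschitz (h : D.Assumptions α L Cson Cmesh Cstab Crel qred) (hα : 0 < α)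
    (hL : α ≤ L) : IsMonotoneLipschitz D.A α L :=
  ⟨hα, hL, h.monotone, h.lipschitz⟩

theorem isComplete (h : D.Assumptions α L Cson Cmesh Cstab Crel qred) {T : Finset E}
    (hT : T ∈ D.meshes) : IsComplete (D.X T : Set V) := by
  have := h.finiteDimensional T hT
  exact Submodule.complete_of_finiteDimensional _

section Solutions

variable [CompleteSpace V]

theorem isSolution_uStarOn (h : D.Assumptions α L Cson Cmesh Cstab Crel qred) (hα : 0 < α)
    (hL : α ≤ L) {T : Finset E} (hT : T ∈ D.meshes) :
    IsSolution D.A D.F (D.X T) (D.uStarOn T) :=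
  isSolution_solution (h.isMonotoneLipschitz hα hL) (h.isComplete hT)

theorem isSolution_uStar (h : D.Assumptions α L Cson Cmesh Cstab Crel qred) (hα : 0 < α)
    (hL : α ≤ L) : IsSolution D.A D.F ⊤ D.uStar :=
  isSolution_solution (h.isMonotoneLipschitz hα hL) (by simpa using isComplete_univ)

theorem cea (h : D.Assumptions α L Cson Cmesh Cstab Crel qred) (hα : 0 < α)
    (hL : α ≤ L) {T : Finset E} (hT : T ∈ D.meshes) {v : V} (hv : v ∈ D.X T) :
    ‖D.uStar - D.uStarOn T‖ ≤ L / α * ‖D.uStar - v‖ :=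
  (h.isSolution_uStar hα hL).norm_sub_le (h.isMonotoneLipschitz hα hL)
    (h.isSolution_uStarOn hα hL hT) le_top hv

/-- Quasi-orthogonality of the Galerkin solutions on successively refined meshes: their squared
distances are bounded by differences of the energy, which telescope. -/
theorem sum_norm_sq_uStarOn_le (h : D.Assumptions α L Cson Cmesh Cstab Crel qred) (hα : 0 < α)
    (hL : α ≤ L) {T : ℕ → Finset E} {n m : ℕ} (hnm : n ≤ m)
    (hT : ∀ i, n ≤ i → i ≤ m → T i ∈ D.meshes)
    (hTT : ∀ i, n ≤ i → i < m → Refines D.refine (T i) (T (i + 1))) :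
    ∑ i ∈ Finset.Ico n m, ‖D.uStarOn (T (i + 1)) - D.uStarOn (T i)‖ ^ 2 ≤
      L / α * ‖D.uStar - D.uStarOn (T n)‖ ^ 2 := by
  obtain ⟨P, hP⟩ := h.potential
  have hA := h.isMonotoneLipschitz hα hL
  have h1 : ∀ i ∈ Finset.Ico n m, ‖D.uStarOn (T (i + 1)) - D.uStarOn (T i)‖ ^ 2 ≤
      2 / α * (energy P D.F (D.uStarOn (T i)) - energy P D.F (D.uStarOn (T (i + 1)))) := by
    intro i hi
    rw [Finset.mem_Ico] at hi
    have := ((h.isSolution_uStarOn hα hL (hT (i + 1) (by omega) (by omega))).energy_bounds hA hP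
      (h.nested _ (hT i hi.1 hi.2.le) _ (hTT i hi.1 hi.2)
        (h.isSolution_uStarOn hα hL (hT i hi.1 hi.2.le)).1)).1
    rw [norm_sub_rev]
    calc _ = 2 / α * (α / 2 * ‖D.uStarOn (T i) - D.uStarOn (T (i + 1))‖ ^ 2) := by field_simp
      _ ≤ _ := by gcongr
  have h2 := (h.isSolution_uStar hα hL).energy_bounds hA hP
    (Submodule.mem_top (x := D.uStarOn (T n)))
  have h3 := (h.isSolution_uStar hα hL).energy_bounds hA hP
    (Submodule.mem_top (x := D.uStarOn (T m)))
  have h4 : 0 ≤ α / 2 * ‖D.uStarOn (T m) - D.uStar‖ ^ 2 := by positivity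
  calc _ ≤ _ := Finset.sum_le_sum h1
    _ = 2 / α * (energy P D.F (D.uStarOn (T n)) - energy P D.F (D.uStarOn (T m))) := by
      rw [← Finset.mul_sum, Finset.sum_Ico_eq_sub _ hnm,
        Finset.sum_range_sub' (fun i => energy P D.F (D.uStarOn (T i))),
        Finset.sum_range_sub' (fun i => energy P D.F (D.uStarOn (T i)))]
      ring
    _ ≤ 2 / α * (L / 2 * ‖D.uStar - D.uStarOn (T n)‖ ^ 2) := by
      rw [norm_sub_rev D.uStar]
      gcongr
      linarith [h2.2, h3.1]
    _ = _ := by field_simp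

end Solutions

theorem abs_estOn_sub_le (h : D.Assumptions α L Cson Cmesh Cstab Crel qred) {T S : Finset E}
    (hT : T ∈ D.meshes) (hS : S ⊆ T) {v w : V} (hv : v ∈ D.X T) (hw : w ∈ D.X T) :
    |D.estOn T S v - D.estOn T S w| ≤ Cstab * ‖v - w‖ :=
  h.stability T hT T Relation.ReflTransGen.refl S (by simpa using hS) v hv w hw

theorem estOn_le_add (h : D.Assumptions α L Cson Cmesh Cstab Crel qred) {T S : Finset E}
    (hT : T ∈ D.meshes) (hS : S ⊆ T) {v w : V} (hv : v ∈ D.X T) (hw : w ∈ D.X T) :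
    D.estOn T S v ≤ D.estOn T S w + Cstab * ‖v - w‖ := by
  have := (abs_le.1 (h.abs_estOn_sub_le hT hS hv hw)).2
  linarith

theorem est_le_add (h : D.Assumptions α L Cson Cmesh Cstab Crel qred) {T : Finset E}
    (hT : T ∈ D.meshes) {v w : V} (hv : v ∈ D.X T) (hw : w ∈ D.X T) :
    D.est T v ≤ D.est T w + Cstab * ‖v - w‖ :=
  h.estOn_le_add hT subset_rfl hv hw

/-- The estimator of a fixed function decreases in a refinement: stability shows that the indicators
of the elements that are not refined do not change as a whole. -/
theorem est_sq_refine_le (h : D.Assumptions α L Cson Cmesh Cstab Crel qred) {T T' : Finset E}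
    (hT : T ∈ D.meshes) (hTT : Refines D.refine T T') {v : V} (hv : v ∈ D.X T) :
    D.est T' v ^ 2 ≤ D.est T v ^ 2 - (1 - qred ^ 2) * D.estOn T (T \ T') v ^ 2 := by
  have h1 : D.estOn T' (T ∩ T') v = D.estOn T (T ∩ T') v := by
    have := h.stability T hT T' hTT _ subset_rfl v (h.nested T hT T' hTT hv) v hv
    rw [sub_self, norm_zero, mul_zero, abs_nonpos_iff, sub_eq_zero] at this
    exact this
  have h2 := h.reduction T hT T' hTT v hv
  have h3 : D.est T' v ^ 2 = _ := est_sq_split (S := T ∩ T') Finset.inter_subset_right v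
  have h4 : D.est T v ^ 2 = _ := est_sq_split (S := T ∩ T') Finset.inter_subset_left v
  rw [show T' \ (T ∩ T') = T' \ T by ext; simp, h1] at h3
  rw [show T \ (T ∩ T') = T \ T' by ext; simp] at h4
  have h5 : D.estOn T' (T' \ T) v ^ 2 ≤ (qred * D.estOn T (T \ T') v) ^ 2 :=
    pow_le_pow_left₀ (estOn_nonneg _ _ _) h2 2
  rw [h3, h4]
  linarith

theorem est_refine_le (h : D.Assumptions α L Cson Cmesh Cstab Crel qred) (hq0 : 0 < qred)
    (hq1 : qred < 1) {T T' : Finset E}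
    (hT : T ∈ D.meshes) (hTT : Refines D.refine T T') {v : V} (hv : v ∈ D.X T) :
    D.est T' v ≤ D.est T v := by
  refine (abs_le_of_sq_le_sq' ?_ (est_nonneg _ _)).2
  have h1 := h.est_sq_refine_le hT hTT hv
  have h2 : 0 ≤ (1 - qred ^ 2) * D.estOn T (T \ T') v ^ 2 := by
    have : 0 ≤ 1 - qred ^ 2 := by nlinarith
    positivity
  linarith

theorem card_sdiff_add_card_le (h : D.Assumptions α L Cson Cmesh Cstab Crel qred)
    {T T' : Finset E} (hT : T ∈ D.meshes) (hTT : Refines D.refine T T') :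
    (T \ T').card + T.card ≤ T'.card := by
  induction hTT with
  | refl => simp
  | @tail T' T'' h1 h2 ih =>
    obtain ⟨M, hM, rfl⟩ := h2
    have h3 := (h.splitting T' (mem_meshes_of_refines hT h1) M hM).1
    have h4 : (T \ D.refine T' M).card ≤ (T \ T').card + (T' \ D.refine T' M).card := by
      refine (Finset.card_le_card ?_).trans (Finset.card_union_le _ _)
      intro t ht
      simp only [Finset.mem_sdiff, Finset.mem_union] at ht ⊢
      tauto
    omega

section Galerkin

variable [CompleteSpace V]

/-- Quasi-monotonicity of the estimator of the Galerkin solutions. -/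
theorem est_uStarOn_le (h : D.Assumptions α L Cson Cmesh Cstab Crel qred) (hα : 0 < α)
    (hL : α ≤ L) (hCstab : 0 < Cstab) (hCrel : 0 < Crel) (hq0 : 0 < qred) (hq1 : qred < 1)
    {T T' : Finset E} (hT : T ∈ D.meshes) (hTT : Refines D.refine T T') :
    D.est T' (D.uStarOn T') ≤ (1 + Cstab * Crel) * D.est T (D.uStarOn T) := by
  have hT' := mem_meshes_of_refines hT hTT
  have hu := (h.isSolution_uStarOn hα hL hT).1
  have h1 := h.est_le_add hT' (h.isSolution_uStarOn hα hL hT').1 (h.nested T hT T' hTT hu)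
  have h2 := h.est_refine_le hq0 hq1 hT hTT hu
  have h3 := h.discrete_reliability T hT T' hTT
  have h4 : D.estOn T (T \ T') (D.uStarOn T) ≤ D.est T (D.uStarOn T) :=
    estOn_mono _ Finset.sdiff_subset _
  have h5 : Cstab * ‖D.uStarOn T' - D.uStarOn T‖ ≤ Cstab * (Crel * D.est T (D.uStarOn T)) := by
    gcongr
    exact h3.trans (by gcongr)
  linarith

/-- Estimator reduction along the Galerkin solutions, for a refinement of a set of elements that
satisfies the Dörfler criterion with parameter `ϑ`. -/
theorem est_uStarOn_le_of_doerfler (h : D.Assumptions α L Cson Cmesh Cstab Crel qred) (hα : 0 < α)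
    (hL : α ≤ L) (hq0 : 0 < qred) (hq1 : qred < 1) {ϑ : ℝ} (hϑ : 0 < ϑ)
    {T T' M : Finset E} (hT : T ∈ D.meshes) (hTT : Refines D.refine T T') (hM : M ⊆ T \ T')
    (hD : ϑ * D.est T (D.uStarOn T) ≤ D.estOn T M (D.uStarOn T)) :
    D.est T' (D.uStarOn T') ≤ √(1 - (1 - qred ^ 2) * ϑ ^ 2) * D.est T (D.uStarOn T) +
      Cstab * ‖D.uStarOn T' - D.uStarOn T‖ := by
  have hT' := mem_meshes_of_refines hT hTT
  have hu := (h.isSolution_uStarOn hα hL hT).1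
  have h1 := h.est_le_add hT' (h.isSolution_uStarOn hα hL hT').1 (h.nested T hT T' hTT hu)
  have h2 := h.est_sq_refine_le hT hTT hu
  have h3 : ϑ * D.est T (D.uStarOn T) ≤ D.estOn T (T \ T') (D.uStarOn T) :=
    hD.trans (estOn_mono _ hM _)
  have h4 : (ϑ * D.est T (D.uStarOn T)) ^ 2 ≤ D.estOn T (T \ T') (D.uStarOn T) ^ 2 :=
    pow_le_pow_left₀ (mul_nonneg hϑ.le (est_nonneg _ _)) h3 2
  have h5 : 0 ≤ 1 - qred ^ 2 := by nlinarith
  have h6 : D.est T' (D.uStarOn T) ≤ √(1 - (1 - qred ^ 2) * ϑ ^ 2) * D.est T (D.uStarOn T) := by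
    rw [← Real.sqrt_sq (est_nonneg T (D.uStarOn T)), ← Real.sqrt_mul' _ (sq_nonneg _)]
    refine Real.le_sqrt_of_sq_le (h2.trans ?_)
    have := mul_le_mul_of_nonneg_left h4 h5
    linarith
  linarith

/-- Square summability of the estimators of the Galerkin solutions under Dörfler marking, from
estimator reduction and quasi-orthogonality. -/
theorem sum_sq_est_uStarOn_le (h : D.Assumptions α L Cson Cmesh Cstab Crel qred) (hα : 0 < α)
    (hL : α ≤ L) (hq0 : 0 < qred) (hq1 : qred < 1)
    {ϑ : ℝ} (hϑ : 0 < ϑ) {T M : ℕ → Finset E} {n m : ℕ} (hnm : n ≤ m)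
    (hT : ∀ i, n ≤ i → i ≤ m → T i ∈ D.meshes)
    (hTT : ∀ i, n ≤ i → i < m → Refines D.refine (T i) (T (i + 1)))
    (hM : ∀ i, n ≤ i → i < m → M i ⊆ T i \ T (i + 1))
    (hD : ∀ i, n ≤ i → i < m →
      ϑ * D.est (T i) (D.uStarOn (T i)) ≤ D.estOn (T i) (M i) (D.uStarOn (T i)))
    {q : ℝ} (hq : q = √(1 - (1 - qred ^ 2) * ϑ ^ 2)) :
    ∑ i ∈ Finset.Ico n (m + 1), D.est (T i) (D.uStarOn (T i)) ^ 2 ≤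
      (1 - q)⁻¹ * (1 + Cstab ^ 2 * (1 - q)⁻¹ * (L / α * Crel ^ 2)) *
        D.est (T n) (D.uStarOn (T n)) ^ 2 := by
  have hq0' : 0 ≤ q := hq ▸ Real.sqrt_nonneg _
  have hqlt : q < 1 := by
    rw [hq, Real.sqrt_lt' one_pos]
    have : 0 < (1 - qred ^ 2) * ϑ ^ 2 := mul_pos (by nlinarith) (by positivity)
    linarith
  have h1q : 0 < 1 - q := by linarith
  set g : ℕ → ℝ := fun i => D.est (T i) (D.uStarOn (T i)) with hg
  set d : ℕ → ℝ := fun i => ‖D.uStarOn (T (i + 1)) - D.uStarOn (T i)‖ with hd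
  have h1 : ∀ i ∈ Finset.Ico n m, g (i + 1) ^ 2 ≤
      q * g i ^ 2 + Cstab ^ 2 * (1 - q)⁻¹ * d i ^ 2 := by
    intro i hi
    rw [Finset.mem_Ico] at hi
    have h2 : g (i + 1) ≤ q * g i + Cstab * d i := by
      rw [hq]
      exact h.est_uStarOn_le_of_doerfler hα hL hq0 hq1 hϑ (hT i hi.1 hi.2.le) (hTT i hi.1 hi.2)
        (hM i hi.1 hi.2) (hD i hi.1 hi.2)
    have h3 : g (i + 1) ^ 2 ≤ (q * g i + Cstab * d i) ^ 2 :=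
      pow_le_pow_left₀ (est_nonneg _ _) h2 2
    -- convexity of the square
    have h4 : q * g i ^ 2 + Cstab ^ 2 * (1 - q)⁻¹ * d i ^ 2 - (q * g i + Cstab * d i) ^ 2 =
        q * (1 - q)⁻¹ * ((1 - q) * g i - Cstab * d i) ^ 2 := by
      field_simp; ring
    have h5 : 0 ≤ q * (1 - q)⁻¹ * ((1 - q) * g i - Cstab * d i) ^ 2 := by positivity
    linarith
  have h2 : ∑ i ∈ Finset.Ico n m, d i ^ 2 ≤ L / α * Crel ^ 2 * g n ^ 2 := by
    refine (h.sum_norm_sq_uStarOn_le hα hL hnm hT hTT).trans ?_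
    have h3 := h.reliability (T n) (hT n le_rfl hnm)
    rw [mul_assoc, ← mul_pow]
    have : 0 ≤ L / α := div_nonneg (hα.le.trans hL) hα.le
    gcongr
  have h3 : ∑ i ∈ Finset.Ico n (m + 1), g i ^ 2 =
      g n ^ 2 + ∑ i ∈ Finset.Ico n m, g (i + 1) ^ 2 := by
    rw [Finset.sum_eq_sum_Ico_succ_bot (by omega),
      Finset.sum_Ico_add' (fun i => g i ^ 2) n m 1]
  have h4 : ∑ i ∈ Finset.Ico n m, g i ^ 2 ≤ ∑ i ∈ Finset.Ico n (m + 1), g i ^ 2 := by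
    rw [Finset.sum_Ico_succ_top hnm]
    have := sq_nonneg (g m)
    linarith
  have h5 := Finset.sum_le_sum h1
  rw [Finset.sum_add_distrib, ← Finset.mul_sum, ← Finset.mul_sum] at h5
  have h6 : Cstab ^ 2 * (1 - q)⁻¹ * ∑ i ∈ Finset.Ico n m, d i ^ 2 ≤
      Cstab ^ 2 * (1 - q)⁻¹ * (L / α * Crel ^ 2 * g n ^ 2) := by
    gcongr
  have h7 := mul_le_mul_of_nonneg_left h4 hq0'
  rw [mul_assoc, inv_mul_eq_div, le_div_iff₀ h1q]
  linarith

/-- Optimality of the Dörfler criterion: if the estimator of the Galerkin solution decreases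
sufficiently, then the refined elements satisfy the criterion. -/
theorem doerfler_of_est_le (h : D.Assumptions α L Cson Cmesh Cstab Crel qred) (hα : 0 < α)
    (hL : α ≤ L) (hCstab : 0 < Cstab) (hCrel : 0 < Crel) {T T' : Finset E} (hT : T ∈ D.meshes)
    (hTT : Refines D.refine T T') {ϑ : ℝ} (hϑ : ϑ = (1 + Cstab ^ 2 * Crel ^ 2)⁻¹)
    (hest : D.est T' (D.uStarOn T') ≤ (1 - ϑ) / 2 * D.est T (D.uStarOn T)) :
    ϑ * D.est T (D.uStarOn T) ≤ D.estOn T (T \ T') (D.uStarOn T) := by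
  have hT' := mem_meshes_of_refines hT hTT
  set η := D.est T (D.uStarOn T) with hη
  set x := D.estOn T (T \ T') (D.uStarOn T) with hx
  set y := D.estOn T (T ∩ T') (D.uStarOn T) with hy
  set C := Cstab * Crel with hC
  have hC0 : 0 < C := by positivity
  have hη0 : 0 ≤ η := est_nonneg _ _
  have hx0 : 0 ≤ x := estOn_nonneg _ _ _
  have hy0 : 0 ≤ y := estOn_nonneg _ _ _
  have hϑ' : ϑ * (1 + C ^ 2) = 1 := by
    rw [hϑ, hC, mul_pow]
    exact inv_mul_cancel₀ (by positivity)
  have hϑ0 : 0 < ϑ := by rw [hϑ]; positivity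
  have hϑ1 : ϑ ≤ 1 := by nlinarith
  have h1 : η ^ 2 = x ^ 2 + y ^ 2 := by
    have h4 : D.est T (D.uStarOn T) ^ 2 = _ :=
      est_sq_split (S := T ∩ T') Finset.inter_subset_left (D.uStarOn T)
    rwa [show T \ (T ∩ T') = T \ T' by ext; simp] at h4
  have h2 : y ≤ (1 - ϑ) / 2 * η + C * x := by
    have h3 := (abs_le.1 (h.stability T hT T' hTT (T ∩ T') subset_rfl _
      (h.isSolution_uStarOn hα hL hT').1 _ (h.isSolution_uStarOn hα hL hT).1)).1
    have h4 : D.estOn T' (T ∩ T') (D.uStarOn T') ≤ D.est T' (D.uStarOn T') :=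
      estOn_mono _ Finset.inter_subset_right _
    have h5 := mul_le_mul_of_nonneg_left (h.discrete_reliability T hT T' hTT) hCstab.le
    rw [← mul_assoc] at h5
    linarith
  by_contra! hlt
  have hη1 : 0 < η := by
    rcases hη0.eq_or_lt with h0 | h0
    · rw [← h0] at hlt; linarith
    · exact h0
  have h3 : y ≤ ((1 - ϑ) / 2 + C * ϑ) * η := by
    have := mul_le_mul_of_nonneg_left hlt.le hC0.le
    linarith
  have h4 : y ^ 2 ≤ (((1 - ϑ) / 2 + C * ϑ) * η) ^ 2 := pow_le_pow_left₀ hy0 h3 2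
  have h5 : x ^ 2 < (ϑ * η) ^ 2 := pow_lt_pow_left₀ hlt hx0 two_ne_zero
  -- the choice of `ϑ` leaves room for the term `(1 - ϑ) / 2`
  have h6 : ϑ ^ 2 + ((1 - ϑ) / 2 + C * ϑ) ^ 2 ≤ 1 := by
    have hCϑ : 2 * (C * ϑ) ≤ 1 := by nlinarith [sq_nonneg (C - 1)]
    have : (C * ϑ) ^ 2 + ϑ ^ 2 = ϑ := by
      have : (C * ϑ) ^ 2 + ϑ ^ 2 = ϑ * (ϑ * (1 + C ^ 2)) := by ring
      rw [this, hϑ', mul_one]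
    nlinarith
  have h7 := mul_le_mul_of_nonneg_right h6 (sq_nonneg η)
  nlinarith

/-- The comparison lemma: overlaying the mesh with a nearly optimal coarse mesh yields a small set
of elements that satisfies the Dörfler criterion. -/
theorem exists_doerfler_card_le (h : D.Assumptions α L Cson Cmesh Cstab Crel qred) (hα : 0 < α)
    (hL : α ≤ L) (hCstab : 0 < Cstab) (hCrel : 0 < Crel) (hq0 : 0 < qred) (hq1 : qred < 1)
    {s : ℝ} (hs : 0 < s) (hA : D.approxNorm s ≠ ⊤) {T : Finset E} (hT : T ∈ D.meshes)
    (hpos : 0 < D.est T (D.uStarOn T)) {ϑ : ℝ} (hϑ : ϑ = (1 + Cstab ^ 2 * Crel ^ 2)⁻¹) :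
    ∃ S ⊆ T, ϑ * D.est T (D.uStarOn T) ≤ D.estOn T S (D.uStarOn T) ∧
      (S.card : ℝ) ≤ ((D.approxNorm s).toReal /
        ((1 - ϑ) / 2 / (1 + Cstab * Crel) * D.est T (D.uStarOn T))) ^ (1 / s) := by
  have hϑ1 : ϑ < 1 := by
    rw [hϑ]
    exact inv_lt_one_of_one_lt₀ (by have : 0 < Cstab ^ 2 * Crel ^ 2 := by positivity
                                    linarith)
  have hϑ1' : 0 < 1 - ϑ := by linarith
  set a := (D.approxNorm s).toReal with ha
  set ε := (1 - ϑ) / 2 / (1 + Cstab * Crel) * D.est T (D.uStarOn T) with hε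
  have hε0 : 0 < ε := by positivity
  have ha0 : 0 ≤ a := ENNReal.toReal_nonneg
  set N := ⌊(a / ε) ^ (1 / s)⌋₊ with hN
  have hN1 : (a / ε) ^ (1 / s) < (N : ℝ) + 1 := Nat.lt_floor_add_one _
  have hN2 : a < ((N : ℝ) + 1) ^ s * ε := by
    have := Real.rpow_lt_rpow (by positivity) hN1 hs
    rwa [← Real.rpow_mul (by positivity), one_div, inv_mul_cancel₀ hs.ne', Real.rpow_one,
      div_lt_iff₀ hε0] at this
  have hinf : (⨅ T ∈ {T | T ∈ D.meshes ∧ T.card ≤ D.T0.card + N},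
      ENNReal.ofReal (‖D.uStar - D.uStarOn T‖ + D.est T (D.uStarOn T))) < ENNReal.ofReal ε := by
    by_contra! hle
    have h1 : ((N : ℝ≥0∞) + 1) ^ s * ENNReal.ofReal ε ≤ D.approxNorm s :=
      (mul_le_mul_right hle _).trans (le_iSup (fun N : ℕ => ((N : ℝ≥0∞) + 1) ^ s *
        ⨅ T ∈ {T | T ∈ D.meshes ∧ T.card ≤ D.T0.card + N},
          ENNReal.ofReal (‖D.uStar - D.uStarOn T‖ + D.est T (D.uStarOn T))) N)
    have h2 : ((N : ℝ≥0∞) + 1) ^ s = ENNReal.ofReal (((N : ℝ) + 1) ^ s) := by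
      rw [← ENNReal.ofReal_rpow_of_pos (by positivity), ENNReal.ofReal_add (by positivity) one_pos.le,
        ENNReal.ofReal_natCast, ENNReal.ofReal_one]
    rw [h2, ← ENNReal.ofReal_mul (by positivity), ENNReal.ofReal_le_iff_le_toReal hA] at h1
    linarith
  simp only [iInf_lt_iff, Set.mem_ofPred_eq, exists_prop] at hinf
  obtain ⟨T₁, ⟨hT₁, hcard⟩, hlt⟩ := hinf
  rw [ENNReal.ofReal_lt_ofReal_iff hε0] at hlt
  obtain ⟨T₃, hT₃, hT₁₃, hc⟩ := h.overlay D.T0 Relation.ReflTransGen.refl T T₁ hT hT₁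
  have hc' := h.card_sdiff_add_card_le hT hT₃
  refine ⟨T \ T₃, Finset.sdiff_subset, ?_, ?_⟩
  · refine h.doerfler_of_est_le hα hL hCstab hCrel hT hT₃ hϑ ?_
    have h1 := h.est_uStarOn_le hα hL hCstab hCrel hq0 hq1 hT₁ hT₁₃
    have h2 : D.est T₁ (D.uStarOn T₁) ≤ ε := by
      have := norm_nonneg (D.uStar - D.uStarOn T₁)
      linarith
    calc _ ≤ _ := h1
      _ ≤ (1 + Cstab * Crel) * ε := by gcongr
      _ = _ := by rw [hε]; field_simp
  · have h1 : (T \ T₃).card ≤ N := by omega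
    calc ((T \ T₃).card : ℝ) ≤ N := by exact_mod_cast h1
      _ ≤ _ := Nat.floor_le (by positivity)

end Galerkin

end Assumptions

end Discretization

/-! ### The index triples used by the algorithm -/

namespace Iterates

variable {𝕜 V E : Type*} [RCLike 𝕜] [NormedAddCommGroup V] [InnerProductSpace 𝕜 V]
  {D : Discretization 𝕜 V E} {lamAlg lamPic : ℝ} {R : Iterates V E}

theorem next_eq_some {l k j : ℕ} {t : ℕ × ℕ × ℕ} (h : R.next D lamAlg lamPic (l, k, j) = some t) :
    (k = 0 ∧ t = (l, 1, 0)) ∨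
    (k ≠ 0 ∧ (j ≠ 0 → ¬ R.AlgStop D lamAlg l k j) ∧ t = (l, k, j + 1)) ∨
    (k ≠ 0 ∧ j ≠ 0 ∧ R.AlgStop D lamAlg l k j ∧ ¬ R.PicStop D lamPic l k j ∧ t = (l, k + 1, 0)) ∨
    (k ≠ 0 ∧ j ≠ 0 ∧ R.AlgStop D lamAlg l k j ∧ R.PicStop D lamPic l k j ∧
      D.est (R.mesh l) (R.u l k j) ≠ 0 ∧ t = (l + 1, 0, 0)) := by
  simp only [next] at h
  split_ifs at h with h1 h2 h3 h4 h5
  · exact Or.inl ⟨h1, (Option.some.inj h).symm⟩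
  · refine Or.inr (Or.inl ⟨h1, fun hj => absurd h2 hj, ?_⟩)
    rw [← Option.some.inj h, h2]
  · exact Or.inr (Or.inr (Or.inr ⟨h1, h2, h3, h4, h5, (Option.some.inj h).symm⟩))
  · exact Or.inr (Or.inr (Or.inl ⟨h1, h2, h3, h4, (Option.some.inj h).symm⟩))
  · exact Or.inr (Or.inl ⟨h1, fun _ => h3, (Option.some.inj h).symm⟩)

theorem next_eq_none {l k j : ℕ} (h : R.next D lamAlg lamPic (l, k, j) = none) :
    k ≠ 0 ∧ j ≠ 0 ∧ R.AlgStop D lamAlg l k j ∧ R.PicStop D lamPic l k j ∧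
      D.est (R.mesh l) (R.u l k j) = 0 := by
  simp only [next] at h
  split_ifs at h with h1 h2 h3 h4 h5
  exact ⟨h1, h2, h3, h4, h5⟩

theorem step_succ (n : ℕ) : R.step D lamAlg lamPic (n + 1) =
    (R.step D lamAlg lamPic n).bind (R.next D lamAlg lamPic) := rfl

theorem exists_of_step_succ {n : ℕ} {t : ℕ × ℕ × ℕ} (h : R.step D lamAlg lamPic (n + 1) = some t) :
    ∃ q, R.step D lamAlg lamPic n = some q ∧ R.next D lamAlg lamPic q = some t := by
  rw [step_succ, Option.bind_eq_some_iff] at h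
  exact h

/-- The index triple used in step `n`, with a junk value if the algorithm has stopped before. -/
noncomputable def path (D : Discretization 𝕜 V E) (lamAlg lamPic : ℝ) (R : Iterates V E) (n : ℕ) :
    ℕ × ℕ × ℕ :=
  (R.step D lamAlg lamPic n).getD (0, 0, 0)

theorem path_eq {n : ℕ} {q : ℕ × ℕ × ℕ} (h : R.step D lamAlg lamPic n = some q) :
    R.path D lamAlg lamPic n = q := by rw [path, h]; rfl

theorem step_eq_some_path {N : ℕ} {q : ℕ × ℕ × ℕ} (h : R.step D lamAlg lamPic N = some q) {m : ℕ}
    (hm : m ≤ N) : R.step D lamAlg lamPic m = some (R.path D lamAlg lamPic m) := by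
  induction N generalizing q with
  | zero =>
    obtain rfl : m = 0 := by omega
    rw [path_eq h, h]
  | succ N ih =>
    rcases Nat.lt_or_ge N m with hlt | hle
    · obtain rfl : m = N + 1 := by omega
      rw [path_eq h, h]
    · obtain ⟨q', h1, -⟩ := exists_of_step_succ h
      exact ih h1 hle

theorem next_path {N : ℕ} {q : ℕ × ℕ × ℕ} (h : R.step D lamAlg lamPic N = some q) {m : ℕ}
    (hm : m < N) : R.next D lamAlg lamPic (R.path D lamAlg lamPic m) =
      some (R.path D lamAlg lamPic (m + 1)) := by
  obtain ⟨q', h1, h2⟩ := exists_of_step_succ (step_eq_some_path h (m := m + 1) hm)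
  rwa [path_eq h1]

theorem path_mem {N : ℕ} {q : ℕ × ℕ × ℕ} (h : R.step D lamAlg lamPic N = some q) {m : ℕ}
    (hm : m ≤ N) : R.path D lamAlg lamPic m ∈ R.Q D lamAlg lamPic :=
  ⟨m, step_eq_some_path h hm⟩

/-- The lexicographic order of index triples. -/
def LexLT (q q' : ℕ × ℕ × ℕ) : Prop :=
  q.1 < q'.1 ∨ (q.1 = q'.1 ∧ (q.2.1 < q'.2.1 ∨ (q.2.1 = q'.2.1 ∧ q.2.2 < q'.2.2)))

theorem lexLT_of_step {m n : ℕ} {q q' : ℕ × ℕ × ℕ} (hmn : m < n)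
    (h : R.step D lamAlg lamPic m = some q) (h' : R.step D lamAlg lamPic n = some q') :
    LexLT q q' := by
  induction n generalizing q' with
  | zero => omega
  | succ n ih =>
    obtain ⟨⟨l, k, j⟩, h1, h2⟩ := exists_of_step_succ h'
    have h3 : LexLT (l, k, j) q' := by
      rcases next_eq_some h2 with ⟨rfl, rfl⟩ | ⟨-, -, rfl⟩ | ⟨-, -, -, -, rfl⟩ |
        ⟨-, -, -, -, -, rfl⟩ <;> simp [LexLT]
    rcases Nat.lt_or_ge m n with hlt | hle
    · have h4 := ih hlt h1
      unfold LexLT at *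
      omega
    · obtain rfl : m = n := by omega
      rw [h] at h1
      rwa [Option.some.inj h1]

theorem step_injective {m n : ℕ} {q : ℕ × ℕ × ℕ} (h : R.step D lamAlg lamPic m = some q)
    (h' : R.step D lamAlg lamPic n = some q) : m = n := by
  rcases lt_trichotomy m n with hlt | heq | hlt
  · have := lexLT_of_step hlt h h'
    unfold LexLT at this; omega
  · exact heq
  · have := lexLT_of_step hlt h' h
    unfold LexLT at this; omega

theorem level_le_of_step {m n : ℕ} {q q' : ℕ × ℕ × ℕ} (hmn : m ≤ n)
    (h : R.step D lamAlg lamPic m = some q) (h' : R.step D lamAlg lamPic n = some q') :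
    q.1 ≤ q'.1 := by
  rcases hmn.lt_or_eq with hlt | rfl
  · have := lexLT_of_step hlt h h'
    unfold LexLT at this; omega
  · rw [h] at h'
    rw [Option.some.inj h']

theorem beforeEq_step {n : ℕ} {q q' : ℕ × ℕ × ℕ} (h : R.step D lamAlg lamPic n = some q) :
    R.BeforeEq D lamAlg lamPic q' q ↔ ∃ m ≤ n, R.step D lamAlg lamPic m = some q' := by
  constructor
  · rintro (⟨m, n', hmn, h1, h2⟩ | rfl)
    · obtain rfl := step_injective h h2
      exact ⟨m, hmn.le, h1⟩
    · exact ⟨n, le_rfl, h⟩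
  · rintro ⟨m, hmn, h1⟩
    rcases hmn.lt_or_eq with hlt | rfl
    · exact Or.inl ⟨m, n, hlt, h1, h⟩
    · exact Or.inr (Option.some.inj (h1.symm.trans h))

theorem stepNumber_step {n : ℕ} {q : ℕ × ℕ × ℕ} (h : R.step D lamAlg lamPic n = some q) :
    R.stepNumber D lamAlg lamPic q = n := by
  have : {q' | q' ∈ R.Q D lamAlg lamPic ∧ R.Before D lamAlg lamPic q' q} =
      ((Finset.range n).image (R.path D lamAlg lamPic) : Finset _) := by
    ext q'
    simp only [Set.mem_ofPred_eq, Finset.coe_image, Finset.coe_range, Set.mem_image, Set.mem_Iio]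
    constructor
    · rintro ⟨-, m, n', hmn, h1, h2⟩
      obtain rfl := step_injective h h2
      exact ⟨m, hmn, path_eq h1⟩
    · rintro ⟨m, hm, rfl⟩
      have h1 := step_eq_some_path h hm.le
      exact ⟨⟨m, h1⟩, m, n, hm, h1, h⟩
  rw [stepNumber, this, Set.ncard_coe_finset, Finset.card_image_of_injOn, Finset.card_range]
  intro m hm m' hm' heq
  simp only [Finset.coe_range, Set.mem_Iio] at hm hm'
  have h1 := step_eq_some_path h hm.le
  have h2 := step_eq_some_path h hm'.le
  rw [← heq] at h2
  exact step_injective h1 h2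

theorem injOn_path {n : ℕ} {q : ℕ × ℕ × ℕ} (h : R.step D lamAlg lamPic n = some q)
    {S : Finset ℕ} (hS : S ⊆ Finset.range (n + 1)) : Set.InjOn (R.path D lamAlg lamPic) S := by
  intro m hm m' hm' heq
  have hm := Finset.mem_range.1 (hS hm)
  have hm' := Finset.mem_range.1 (hS hm')
  have h1 := step_eq_some_path h (m := m) (by omega)
  have h2 := step_eq_some_path h (m := m') (by omega)
  rw [← heq] at h2
  exact step_injective h1 h2

theorem cost_step {n : ℕ} {q : ℕ × ℕ × ℕ} (h : R.step D lamAlg lamPic n = some q) :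
    R.cost D lamAlg lamPic q = ∑ m ∈ Finset.range (n + 1),
      ((R.mesh (R.path D lamAlg lamPic m).1).card : ℝ≥0∞) := by
  have : {p : ℕ × ℕ × ℕ | p ∈ R.Q D lamAlg lamPic ∧ R.BeforeEq D lamAlg lamPic p q} =
      ((Finset.range (n + 1)).image (R.path D lamAlg lamPic) : Finset _) := by
    ext q'
    simp only [Set.mem_ofPred_eq, Finset.coe_image, Finset.coe_range, Set.mem_image, Set.mem_Iio,
      beforeEq_step h]
    constructor
    · rintro ⟨-, m, hm, h1⟩
      exact ⟨m, by omega, path_eq h1⟩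
    · rintro ⟨m, hm, rfl⟩
      have h1 := step_eq_some_path h (m := m) (by omega)
      exact ⟨⟨m, h1⟩, m, by omega, h1⟩
  change ∑' p : ({p : ℕ × ℕ × ℕ | p ∈ R.Q D lamAlg lamPic ∧ R.BeforeEq D lamAlg lamPic p q} :
    Set (ℕ × ℕ × ℕ)), ((R.mesh p.1.1).card : ℝ≥0∞) = _
  rw [this, Finset.tsum_subtype' _ (fun p : ℕ × ℕ × ℕ => ((R.mesh p.1).card : ℝ≥0∞)),
    Finset.sum_image (injOn_path h subset_rfl)]

theorem costAfterZero_step {n : ℕ} {q : ℕ × ℕ × ℕ} (h : R.step D lamAlg lamPic n = some q) :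
    R.costAfterZero D lamAlg lamPic q = ∑ m ∈ Finset.range (n + 1)
      with 1 ≤ (R.path D lamAlg lamPic m).1,
      ((R.mesh (R.path D lamAlg lamPic m).1).card : ℝ≥0∞) := by
  have : {p : ℕ × ℕ × ℕ | p ∈ R.Q D lamAlg lamPic ∧ R.BeforeEq D lamAlg lamPic p q ∧ 1 ≤ p.1} =
      (((Finset.range (n + 1)).filter (fun m => 1 ≤ (R.path D lamAlg lamPic m).1)).image
        (R.path D lamAlg lamPic) : Finset _) := by
    ext q'
    simp only [Set.mem_ofPred_eq, Finset.coe_image, Set.mem_image, Finset.coe_filter,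
      Finset.mem_range, beforeEq_step h]
    constructor
    · rintro ⟨-, ⟨m, hm, h1⟩, hl⟩
      exact ⟨m, ⟨by omega, by rwa [path_eq h1]⟩, path_eq h1⟩
    · rintro ⟨m, ⟨hm, hl⟩, rfl⟩
      have h1 := step_eq_some_path h (m := m) (by omega)
      exact ⟨⟨m, h1⟩, ⟨m, by omega, h1⟩, hl⟩
  change ∑' p : ({p : ℕ × ℕ × ℕ | p ∈ R.Q D lamAlg lamPic ∧ R.BeforeEq D lamAlg lamPic p q ∧
    1 ≤ p.1} : Set (ℕ × ℕ × ℕ)), ((R.mesh p.1.1).card : ℝ≥0∞) = _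
  rw [this, Finset.tsum_subtype' _ (fun p : ℕ × ℕ × ℕ => ((R.mesh p.1).card : ℝ≥0∞)),
    Finset.sum_image (injOn_path h (Finset.filter_subset _ _))]

/-! ### Predecessors in the set of used index triples -/

theorem next_mem_Q {q t : ℕ × ℕ × ℕ} (hq : q ∈ R.Q D lamAlg lamPic)
    (h : R.next D lamAlg lamPic q = some t) : t ∈ R.Q D lamAlg lamPic := by
  obtain ⟨n, hn⟩ := hq
  exact ⟨n + 1, by rw [step_succ, hn]; exact h⟩

theorem exists_prev {q : ℕ × ℕ × ℕ} (hq : q ∈ R.Q D lamAlg lamPic) (h0 : q ≠ (0, 0, 0)) :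
    ∃ p ∈ R.Q D lamAlg lamPic, R.next D lamAlg lamPic p = some q := by
  obtain ⟨n, hn⟩ := hq
  cases n with
  | zero => exact absurd (Option.some.inj hn).symm h0
  | succ n =>
    obtain ⟨p, h1, h2⟩ := exists_of_step_succ hn
    exact ⟨p, ⟨n, h1⟩, h2⟩

theorem prev_solver {l k j : ℕ} (hq : (l, k, j + 1) ∈ R.Q D lamAlg lamPic) :
    (l, k, j) ∈ R.Q D lamAlg lamPic ∧
      R.next D lamAlg lamPic (l, k, j) = some (l, k, j + 1) := by
  obtain ⟨⟨l', k', j'⟩, h1, h2⟩ := exists_prev hq (by simp)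
  rcases next_eq_some h2 with ⟨-, h⟩ | ⟨-, -, h⟩ | ⟨-, -, -, -, h⟩ | ⟨-, -, -, -, -, h⟩ <;>
    simp only [Prod.mk.injEq] at h
  · omega
  · obtain ⟨rfl, rfl, h⟩ := h
    obtain rfl : j = j' := by omega
    exact ⟨h1, h2⟩
  · omega
  · omega

theorem prev_mesh {l : ℕ} (hq : (l + 1, 0, 0) ∈ R.Q D lamAlg lamPic) :
    ∃ k j, (l, k, j) ∈ R.Q D lamAlg lamPic ∧
      R.next D lamAlg lamPic (l, k, j) = some (l + 1, 0, 0) := by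
  obtain ⟨⟨l', k', j'⟩, h1, h2⟩ := exists_prev hq (by simp)
  rcases next_eq_some h2 with ⟨-, h⟩ | ⟨-, -, h⟩ | ⟨-, -, -, -, h⟩ | ⟨-, -, -, -, -, h⟩ <;>
    simp only [Prod.mk.injEq] at h
  · omega
  · omega
  · omega
  · obtain rfl : l = l' := by omega
    exact ⟨_, _, h1, h2⟩

theorem start_mem_Q {l k j : ℕ} (hq : (l, k, j) ∈ R.Q D lamAlg lamPic) :
    (l, k, 0) ∈ R.Q D lamAlg lamPic := by
  induction j with
  | zero => exact hq
  | succ j ih => exact ih (prev_solver hq).1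

theorem level_mem_Q {l k j : ℕ} (hq : (l, k, j) ∈ R.Q D lamAlg lamPic) :
    (l, 0, 0) ∈ R.Q D lamAlg lamPic := by
  induction k generalizing j with
  | zero => exact start_mem_Q hq
  | succ k ih =>
    obtain ⟨⟨l', k', j'⟩, h1, h2⟩ := exists_prev (start_mem_Q hq) (by simp)
    rcases next_eq_some h2 with ⟨h0, h⟩ | ⟨-, -, h⟩ | ⟨-, -, -, -, h⟩ | ⟨-, -, -, -, -, h⟩ <;>
      simp only [Prod.mk.injEq] at h
    · obtain ⟨rfl, h3, -⟩ := h
      obtain rfl : k' = k := by omega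
      exact ih h1
    · omega
    · obtain ⟨rfl, h3, -⟩ := h
      obtain rfl : k' = k := by omega
      exact ih h1
    · omega

theorem level_mem_Q_of_le {l i : ℕ} (hq : (l, 0, 0) ∈ R.Q D lamAlg lamPic) (hi : i ≤ l) :
    (i, 0, 0) ∈ R.Q D lamAlg lamPic := by
  induction l with
  | zero => obtain rfl : i = 0 := by omega
            exact hq
  | succ l ih =>
    rcases Nat.lt_or_ge l i with hlt | hle
    · obtain rfl : i = l + 1 := by omega
      exact hq
    · obtain ⟨k, j, h1, -⟩ := prev_mesh hq
      exact ih (level_mem_Q h1) hle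

end Iterates

namespace IsRun

open Iterates

variable {𝕜 V E : Type*} [RCLike 𝕜] [NormedAddCommGroup V] [InnerProductSpace 𝕜 V]
  {D : Discretization 𝕜 V E} {R : Iterates V E}
  {α L Cson Cmesh Cstab Crel qred θ lamAlg lamPic Cmark qalg : ℝ}

theorem mem_meshes (hR : IsRun D α L θ lamAlg lamPic Cmark qalg R) {l : ℕ}
    (hq : (l, 0, 0) ∈ R.Q D lamAlg lamPic) : R.mesh l ∈ D.meshes := by
  induction l with
  | zero => rw [hR.mesh_zero]; exact Relation.ReflTransGen.refl
  | succ l ih =>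
    obtain ⟨k, j, h1, h2⟩ := prev_mesh hq
    obtain ⟨hM, -, -, hm, -⟩ := hR.next_mesh l k j h1 h2
    rw [hm]
    exact Discretization.mem_meshes_of_refines (ih (level_mem_Q h1))
      (Discretization.refines_refine hM)

theorem refines (hR : IsRun D α L θ lamAlg lamPic Cmark qalg R) {l : ℕ}
    (hq : (l + 1, 0, 0) ∈ R.Q D lamAlg lamPic) :
    Refines D.refine (R.mesh l) (R.mesh (l + 1)) := by
  obtain ⟨k, j, h1, h2⟩ := prev_mesh hq
  obtain ⟨hM, -, -, hm, -⟩ := hR.next_mesh l k j h1 h2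
  rw [hm]
  exact Discretization.refines_refine hM

variable [DecidableEq E]

theorem marked_subset (hR : IsRun D α L θ lamAlg lamPic Cmark qalg R)
    (hD : D.Assumptions α L Cson Cmesh Cstab Crel qred) {l : ℕ}
    (hq : (l + 1, 0, 0) ∈ R.Q D lamAlg lamPic) :
    R.marked l ⊆ R.mesh l \ R.mesh (l + 1) := by
  obtain ⟨k, j, h1, h2⟩ := prev_mesh hq
  obtain ⟨hM, -, -, hm, -⟩ := hR.next_mesh l k j h1 h2
  rw [hm]
  exact hD.marked_refined _ (hR.mem_meshes (level_mem_Q h1)) _ hM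

theorem mem_space (hR : IsRun D α L θ lamAlg lamPic Cmark qalg R)
    (hD : D.Assumptions α L Cson Cmesh Cstab Crel qred) {l k j : ℕ}
    (hq : (l, k, j) ∈ R.Q D lamAlg lamPic) : R.u l k j ∈ D.X (R.mesh l) := by
  obtain ⟨n, hn⟩ := hq
  induction n generalizing l k j with
  | zero =>
    obtain ⟨rfl, rfl, rfl⟩ : 0 = l ∧ 0 = k ∧ 0 = j := by simpa [step] using hn
    rw [hR.mesh_zero]; exact hR.u_zero
  | succ n ih =>
    obtain ⟨⟨l', k', j'⟩, h1, h2⟩ := exists_of_step_succ hn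
    have hQ : (l', k', j') ∈ R.Q D lamAlg lamPic := ⟨n, h1⟩
    have ih := ih h1
    rcases next_eq_some h2 with ⟨h0, h⟩ | ⟨-, -, h⟩ | ⟨-, -, -, -, h⟩ | ⟨-, -, -, -, -, h⟩ <;>
      obtain ⟨rfl, rfl, rfl⟩ := by simpa only [Prod.mk.injEq] using h
    · subst h0
      rw [hR.next_linearization _ 0 _ hQ h2]
      exact ih
    · exact (hR.solver_step _ _ _ hQ h2).1
    · rw [hR.next_linearization _ _ _ hQ h2]
      exact ih
    · rw [(hR.next_mesh _ _ _ hQ h2).2.2.2.2]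
      exact hD.nested _ (hR.mem_meshes (level_mem_Q hQ)) _
        (hR.refines (next_mem_Q hQ h2)) ih

end IsRun

/-! ### Thresholds of the parameters and contraction properties of the three loops -/

/-- The threshold for `lamAlg + lamAlg / lamPic`; for arguments outside of the admissible range, a
positive junk value. -/
noncomputable def lamAlgThreshold (qPic qalg : ℝ) : ℝ :=
  if 0 < (1 - qPic) / (4 * (qalg / (1 - qalg))) then (1 - qPic) / (4 * (qalg / (1 - qalg))) else 1

/-- The threshold for `lamPic / θ`. The absolute values only serve to make it positive for arguments
outside of the admissible range. -/
noncomputable def lamPicThreshold (Cstab qPic qalg : ℝ) : ℝ :=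
  (1 + |Cstab| * ((1 + |qPic / (1 - qPic)|) * |qalg / (1 - qalg)| * lamAlgThreshold qPic qalg +
    |qPic / (1 - qPic)|))⁻¹

/-- The threshold for the marking parameter `θ`. -/
noncomputable def thetaThreshold (Cstab Crel : ℝ) : ℝ := (4 * (1 + Cstab ^ 2 * Crel ^ 2))⁻¹

theorem lamAlgThreshold_pos (qPic qalg : ℝ) : 0 < lamAlgThreshold qPic qalg := by
  unfold lamAlgThreshold
  split_ifs with h
  · exact h
  · exact one_pos

theorem lamPicThreshold_pos (Cstab qPic qalg : ℝ) : 0 < lamPicThreshold Cstab qPic qalg := by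
  have := lamAlgThreshold_pos qPic qalg
  unfold lamPicThreshold
  positivity

theorem thetaThreshold_pos (Cstab Crel : ℝ) : 0 < thetaThreshold Cstab Crel := by
  unfold thetaThreshold
  positivity

/-- The conditions on the constants and on the parameters of the algorithm. -/
structure IsAdmissible (α L Cstab Crel qred qalg θ lamAlg lamPic : ℝ) : Prop where
  α_pos : 0 < α
  α_le : α ≤ L
  Cstab_pos : 0 < Cstab
  Crel_pos : 0 < Crel
  qred_pos : 0 < qred
  qred_lt : qred < 1
  qalg_pos : 0 < qalg
  qalg_lt : qalg < 1
  θ_pos : 0 < θ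
  θ_lt : θ < 1
  θ_lt_threshold : θ < thetaThreshold Cstab Crel
  lamAlg_pos : 0 < lamAlg
  lamPic_pos : 0 < lamPic
  lamAlg_lt : lamAlg + lamAlg / lamPic < lamAlgThreshold (qPicard α L) qalg
  lamPic_lt : lamPic / θ < lamPicThreshold Cstab (qPicard α L) qalg

/-- If both stopping criteria hold, the Galerkin error is at most this multiple of the estimator. -/
noncomputable def stopFactor (CPic Calg lamAlg lamPic : ℝ) : ℝ :=
  (1 + CPic) * Calg * lamAlg + (CPic + (1 + CPic) * Calg * lamAlg) * lamPic

namespace IsAdmissible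

variable {α L Cstab Crel qred qalg θ lamAlg lamPic : ℝ}

theorem CPic_nonneg (h : IsAdmissible α L Cstab Crel qred qalg θ lamAlg lamPic) :
    0 ≤ qPicard α L / (1 - qPicard α L) :=
  div_nonneg (qPicard_nonneg _ _) (sub_nonneg.2 (qPicard_lt_one h.α_pos h.α_le).le)

theorem Calg_pos (h : IsAdmissible α L Cstab Crel qred qalg θ lamAlg lamPic) :
    0 < qalg / (1 - qalg) :=
  div_pos h.qalg_pos (sub_pos.2 h.qalg_lt)

theorem Calg_mul_le (h : IsAdmissible α L Cstab Crel qred qalg θ lamAlg lamPic) :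
    qalg / (1 - qalg) * (lamAlg + lamAlg / lamPic) ≤ (1 - qPicard α L) / 4 := by
  have h1 := h.Calg_pos
  have h2 := qPicard_lt_one h.α_pos h.α_le
  have h3 : lamAlgThreshold (qPicard α L) qalg =
      (1 - qPicard α L) / (4 * (qalg / (1 - qalg))) :=
    if_pos (div_pos (by linarith) (by linarith))
  have h4 := h.lamAlg_lt.le
  rw [h3] at h4
  calc _ ≤ qalg / (1 - qalg) * ((1 - qPicard α L) / (4 * (qalg / (1 - qalg)))) := by gcongr
    _ = _ := by generalize qalg / (1 - qalg) = c at *; field_simp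

theorem ratio_pos (h : IsAdmissible α L Cstab Crel qred qalg θ lamAlg lamPic) :
    0 < lamPic / lamPicThreshold Cstab (qPicard α L) qalg :=
  div_pos h.lamPic_pos (lamPicThreshold_pos _ _ _)

theorem ratio_lt (h : IsAdmissible α L Cstab Crel qred qalg θ lamAlg lamPic) :
    lamPic / lamPicThreshold Cstab (qPicard α L) qalg < θ := by
  have := h.lamPic_lt
  rwa [div_lt_iff₀ h.θ_pos, mul_comm, ← div_lt_iff₀ (lamPicThreshold_pos _ _ _)] at this

theorem stopFactor_pos (h : IsAdmissible α L Cstab Crel qred qalg θ lamAlg lamPic) :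
    0 < stopFactor (qPicard α L / (1 - qPicard α L)) (qalg / (1 - qalg)) lamAlg lamPic := by
  have := h.CPic_nonneg
  have := h.Calg_pos
  have := h.lamAlg_pos
  have := h.lamPic_pos
  unfold stopFactor
  positivity

theorem Cstab_mul_stopFactor_le (h : IsAdmissible α L Cstab Crel qred qalg θ lamAlg lamPic) :
    Cstab * stopFactor (qPicard α L / (1 - qPicard α L)) (qalg / (1 - qalg)) lamAlg lamPic ≤
      lamPic / lamPicThreshold Cstab (qPicard α L) qalg := by
  have h1 := h.CPic_nonneg
  have h2 := h.Calg_pos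
  have h3 := h.lamAlg_lt.le
  have h4 := h.lamPic_pos
  have h5 := h.Cstab_pos
  rw [lamPicThreshold, abs_of_nonneg h1, abs_of_pos h2, abs_of_pos h5, div_inv_eq_mul]
  generalize qPicard α L / (1 - qPicard α L) = CP at *
  generalize qalg / (1 - qalg) = CA at *
  generalize lamAlgThreshold _ _ = lS at *
  have h6 : stopFactor CP CA lamAlg lamPic =
      lamPic * ((1 + CP) * CA * (lamAlg + lamAlg / lamPic) + CP) := by
    unfold stopFactor; field_simp; ring
  rw [h6]
  calc _ ≤ Cstab * (lamPic * ((1 + CP) * CA * lS + CP)) := by gcongr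
    _ ≤ _ := by linarith

theorem thetaPrime_pos_lt (h : IsAdmissible α L Cstab Crel qred qalg θ lamAlg lamPic) {θ' : ℝ}
    (hθ' : θ' = thetaPrime Cstab (qPicard α L / (1 - qPicard α L)) (qalg / (1 - qalg))
      θ lamAlg lamPic (lamPicThreshold Cstab (qPicard α L) qalg)) :
    0 < θ' ∧ θ' < (1 + Cstab ^ 2 * Crel ^ 2)⁻¹ := by
  have h1 := h.Cstab_mul_stopFactor_le
  have h2 := h.ratio_lt
  have h3 := mul_pos h.Cstab_pos h.stopFactor_pos
  have h4 := h.θ_pos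
  have h5 := h.θ_lt_threshold
  rw [hθ', thetaPrime]
  rw [stopFactor] at h1 h3
  generalize lamPic / lamPicThreshold _ _ _ = ρ at *
  generalize Cstab * _ = B at *
  have h0 : (0 : ℝ) < 1 + Cstab ^ 2 * Crel ^ 2 := by positivity
  have h6 : 4 * θ < (1 + Cstab ^ 2 * Crel ^ 2)⁻¹ := by
    rw [thetaThreshold, mul_inv] at h5; linarith
  have h7 : (1 + Cstab ^ 2 * Crel ^ 2)⁻¹ ≤ 1 :=
    inv_le_one_of_one_le₀ (by have : 0 ≤ Cstab ^ 2 * Crel ^ 2 := by positivity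
                              linarith)
  refine ⟨div_pos (by linarith) (by linarith), ?_⟩
  refine lt_of_le_of_lt ?_ h6
  rw [div_le_iff₀ (by linarith)]
  nlinarith

end IsAdmissible

namespace IsRun

open Iterates Discretization

variable {𝕜 V E : Type*} [RCLike 𝕜] [NormedAddCommGroup V] [InnerProductSpace 𝕜 V]
  {D : Discretization 𝕜 V E} {R : Iterates V E}
  {α L Cson Cmesh Cstab Crel qred θ lamAlg lamPic Cmark qalg : ℝ}

/-! ### Linearization and algebraic solver -/

theorem solver_contraction (hR : IsRun D α L θ lamAlg lamPic Cmark qalg R) {l k j : ℕ}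
    (hq : (l, k, j + 1) ∈ R.Q D lamAlg lamPic) :
    ‖R.uLin D α L l k - R.u l k (j + 1)‖ ≤ qalg * ‖R.uLin D α L l k - R.u l k j‖ :=
  (hR.solver_step l k j (prev_solver hq).1 (prev_solver hq).2).2

theorem norm_solver_update_le (hp : IsAdmissible α L Cstab Crel qred qalg θ lamAlg lamPic)
    (hR : IsRun D α L θ lamAlg lamPic Cmark qalg R) {l k j : ℕ}
    (hq : (l, k, j + 1) ∈ R.Q D lamAlg lamPic) :
    ‖R.u l k (j + 1) - R.u l k j‖ ≤ 2 * ‖R.uLin D α L l k - R.u l k j‖ := by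
  have h1 := solver_contraction hR hq
  have h2 := norm_sub_le_norm_sub_add_norm_sub (R.u l k (j + 1)) (R.uLin D α L l k) (R.u l k j)
  rw [norm_sub_rev (R.u l k (j + 1)) (R.uLin D α L l k)] at h2
  have h3 := mul_le_mul_of_nonneg_right hp.qalg_lt.le (norm_nonneg (R.uLin D α L l k - R.u l k j))
  linarith

theorem algebraic_error_le (hp : IsAdmissible α L Cstab Crel qred qalg θ lamAlg lamPic)
    (hR : IsRun D α L θ lamAlg lamPic Cmark qalg R) {l k j : ℕ} (hj : j ≠ 0)
    (hq : (l, k, j) ∈ R.Q D lamAlg lamPic) (hAlg : R.AlgStop D lamAlg l k j) :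
    ‖R.uLin D α L l k - R.u l k j‖ ≤ qalg / (1 - qalg) *
      (lamAlg * (D.est (R.mesh l) (R.u l k j) + ‖R.u l k j - R.u l k 0‖)) := by
  obtain ⟨j, rfl⟩ := Nat.exists_eq_succ_of_ne_zero hj
  have h1 := solver_contraction hR hq
  have h2 := norm_sub_le_norm_sub_add_norm_sub (R.uLin D α L l k) (R.u l k (j + 1)) (R.u l k j)
  have h3 : ‖R.u l k (j + 1) - R.u l k j‖ ≤ _ := hAlg
  have h4 := mul_le_mul_of_nonneg_left (h2.trans (add_le_add_right h3 _)) hp.qalg_pos.le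
  rw [div_mul_eq_mul_div, le_div_iff₀ (by linarith [hp.qalg_lt])]
  change ‖R.uLin D α L l k - R.u l k (j + 1)‖ * _ ≤ _
  change _ ≤ qalg * (lamAlg * (D.est (R.mesh l) (R.u l k (j + 1)) +
    ‖R.u l k (j + 1) - R.u l k 0‖))
  linarith

theorem Delta_nonneg (q : ℕ × ℕ × ℕ) : 0 ≤ R.Delta D α L q := by
  obtain ⟨l, k, j⟩ := q
  exact add_nonneg (add_nonneg (norm_nonneg _) (norm_nonneg _)) (est_nonneg _ _)

variable [DecidableEq E]

theorem Delta_solver_step_le (hp : IsAdmissible α L Cstab Crel qred qalg θ lamAlg lamPic)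
    (hD : D.Assumptions α L Cson Cmesh Cstab Crel qred)
    (hR : IsRun D α L θ lamAlg lamPic Cmark qalg R) {l k j : ℕ}
    (hq : (l, k, j + 1) ∈ R.Q D lamAlg lamPic) :
    R.Delta D α L (l, k, j + 1) ≤ (3 + 2 * Cstab) * R.Delta D α L (l, k, j) := by
  have hm := hR.mem_meshes (level_mem_Q hq)
  have h1 := norm_solver_update_le hp hR hq
  have h2 := hD.est_le_add hm (mem_space hR hD hq) (mem_space hR hD (prev_solver hq).1)
  have h3 := norm_sub_le_norm_sub_add_norm_sub D.uStar (R.u l k j) (R.u l k (j + 1))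
  rw [norm_sub_rev (R.u l k j)] at h3
  have h4 := mul_le_mul_of_nonneg_left h1 hp.Cstab_pos.le
  have h5 := solver_contraction hR hq
  have h6 := mul_le_mul_of_nonneg_right hp.qalg_lt.le (norm_nonneg (R.uLin D α L l k - R.u l k j))
  have h7 := norm_nonneg (D.uStar - R.u l k j)
  have h8 := est_nonneg (D := D) (R.mesh l) (R.u l k j)
  have h9 := mul_nonneg hp.Cstab_pos.le h7
  have h10 := mul_nonneg hp.Cstab_pos.le h8
  simp only [Delta]
  linarith

/-- On passing to the next mesh, the quasi-error does not increase: the iterate stays the same, and its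
algebraic error is discarded. -/
theorem Delta_mesh_step_le (hp : IsAdmissible α L Cstab Crel qred qalg θ lamAlg lamPic)
    (hD : D.Assumptions α L Cson Cmesh Cstab Crel qred)
    (hR : IsRun D α L θ lamAlg lamPic Cmark qalg R) {l k j : ℕ}
    (hq : (l, k, j) ∈ R.Q D lamAlg lamPic)
    (hn : R.next D lamAlg lamPic (l, k, j) = some (l + 1, 0, 0)) :
    R.Delta D α L (l + 1, 0, 0) ≤ R.Delta D α L (l, k, j) := by
  have hq' := next_mem_Q hq hn
  have h1 := (hR.next_mesh l k j hq hn).2.2.2.2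
  have h2 := hD.est_refine_le hp.qred_pos hp.qred_lt (hR.mem_meshes (level_mem_Q hq))
    (hR.refines hq') (mem_space hR hD hq)
  have h3 := norm_nonneg (R.uLin D α L l k - R.u l k j)
  simp only [Delta, uLin, if_true, sub_self, norm_zero, h1]
  simp only [uLin] at h3
  linarith

variable [CompleteSpace V]

theorem isPicardSolution_uLin
    (hD : D.Assumptions α L Cson Cmesh Cstab Crel qred)
    (hR : IsRun D α L θ lamAlg lamPic Cmark qalg R) {l k : ℕ} (hk : k ≠ 0)
    (hq : (l, k, 0) ∈ R.Q D lamAlg lamPic) :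
    IsPicardSolution D.A D.F α L (D.X (R.mesh l)) (R.u l k 0) (R.uLin D α L l k) := by
  rw [uLin, if_neg hk]
  exact isPicardSolution_picardSolution (hD.isComplete (hR.mem_meshes (level_mem_Q hq))) _

theorem norm_sub_uLin_le (hp : IsAdmissible α L Cstab Crel qred qalg θ lamAlg lamPic)
    (hD : D.Assumptions α L Cson Cmesh Cstab Crel qred)
    (hR : IsRun D α L θ lamAlg lamPic Cmark qalg R) {l k : ℕ} (hk : k ≠ 0)
    (hq : (l, k, 0) ∈ R.Q D lamAlg lamPic) :
    ‖D.uStarOn (R.mesh l) - R.uLin D α L l k‖ ≤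
      qPicard α L * ‖D.uStarOn (R.mesh l) - R.u l k 0‖ := by
  have hA := hD.isMonotoneLipschitz hp.α_pos hp.α_le
  have h1 := hD.isSolution_uStarOn hp.α_pos hp.α_le (hR.mem_meshes (level_mem_Q hq))
  exact ((isSolution_iff_isPicardSolution_self hA).1 h1).norm_sub_le hA
    (isPicardSolution_uLin hD hR hk hq)

theorem norm_sub_uLin_le' (hp : IsAdmissible α L Cstab Crel qred qalg θ lamAlg lamPic)
    (hD : D.Assumptions α L Cson Cmesh Cstab Crel qred)
    (hR : IsRun D α L θ lamAlg lamPic Cmark qalg R) {l k : ℕ} (hk : k ≠ 0)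
    (hq : (l, k, 0) ∈ R.Q D lamAlg lamPic) :
    ‖D.uStarOn (R.mesh l) - R.uLin D α L l k‖ ≤
      qPicard α L / (1 - qPicard α L) * ‖R.uLin D α L l k - R.u l k 0‖ := by
  have h1 := norm_sub_uLin_le hp hD hR hk hq
  have h2 := norm_sub_le_norm_sub_add_norm_sub (D.uStarOn (R.mesh l)) (R.uLin D α L l k)
    (R.u l k 0)
  have h3 := qPicard_lt_one hp.α_pos hp.α_le
  have h4 := mul_le_mul_of_nonneg_left h2 (qPicard_nonneg α L)
  rw [div_mul_eq_mul_div, le_div_iff₀ (by linarith)]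
  linarith

/-! ### The quasi-error -/

theorem galerkin_error_le (hp : IsAdmissible α L Cstab Crel qred qalg θ lamAlg lamPic)
    (hD : D.Assumptions α L Cson Cmesh Cstab Crel qred)
    (hR : IsRun D α L θ lamAlg lamPic Cmark qalg R) {l k j : ℕ}
    (hq : (l, k, j) ∈ R.Q D lamAlg lamPic) :
    ‖D.uStarOn (R.mesh l) - R.u l k j‖ ≤ (1 + L / α) * R.Delta D α L (l, k, j) := by
  have h1 := hD.cea hp.α_pos hp.α_le (hR.mem_meshes (level_mem_Q hq)) (mem_space hR hD hq)
  have h2 := norm_sub_le_norm_sub_add_norm_sub (D.uStarOn (R.mesh l)) D.uStar (R.u l k j)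
  rw [norm_sub_rev (D.uStarOn _) D.uStar] at h2
  have h3 : ‖D.uStar - R.u l k j‖ ≤ R.Delta D α L (l, k, j) := by
    have := norm_nonneg (R.uLin D α L l k - R.u l k j)
    have := est_nonneg (D := D) (R.mesh l) (R.u l k j)
    simp only [Delta]; linarith
  have h4 : 0 ≤ 1 + L / α := by
    have := div_pos (hp.α_pos.trans_le hp.α_le) hp.α_pos
    linarith
  have := mul_le_mul_of_nonneg_left h3 h4
  linarith

theorem est_uStarOn_le_Delta (hp : IsAdmissible α L Cstab Crel qred qalg θ lamAlg lamPic)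
    (hD : D.Assumptions α L Cson Cmesh Cstab Crel qred)
    (hR : IsRun D α L θ lamAlg lamPic Cmark qalg R) {l k j : ℕ}
    (hq : (l, k, j) ∈ R.Q D lamAlg lamPic) :
    D.est (R.mesh l) (D.uStarOn (R.mesh l)) ≤
      (1 + Cstab * (1 + L / α)) * R.Delta D α L (l, k, j) := by
  have hm := hR.mem_meshes (level_mem_Q hq)
  have h1 := galerkin_error_le hp hD hR hq
  have h2 := hD.est_le_add hm (hD.isSolution_uStarOn hp.α_pos hp.α_le hm).1 (mem_space hR hD hq)
  have h3 := mul_le_mul_of_nonneg_left h1 hp.Cstab_pos.le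
  have h4 : D.est (R.mesh l) (R.u l k j) ≤ R.Delta D α L (l, k, j) := by
    have := norm_nonneg (R.uLin D α L l k - R.u l k j)
    have := norm_nonneg (D.uStar - R.u l k j)
    simp only [Delta]; linarith
  linarith

theorem Delta_le (hp : IsAdmissible α L Cstab Crel qred qalg θ lamAlg lamPic)
    (hD : D.Assumptions α L Cson Cmesh Cstab Crel qred)
    (hR : IsRun D α L θ lamAlg lamPic Cmark qalg R) {l k j : ℕ}
    (hq : (l, k, j) ∈ R.Q D lamAlg lamPic) :
    R.Delta D α L (l, k, j) ≤ (1 + Crel * Cstab) * ‖D.uStarOn (R.mesh l) - R.u l k j‖ +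
      ‖R.uLin D α L l k - R.u l k j‖ + (1 + Crel) * D.est (R.mesh l) (R.u l k j) := by
  have hm := hR.mem_meshes (level_mem_Q hq)
  have h1 := hD.reliability _ hm
  have h2 := hD.est_le_add hm (hD.isSolution_uStarOn hp.α_pos hp.α_le hm).1 (mem_space hR hD hq)
  have h3 := norm_sub_le_norm_sub_add_norm_sub D.uStar (D.uStarOn (R.mesh l)) (R.u l k j)
  have h4 := mul_le_mul_of_nonneg_left h2 hp.Crel_pos.le
  simp only [Delta]
  linarith

/-- As long as the algebraic solver does not stop, its preceding error dominates the quasi-error. -/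
theorem Delta_le_of_not_algStop (hp : IsAdmissible α L Cstab Crel qred qalg θ lamAlg lamPic)
    (hD : D.Assumptions α L Cson Cmesh Cstab Crel qred)
    (hR : IsRun D α L θ lamAlg lamPic Cmark qalg R) {l k j : ℕ} (hk : k ≠ 0)
    (hq : (l, k, j + 1) ∈ R.Q D lamAlg lamPic) (hAlg : ¬ R.AlgStop D lamAlg l k (j + 1)) :
    R.Delta D α L (l, k, j + 1) ≤ ((1 + Crel * Cstab) * (1 + qPicard α L / (1 - qPicard α L) *
      (1 + 2 / lamAlg)) + 1 + (1 + Crel) * (2 / lamAlg)) * ‖R.uLin D α L l k - R.u l k j‖ := by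
  have h1 := norm_solver_update_le hp hR hq
  have h2 := solver_contraction hR hq
  have h3 := norm_sub_uLin_le' hp hD hR hk (start_mem_Q hq)
  have h4 : lamAlg * (D.est (R.mesh l) (R.u l k (j + 1)) + ‖R.u l k (j + 1) - R.u l k 0‖) <
      ‖R.u l k (j + 1) - R.u l k j‖ := not_le.1 hAlg
  have h5 := mul_le_mul_of_nonneg_right hp.qalg_lt.le (norm_nonneg (R.uLin D α L l k - R.u l k j))
  have h6 := Delta_le hp hD hR hq
  have h7 := norm_sub_le_norm_sub_add_norm_sub (D.uStarOn (R.mesh l)) (R.uLin D α L l k)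
    (R.u l k (j + 1))
  have h8 := norm_sub_le_norm_sub_add_norm_sub (R.uLin D α L l k) (R.u l k (j + 1)) (R.u l k 0)
  have hCP := hp.CPic_nonneg
  have hCr := hp.Crel_pos
  have hCs := hp.Cstab_pos
  have hη := est_nonneg (D := D) (R.mesh l) (R.u l k (j + 1))
  have hd := norm_nonneg (R.u l k (j + 1) - R.u l k 0)
  generalize ‖R.uLin D α L l k - R.u l k j‖ = a at *
  generalize ‖R.uLin D α L l k - R.u l k (j + 1)‖ = a' at *
  generalize qPicard α L / (1 - qPicard α L) = CP at *
  have h9 : D.est (R.mesh l) (R.u l k (j + 1)) + ‖R.u l k (j + 1) - R.u l k 0‖ ≤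
      2 / lamAlg * a := by
    rw [div_mul_eq_mul_div, le_div_iff₀ hp.lamAlg_pos]
    linarith
  have ha' : a' ≤ a := by linarith
  have h10 : ‖D.uStarOn (R.mesh l) - R.u l k (j + 1)‖ ≤ (1 + CP * (1 + 2 / lamAlg)) * a := by
    have : ‖R.uLin D α L l k - R.u l k 0‖ ≤ (1 + 2 / lamAlg) * a := by linarith
    have := h3.trans (mul_le_mul_of_nonneg_left this hCP)
    linarith
  calc _ ≤ _ := h6
    _ ≤ (1 + Crel * Cstab) * ((1 + CP * (1 + 2 / lamAlg)) * a) + a +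
        (1 + Crel) * (2 / lamAlg * a) := by
      gcongr
      linarith
    _ = _ := by ring

/-- If both stopping criteria hold, the estimator dominates the algebraic error and the Galerkin
error. -/
theorem final_bounds (hp : IsAdmissible α L Cstab Crel qred qalg θ lamAlg lamPic)
    (hD : D.Assumptions α L Cson Cmesh Cstab Crel qred)
    (hR : IsRun D α L θ lamAlg lamPic Cmark qalg R) {l k j : ℕ} (hk : k ≠ 0) (hj : j ≠ 0)
    (hq : (l, k, j) ∈ R.Q D lamAlg lamPic) (hAlg : R.AlgStop D lamAlg l k j)
    (hPic : R.PicStop D lamPic l k j) :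
    ‖R.uLin D α L l k - R.u l k j‖ ≤ qalg / (1 - qalg) * (lamAlg * (1 + lamPic)) *
      D.est (R.mesh l) (R.u l k j) ∧
    ‖D.uStarOn (R.mesh l) - R.u l k j‖ ≤
      stopFactor (qPicard α L / (1 - qPicard α L)) (qalg / (1 - qalg)) lamAlg lamPic *
      D.est (R.mesh l) (R.u l k j) := by
  have h1 := algebraic_error_le hp hR hj hq hAlg
  have h2 : ‖R.u l k j - R.u l k 0‖ ≤ lamPic * D.est (R.mesh l) (R.u l k j) := hPic
  have h3 := norm_sub_uLin_le' hp hD hR hk (start_mem_Q hq)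
  have h7 := norm_sub_le_norm_sub_add_norm_sub (D.uStarOn (R.mesh l)) (R.uLin D α L l k)
    (R.u l k j)
  have h8 := norm_sub_le_norm_sub_add_norm_sub (R.uLin D α L l k) (R.u l k j) (R.u l k 0)
  have hCP := hp.CPic_nonneg
  have hCA := hp.Calg_pos
  have hla := hp.lamAlg_pos
  generalize qPicard α L / (1 - qPicard α L) = CP at *
  generalize qalg / (1 - qalg) = CA at *
  generalize D.est (R.mesh l) (R.u l k j) = η at *
  have h9 : ‖R.uLin D α L l k - R.u l k j‖ ≤ CA * (lamAlg * (1 + lamPic)) * η := by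
    calc _ ≤ _ := h1
      _ ≤ CA * (lamAlg * (η + lamPic * η)) := by gcongr
      _ = _ := by ring
  refine ⟨h9, ?_⟩
  calc _ ≤ _ := h7
    _ ≤ CP * (CA * (lamAlg * (1 + lamPic)) * η + lamPic * η) +
        CA * (lamAlg * (1 + lamPic)) * η := by
      gcongr
      refine h3.trans ?_
      gcongr
      exact h8.trans (by gcongr)
    _ = _ := by unfold stopFactor; ring

theorem Delta_le_of_final (hp : IsAdmissible α L Cstab Crel qred qalg θ lamAlg lamPic)
    (hD : D.Assumptions α L Cson Cmesh Cstab Crel qred)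
    (hR : IsRun D α L θ lamAlg lamPic Cmark qalg R) {l k j : ℕ} (hk : k ≠ 0) (hj : j ≠ 0)
    (hq : (l, k, j) ∈ R.Q D lamAlg lamPic) (hAlg : R.AlgStop D lamAlg l k j)
    (hPic : R.PicStop D lamPic l k j) :
    R.Delta D α L (l, k, j) ≤ ((1 + Crel * Cstab) *
      stopFactor (qPicard α L / (1 - qPicard α L)) (qalg / (1 - qalg)) lamAlg lamPic +
      qalg / (1 - qalg) * (lamAlg * (1 + lamPic)) + (1 + Crel)) *
      D.est (R.mesh l) (R.u l k j) := by
  obtain ⟨h1, h2⟩ := final_bounds hp hD hR hk hj hq hAlg hPic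
  have h3 := Delta_le hp hD hR hq
  have hCr := hp.Crel_pos
  have hCs := hp.Cstab_pos
  calc _ ≤ _ := h3
    _ ≤ (1 + Crel * Cstab) * (stopFactor (qPicard α L / (1 - qPicard α L)) (qalg / (1 - qalg))
        lamAlg lamPic * D.est (R.mesh l) (R.u l k j)) + qalg / (1 - qalg) *
        (lamAlg * (1 + lamPic)) * D.est (R.mesh l) (R.u l k j) +
        (1 + Crel) * D.est (R.mesh l) (R.u l k j) := by gcongr
    _ = _ := by ring

/-- At final iterates, the estimators of the iterate and of the Galerkin solution are equivalent,
also on sets of elements. -/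
theorem final_estOn_sub_le (hp : IsAdmissible α L Cstab Crel qred qalg θ lamAlg lamPic)
    (hD : D.Assumptions α L Cson Cmesh Cstab Crel qred)
    (hR : IsRun D α L θ lamAlg lamPic Cmark qalg R) {l k j : ℕ} (hk : k ≠ 0) (hj : j ≠ 0)
    (hq : (l, k, j) ∈ R.Q D lamAlg lamPic) (hAlg : R.AlgStop D lamAlg l k j)
    (hPic : R.PicStop D lamPic l k j) {S : Finset E} (hS : S ⊆ R.mesh l) :
    |D.estOn (R.mesh l) S (D.uStarOn (R.mesh l)) - D.estOn (R.mesh l) S (R.u l k j)| ≤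
      Cstab * stopFactor (qPicard α L / (1 - qPicard α L)) (qalg / (1 - qalg)) lamAlg lamPic *
        D.est (R.mesh l) (R.u l k j) := by
  have hm := hR.mem_meshes (level_mem_Q hq)
  have h1 := hD.abs_estOn_sub_le hm hS (hD.isSolution_uStarOn hp.α_pos hp.α_le hm).1
    (mem_space hR hD hq)
  have h2 := mul_le_mul_of_nonneg_left (final_bounds hp hD hR hk hj hq hAlg hPic).2
    hp.Cstab_pos.le
  rw [mul_assoc]
  exact h1.trans h2

/-- As long as the linearization does not stop, the inexact Picard iteration contracts. -/
theorem picard_contraction (hp : IsAdmissible α L Cstab Crel qred qalg θ lamAlg lamPic)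
    (hD : D.Assumptions α L Cson Cmesh Cstab Crel qred)
    (hR : IsRun D α L θ lamAlg lamPic Cmark qalg R) {l k j : ℕ} (hk : k ≠ 0) (hj : j ≠ 0)
    (hq : (l, k, j) ∈ R.Q D lamAlg lamPic) (hAlg : R.AlgStop D lamAlg l k j)
    (hPic : ¬ R.PicStop D lamPic l k j) :
    ‖D.uStarOn (R.mesh l) - R.u l k j‖ ≤
      (1 + qPicard α L) / 2 * ‖D.uStarOn (R.mesh l) - R.u l k 0‖ ∧
    D.est (R.mesh l) (R.u l k j) ≤ 2 / lamPic * ‖D.uStarOn (R.mesh l) - R.u l k 0‖ := by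
  have h1 := algebraic_error_le hp hR hj hq hAlg
  have h2 : lamPic * D.est (R.mesh l) (R.u l k j) < ‖R.u l k j - R.u l k 0‖ := not_le.1 hPic
  have h3 := norm_sub_uLin_le hp hD hR hk (start_mem_Q hq)
  have h4 := norm_sub_le_norm_sub_add_norm_sub (D.uStarOn (R.mesh l)) (R.uLin D α L l k)
    (R.u l k j)
  have h5 := norm_sub_le_norm_sub_add_norm_sub (R.u l k j) (D.uStarOn (R.mesh l)) (R.u l k 0)
  rw [norm_sub_rev (R.u l k j) (D.uStarOn (R.mesh l))] at h5
  have h6 := hp.Calg_mul_le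
  have h7 := qPicard_lt_one hp.α_pos hp.α_le
  have h8 := qPicard_nonneg α L
  have hCA := hp.Calg_pos
  have hla := hp.lamAlg_pos
  have hlp := hp.lamPic_pos
  have he := norm_nonneg (D.uStarOn (R.mesh l) - R.u l k j)
  have hf := norm_nonneg (D.uStarOn (R.mesh l) - R.u l k 0)
  generalize qalg / (1 - qalg) = CA at *
  generalize D.est (R.mesh l) (R.u l k j) = η at *
  generalize ‖D.uStarOn (R.mesh l) - R.u l k j‖ = e at *
  generalize ‖D.uStarOn (R.mesh l) - R.u l k 0‖ = f at *
  have hd := norm_nonneg (R.u l k j - R.u l k 0)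
  generalize ‖R.u l k j - R.u l k 0‖ = d at *
  generalize qPicard α L = q at *
  have hη : η ≤ d / lamPic := by rw [le_div_iff₀ hlp]; linarith
  have h9 : ‖R.uLin D α L l k - R.u l k j‖ ≤ (1 - q) / 4 * (e + f) := by
    calc _ ≤ _ := h1
      _ ≤ CA * (lamAlg * (d / lamPic + d)) := by gcongr
      _ = CA * (lamAlg + lamAlg / lamPic) * d := by field_simp; ring
      _ ≤ (1 - q) / 4 * (e + f) := by gcongr
  have h10 : e ≤ (1 + q) / 2 * f := by
    have h11 : e * (1 - (1 - q) / 4) ≤ (q + (1 - q) / 4) * f := by linarith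
    have h12 : (q + (1 - q) / 4) * f ≤ (1 + q) / 2 * f * (1 - (1 - q) / 4) := by
      have : 0 ≤ (1 - q) ^ 2 * f := by positivity
      nlinarith
    exact le_of_mul_le_mul_right (h11.trans h12) (by linarith)
  refine ⟨h10, ?_⟩
  rw [div_mul_eq_mul_div, le_div_iff₀ hlp]
  have : (1 + q) / 2 * f ≤ 1 * f := by gcongr; linarith
  linarith

theorem Delta_linearization_step_le
    (hp : IsAdmissible α L Cstab Crel qred qalg θ lamAlg lamPic)
    (hD : D.Assumptions α L Cson Cmesh Cstab Crel qred)
    (hR : IsRun D α L θ lamAlg lamPic Cmark qalg R) {l k j : ℕ}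
    (hq : (l, k, j) ∈ R.Q D lamAlg lamPic)
    (hn : R.next D lamAlg lamPic (l, k, j) = some (l, k + 1, 0)) :
    ‖R.uLin D α L l (k + 1) - R.u l (k + 1) 0‖ ≤ 2 * ‖D.uStarOn (R.mesh l) - R.u l k j‖ ∧
    R.Delta D α L (l, k + 1, 0) ≤ (1 + 2 * (1 + L / α)) * R.Delta D α L (l, k, j) := by
  have hq' := next_mem_Q hq hn
  have h1 := hR.next_linearization l k j hq hn
  have h2 := norm_sub_uLin_le hp hD hR (Nat.succ_ne_zero k) hq'
  have h3 := norm_sub_le_norm_sub_add_norm_sub (R.uLin D α L l (k + 1)) (D.uStarOn (R.mesh l))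
    (R.u l (k + 1) 0)
  rw [norm_sub_rev (R.uLin D α L l (k + 1)) (D.uStarOn (R.mesh l))] at h3
  rw [h1] at h2 h3
  have h4 := mul_le_mul_of_nonneg_right (qPicard_lt_one hp.α_pos hp.α_le).le
    (norm_nonneg (D.uStarOn (R.mesh l) - R.u l k j))
  have h5 : ‖R.uLin D α L l (k + 1) - R.u l k j‖ ≤ 2 * ‖D.uStarOn (R.mesh l) - R.u l k j‖ := by
    linarith
  have h6 := galerkin_error_le hp hD hR hq
  have h7 := norm_nonneg (R.uLin D α L l k - R.u l k j)
  rw [h1]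
  refine ⟨h5, ?_⟩
  have h8 : R.Delta D α L (l, k + 1, 0) ≤
      R.Delta D α L (l, k, j) + 2 * ‖D.uStarOn (R.mesh l) - R.u l k j‖ := by
    simp only [Delta, h1]
    linarith
  linarith

theorem est_le_of_final (hp : IsAdmissible α L Cstab Crel qred qalg θ lamAlg lamPic)
    (hD : D.Assumptions α L Cson Cmesh Cstab Crel qred)
    (hR : IsRun D α L θ lamAlg lamPic Cmark qalg R) {l k j : ℕ} (hk : k ≠ 0) (hj : j ≠ 0)
    (hq : (l, k, j) ∈ R.Q D lamAlg lamPic) (hAlg : R.AlgStop D lamAlg l k j)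
    (hPic : R.PicStop D lamPic l k j) :
    (1 - lamPic / lamPicThreshold Cstab (qPicard α L) qalg) * D.est (R.mesh l) (R.u l k j) ≤
      D.est (R.mesh l) (D.uStarOn (R.mesh l)) ∧
    D.est (R.mesh l) (D.uStarOn (R.mesh l)) ≤
      (1 + lamPic / lamPicThreshold Cstab (qPicard α L) qalg) *
        D.est (R.mesh l) (R.u l k j) := by
  have h1 := abs_le.1
    (final_estOn_sub_le hp hD hR hk hj hq hAlg hPic (subset_rfl (a := R.mesh l)))
  have h2 := mul_le_mul_of_nonneg_right hp.Cstab_mul_stopFactor_le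
    (est_nonneg (D := D) (R.mesh l) (R.u l k j))
  simp only [est] at *
  constructor <;> linarith [h1.1, h1.2]

/-- The Dörfler criterion for the final iterate implies one for the Galerkin solution. -/
theorem doerfler_uStarOn (hp : IsAdmissible α L Cstab Crel qred qalg θ lamAlg lamPic)
    (hD : D.Assumptions α L Cson Cmesh Cstab Crel qred)
    (hR : IsRun D α L θ lamAlg lamPic Cmark qalg R) {l : ℕ}
    (hq : (l + 1, 0, 0) ∈ R.Q D lamAlg lamPic) {ρ : ℝ}
    (hρ : ρ = lamPic / lamPicThreshold Cstab (qPicard α L) qalg) :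
    (θ - ρ) / (1 + ρ) * D.est (R.mesh l) (D.uStarOn (R.mesh l)) ≤
      D.estOn (R.mesh l) (R.marked l) (D.uStarOn (R.mesh l)) := by
  obtain ⟨k, j, h1, h2⟩ := prev_mesh hq
  obtain ⟨hM, hθ, -⟩ := hR.next_mesh l k j h1 h2
  rcases next_eq_some h2 with ⟨-, h⟩ | ⟨-, -, h⟩ | ⟨-, -, -, -, h⟩ | ⟨hk, hj, hs, hs', -⟩ <;>
    try (simp only [Prod.mk.injEq] at h; omega)
  have h3 := (abs_le.1 (final_estOn_sub_le hp hD hR hk hj h1 hs hs' hM)).1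
  have h4 := (est_le_of_final hp hD hR hk hj h1 hs hs').2
  have h5 := mul_le_mul_of_nonneg_right hp.Cstab_mul_stopFactor_le
    (est_nonneg (D := D) (R.mesh l) (R.u l k j))
  have h6 := hp.ratio_lt
  have h7 := hp.ratio_pos
  rw [← hρ] at h4 h5 h6 h7
  have h8 : 0 < θ - ρ := by linarith
  calc _ ≤ (θ - ρ) / (1 + ρ) * ((1 + ρ) * D.est (R.mesh l) (R.u l k j)) := by gcongr
    _ = (θ - ρ) * D.est (R.mesh l) (R.u l k j) := by field_simp
    _ ≤ _ := by linarith

/-- Summability of the estimators of the Galerkin solutions over the levels. -/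
theorem exists_sum_est_uStarOn_le (α L Cstab Crel qred qalg θ lamAlg lamPic : ℝ) :
    ∃ K : ℝ, IsAdmissible α L Cstab Crel qred qalg θ lamAlg lamPic →
      ∀ {𝕜 V E : Type*} [RCLike 𝕜] [NormedAddCommGroup V] [InnerProductSpace 𝕜 V]
      [CompleteSpace V] [DecidableEq E] {D : Discretization 𝕜 V E} {R : Iterates V E}
      {Cson Cmesh Cmark : ℝ}, D.Assumptions α L Cson Cmesh Cstab Crel qred →
      IsRun D α L θ lamAlg lamPic Cmark qalg R → ∀ {n m : ℕ}, n ≤ m →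
      (m, 0, 0) ∈ R.Q D lamAlg lamPic →
      ∑ i ∈ Finset.Ico n m, D.est (R.mesh i) (D.uStarOn (R.mesh i)) ≤
        K * D.est (R.mesh n) (D.uStarOn (R.mesh n)) := by
  set ρ := lamPic / lamPicThreshold Cstab (qPicard α L) qalg with hρ
  set q := √(1 - (1 - qred ^ 2) * ((θ - ρ) / (1 + ρ)) ^ 2) with hq
  set K := (1 - q)⁻¹ * (1 + Cstab ^ 2 * (1 - q)⁻¹ * (L / α * Crel ^ 2)) with hK
  refine ⟨√K * (1 - √(1 - K⁻¹))⁻¹, ?_⟩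
  intro hp 𝕜 V E _ _ _ _ _ D R Cson Cmesh Cmark hD hR n m hnm hm
  have hρ0 : 0 < ρ := hp.ratio_pos
  have hϑ : 0 < (θ - ρ) / (1 + ρ) := div_pos (by linarith [hp.ratio_lt]) (by linarith)
  have hqlt : q < 1 := by
    rw [hq, Real.sqrt_lt' one_pos]
    have : 0 < (1 - qred ^ 2) * ((θ - ρ) / (1 + ρ)) ^ 2 :=
      mul_pos (by nlinarith [hp.qred_pos, hp.qred_lt]) (by positivity)
    linarith
  have hq0 : 0 ≤ q := Real.sqrt_nonneg _
  have hK1 : 1 ≤ K := by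
    have h1 : 1 ≤ (1 - q)⁻¹ := one_le_inv_iff₀.2 ⟨by linarith, by linarith⟩
    have h2 : 0 ≤ Cstab ^ 2 * (1 - q)⁻¹ * (L / α * Crel ^ 2) := by
      have := (div_pos (hp.α_pos.trans_le hp.α_le) hp.α_pos).le
      positivity
    rw [hK]
    exact one_le_mul_of_one_le_of_one_le h1 (by linarith)
  have hmesh : ∀ i ≤ m, (i, 0, 0) ∈ R.Q D lamAlg lamPic := fun i hi => level_mem_Q_of_le hm hi
  have h1 := sum_le_of_sum_sq_le (g := fun i => D.est (R.mesh i) (D.uStarOn (R.mesh i))) (N := m)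
    hK1 (fun _ => est_nonneg _ _) (fun a b hab hb => hD.sum_sq_est_uStarOn_le hp.α_pos hp.α_le
      hp.qred_pos hp.qred_lt hϑ (M := R.marked) hab
      (fun i _ hi => hR.mem_meshes (hmesh i (by omega)))
      (fun i _ hi => hR.refines (hmesh (i + 1) (by omega)))
      (fun i _ hi => marked_subset hR hD (hmesh (i + 1) (by omega)))
      (fun i _ hi => doerfler_uStarOn hp hD hR (hmesh (i + 1) (by omega)) hρ) hq) hnm
  rw [Finset.sum_Ico_succ_top hnm] at h1
  have := est_nonneg (D := D) (R.mesh m) (D.uStarOn (R.mesh m))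
  linarith

end IsRun

/-! ### Full linear convergence -/

namespace IsRun

open Iterates Discretization

/-- Every step of the algorithm is a step of a contracting triple loop. -/
theorem exists_loopStep (α L Cstab Crel qred qalg θ lamAlg lamPic : ℝ) :
    ∃ C q : ℝ, 1 ≤ C ∧ q < 1 ∧ (IsAdmissible α L Cstab Crel qred qalg θ lamAlg lamPic →
      ∀ {𝕜 V E : Type*} [RCLike 𝕜] [NormedAddCommGroup V] [InnerProductSpace 𝕜 V]
      [CompleteSpace V] [DecidableEq E] {D : Discretization 𝕜 V E} {R : Iterates V E}
      {Cson Cmesh Cmark : ℝ}, D.Assumptions α L Cson Cmesh Cstab Crel qred →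
      IsRun D α L θ lamAlg lamPic Cmark qalg R →
      (∀ n m : ℕ, n ≤ m → (m, 0, 0) ∈ R.Q D lamAlg lamPic →
        ∑ i ∈ Finset.Ico n m, D.est (R.mesh i) (D.uStarOn (R.mesh i)) ≤
          C * D.est (R.mesh n) (D.uStarOn (R.mesh n))) ∧
      ∀ p ∈ R.Q D lamAlg lamPic,
        D.est (R.mesh p.1) (D.uStarOn (R.mesh p.1)) ≤ C * R.Delta D α L p ∧
        ∀ t, R.next D lamAlg lamPic p = some t →
        LoopStep C q (R.Delta D α L) (fun p => ‖R.uLin D α L p.1 p.2.1 - R.u p.1 p.2.1 p.2.2‖)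
          (fun l k => ‖D.uStarOn (R.mesh l) - R.u l k 0‖)
          (fun l => D.est (R.mesh l) (D.uStarOn (R.mesh l))) p t) := by
  by_cases hp : IsAdmissible α L Cstab Crel qred qalg θ lamAlg lamPic
  swap
  · exact ⟨1, 0, le_rfl, one_pos, fun h => absurd h hp⟩
  obtain ⟨K, hK⟩ := exists_sum_est_uStarOn_le α L Cstab Crel qred qalg θ lamAlg lamPic
  set CP := qPicard α L / (1 - qPicard α L) with hCP
  set CA := qalg / (1 - qalg) with hCA
  set ρ := lamPic / lamPicThreshold Cstab (qPicard α L) qalg with hρ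
  set c1 := 1 + Cstab * (1 + L / α) with hc1
  set c2 := 3 + 2 * Cstab with hc2
  set c3 := (1 + Crel * Cstab) * (1 + CP * (1 + 2 / lamAlg)) + 1 + (1 + Crel) * (2 / lamAlg)
    with hc3
  set c4 := 1 + 2 * (1 + L / α) with hc4
  set c5 := (1 + Crel * Cstab) + 2 + (1 + Crel) * (2 / lamPic) with hc5
  set c6 := 1 + L / α with hc6
  set c7 := ((1 + Crel * Cstab) * stopFactor CP CA lamAlg lamPic +
    CA * (lamAlg * (1 + lamPic)) + (1 + Crel)) * (1 - ρ)⁻¹ with hc7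
  obtain ⟨C, hC⟩ := Finset.exists_le ({1, K, c1, c2, c2 * c3, c4, c5, c6, c7} : Finset ℝ)
  simp only [Finset.mem_insert, Finset.mem_singleton, forall_eq_or_imp, forall_eq] at hC
  obtain ⟨hC0, hCK, hC1, hC2, hC3, hC4, hC5, hC6, hC7⟩ := hC
  have hqP := qPicard_lt_one hp.α_pos hp.α_le
  have hLα := div_pos (hp.α_pos.trans_le hp.α_le) hp.α_pos
  have hCs := hp.Cstab_pos
  have hCr := hp.Crel_pos
  refine ⟨C, max qalg ((1 + qPicard α L) / 2), hC0, max_lt hp.qalg_lt (by linarith), ?_⟩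
  intro _ 𝕜 V E _ _ _ _ _ D R Cson Cmesh Cmark hD hR
  have hΔ := fun t => Delta_nonneg (D := D) (R := R) (α := α) (L := L) t
  refine ⟨fun n m hnm hm => (hK hp hD hR hnm hm).trans
    (mul_le_mul_of_nonneg_right hCK (est_nonneg _ _)), ?_⟩
  rintro ⟨l, k, j⟩ hq
  refine ⟨(est_uStarOn_le_Delta hp hD hR hq).trans (mul_le_mul_of_nonneg_right hC1 (hΔ _)), ?_⟩
  intro t hn
  have hq' := next_mem_Q hq hn
  rcases next_eq_some hn with ⟨rfl, rfl⟩ | ⟨hk, hj, rfl⟩ | ⟨hk, hj, hs, hs', rfl⟩ |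
    ⟨hk, hj, hs, hs', -, rfl⟩
  · refine Or.inr (Or.inl ⟨rfl, ?_, ?_, fun h => absurd h (by omega)⟩)
    · exact (Delta_linearization_step_le hp hD hR hq hn).2.trans
        (mul_le_mul_of_nonneg_right hC4 (hΔ _))
    · exact (galerkin_error_le hp hD hR hq').trans (mul_le_mul_of_nonneg_right hC6 (hΔ _))
  · refine Or.inl ⟨rfl, ?_, ?_, ?_⟩
    · exact (Delta_solver_step_le hp hD hR hq').trans (mul_le_mul_of_nonneg_right hC2 (hΔ _))
    · exact (solver_contraction hR hq').trans
        (mul_le_mul_of_nonneg_right (le_max_left _ _) (norm_nonneg _))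
    · intro h1
      obtain ⟨j, rfl⟩ := Nat.exists_eq_add_of_le' h1
      have h2 := Delta_le_of_not_algStop hp hD hR hk hq (hj (by omega))
      rw [← hCP, ← hc3] at h2
      calc _ ≤ c2 * R.Delta D α L (l, k, j + 1) := Delta_solver_step_le hp hD hR hq'
        _ ≤ c2 * (c3 * ‖R.uLin D α L l k - R.u l k j‖) := by
          have : 0 ≤ c2 := by positivity
          gcongr
        _ ≤ _ := by
          rw [← mul_assoc]
          exact mul_le_mul_of_nonneg_right hC3 (norm_nonneg _)
  · refine Or.inr (Or.inl ⟨rfl, ?_, ?_, fun _ => ?_⟩)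
    · exact (Delta_linearization_step_le hp hD hR hq hn).2.trans
        (mul_le_mul_of_nonneg_right hC4 (hΔ _))
    · exact (galerkin_error_le hp hD hR hq').trans (mul_le_mul_of_nonneg_right hC6 (hΔ _))
    · obtain ⟨h1, h2⟩ := picard_contraction hp hD hR hk hj hq hs hs'
      have h3 := (Delta_linearization_step_le hp hD hR hq hn).1
      have h4 := Delta_le hp hD hR hq'
      have h5 := hR.next_linearization l k j hq hn
      rw [h5] at h3 h4
      have h6 : ‖D.uStarOn (R.mesh l) - R.u l k j‖ ≤ ‖D.uStarOn (R.mesh l) - R.u l k 0‖ :=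
        h1.trans (mul_le_of_le_one_left (norm_nonneg _) (by linarith))
      constructor
      · refine le_trans ?_ (mul_le_mul_of_nonneg_right hC5 (norm_nonneg _))
        calc _ ≤ _ := h4
          _ ≤ (1 + Crel * Cstab) * ‖D.uStarOn (R.mesh l) - R.u l k 0‖ +
              2 * ‖D.uStarOn (R.mesh l) - R.u l k 0‖ +
              (1 + Crel) * (2 / lamPic * ‖D.uStarOn (R.mesh l) - R.u l k 0‖) := by
            gcongr
            linarith
          _ = _ := by rw [hc5]; ring
      · beta_reduce
        rw [h5]
        exact h1.trans (mul_le_mul_of_nonneg_right (le_max_right _ _) (norm_nonneg _))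
  · refine Or.inr (Or.inr ⟨rfl, ?_⟩)
    have h1 := Delta_mesh_step_le hp hD hR hq hn
    have h2 := Delta_le_of_final hp hD hR hk hj hq hs hs'
    have h3 := (est_le_of_final hp hD hR hk hj hq hs hs').1
    rw [← hρ, ← le_inv_mul_iff₀ (by linarith [hp.ratio_lt, hp.θ_lt])] at h3
    have hsf := hp.stopFactor_pos
    have hCA0 := hp.Calg_pos
    have hla := hp.lamAlg_pos
    have hlp := hp.lamPic_pos
    refine le_trans ?_ (mul_le_mul_of_nonneg_right hC7 (est_nonneg _ _))
    calc _ ≤ _ := h1.trans h2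
      _ ≤ ((1 + Crel * Cstab) * stopFactor CP CA lamAlg lamPic +
          CA * (lamAlg * (1 + lamPic)) + (1 + Crel)) *
          ((1 - ρ)⁻¹ * D.est (R.mesh l) (D.uStarOn (R.mesh l))) := by gcongr
      _ = _ := by rw [hc7]; ring

/-- Full linear convergence of the quasi-error, with respect to the steps of the algorithm. -/
theorem exists_linear_convergence (α L Cstab Crel qred qalg θ lamAlg lamPic : ℝ) :
    ∃ Clin qlin : ℝ, 1 ≤ Clin ∧ 0 < qlin ∧ qlin < 1 ∧
      (IsAdmissible α L Cstab Crel qred qalg θ lamAlg lamPic →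
      ∀ {𝕜 V E : Type*} [RCLike 𝕜] [NormedAddCommGroup V] [InnerProductSpace 𝕜 V]
      [CompleteSpace V] [DecidableEq E] {D : Discretization 𝕜 V E} {R : Iterates V E}
      {Cson Cmesh Cmark : ℝ}, D.Assumptions α L Cson Cmesh Cstab Crel qred →
      IsRun D α L θ lamAlg lamPic Cmark qalg R →
      ∀ {N : ℕ} {q : ℕ × ℕ × ℕ}, R.step D lamAlg lamPic N = some q → ∀ n ≤ N,
        R.Delta D α L q ≤
          Clin * qlin ^ (N - n) * R.Delta D α L (R.path D lamAlg lamPic n)) := by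
  obtain ⟨C, q, hC, hq1, hmain⟩ := exists_loopStep α L Cstab Crel qred qalg θ lamAlg lamPic
  have hq : 0 < (1 - q)⁻¹ := inv_pos.2 (by linarith)
  set K := (1 + C + C * (1 - q)⁻¹) *
      (1 + (1 + C * C * (1 - q)⁻¹) * C * (1 + C + C * (1 - q)⁻¹)) * (1 + C ^ 3) with hK
  have hK1 : 1 < K := by
    have h1 : 1 < 1 + C + C * (1 - q)⁻¹ := by
      have : 0 < C * (1 - q)⁻¹ := by positivity
      linarith
    have h2 : 1 ≤ 1 + (1 + C * C * (1 - q)⁻¹) * C * (1 + C + C * (1 - q)⁻¹) := by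
      have : 0 < (1 + C * C * (1 - q)⁻¹) * C * (1 + C + C * (1 - q)⁻¹) := by positivity
      linarith
    have h3 : 1 ≤ 1 + C ^ 3 := by
      have : 0 < C ^ 3 := by positivity
      linarith
    exact one_lt_mul_of_lt_of_le (one_lt_mul_of_lt_of_le h1 h2) h3
  refine ⟨K, 1 - K⁻¹, hK1.le, ?_, ?_, ?_⟩
  · have := inv_lt_one_of_one_lt₀ hK1
    linarith
  · have : 0 < K⁻¹ := by positivity
    linarith
  · intro hp 𝕜 V E _ _ _ _ _ D R Cson Cmesh Cmark hD hR N t ht n hn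
    obtain ⟨hg, hstep⟩ := hmain hp hD hR
    have hmem : ∀ m ≤ N, R.path D lamAlg lamPic m ∈ R.Q D lamAlg lamPic :=
      fun m hm => path_mem ht hm
    have h1 := le_geometric_of_sum_le (a := fun n => R.Delta D α L (R.path D lamAlg lamPic n))
      (N := N) hK1.le (fun n hn => sum_le_of_triple_loop (N := N) hC hq1 Delta_nonneg
        (fun _ => norm_nonneg _) (fun _ _ => norm_nonneg _) ?_
        (fun m hm => (hstep _ (hmem m hm)).1)
        (fun m hm => (hstep _ (hmem m hm.le)).2 _ (next_path ht hm)) ?_ hn) hn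
    · rwa [path_eq ht] at h1
    · intro m _
      have h2 := norm_nonneg (D.uStar - R.u (R.path D lamAlg lamPic m).1
        (R.path D lamAlg lamPic m).2.1 (R.path D lamAlg lamPic m).2.2)
      have h3 := est_nonneg (D := D) (R.mesh (R.path D lamAlg lamPic m).1)
        (R.u (R.path D lamAlg lamPic m).1 (R.path D lamAlg lamPic m).2.1
          (R.path D lamAlg lamPic m).2.2)
      simp only [Delta]
      linarith
    · intro a b hab hb
      refine hg _ _ (level_le_of_step hab (step_eq_some_path ht (hab.trans hb))
        (step_eq_some_path ht hb)) ?_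
      exact level_mem_Q (hmem b hb)

end IsRun

/-! ### Summation of inverse powers and the number of marked elements -/

/-- If `x` decays linearly and `y i ^ s * x (n i) ≤ B`, then the sum of the `y i` obeys the same
bound up to a constant: `∑ y i ≤ B ^ (1 / s) * ∑ x (n i) ^ (-1 / s)`, where the last sum is dominated
by a geometric series times `x N ^ (-1 / s)`. -/
theorem sum_rpow_mul_le_of_linear_convergence {ι : Type*} {x : ℕ → ℝ} {y : ι → ℝ} {C q s B : ℝ}
    {N : ℕ} (hC : 0 < C) (hq0 : 0 < q) (hq1 : q < 1) (hs : 0 < s) (hB : 0 ≤ B) (hxN : 0 ≤ x N)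
    (hx : ∀ n ≤ N, x N ≤ C * q ^ (N - n) * x n) {S : Finset ι} {n : ι → ℕ}
    (hn : ∀ i ∈ S, n i ≤ N) (hinj : Set.InjOn n S) (hy : ∀ i ∈ S, 0 ≤ y i)
    (hyx : ∀ i ∈ S, y i ^ s * x (n i) ≤ B) :
    (∑ i ∈ S, y i) ^ s * x N ≤ C * (1 - q ^ (1 / s)) ^ (-s) * B := by
  set r := q ^ (1 / s) with hr
  have hs' : 0 < 1 / s := by positivity
  have hr0 : 0 < r := Real.rpow_pos_of_pos hq0 _
  have hr1 : r < 1 := Real.rpow_lt_one hq0.le hq1 hs'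
  have hr2 : 0 < 1 - r := by linarith
  rcases hxN.eq_or_lt with h0 | h0
  · rw [← h0, mul_zero]
    positivity
  set c := (B * C / x N) ^ (1 / s) with hc
  have hc0 : 0 ≤ c := by positivity
  have hyi : ∀ i ∈ S, y i ≤ c * r ^ (N - n i) := by
    intro i hi
    have h1 := hx (n i) (hn i hi)
    have hxi : 0 < x (n i) := by
      by_contra! hle
      have : C * q ^ (N - n i) * x (n i) ≤ 0 := mul_nonpos_of_nonneg_of_nonpos (by positivity) hle
      linarith
    have h2 : y i ^ s ≤ B * C / x N * q ^ (N - n i) := by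
      have h3 : y i ^ s ≤ B / x (n i) := by rw [le_div_iff₀ hxi]; exact hyx i hi
      refine h3.trans ?_
      rw [div_le_iff₀ hxi, div_mul_eq_mul_div, div_mul_eq_mul_div, le_div_iff₀ h0]
      calc B * x N ≤ B * (C * q ^ (N - n i) * x (n i)) := by gcongr
        _ = _ := by ring
    have h4 : c * r ^ (N - n i) = (B * C / x N * q ^ (N - n i)) ^ (1 / s) := by
      rw [hc, hr, Real.mul_rpow (by positivity) (by positivity), ← Real.rpow_natCast,
        ← Real.rpow_natCast, ← Real.rpow_mul hq0.le, ← Real.rpow_mul hq0.le, mul_comm (1 / s)]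
    rw [h4]
    have h5 := Real.rpow_le_rpow (Real.rpow_nonneg (hy i hi) s) h2 hs'.le
    rwa [← Real.rpow_mul (hy i hi), mul_one_div_cancel hs.ne', Real.rpow_one] at h5
  have hgeom : ∑ i ∈ S, r ^ (N - n i) ≤ (1 - r)⁻¹ := by
    have hinj' : Set.InjOn (fun i => N - n i) S := by
      intro i hi i' hi' heq
      have h1 := hn i hi
      have h2 := hn i' hi'
      exact hinj hi hi' (by simp only at heq; omega)
    rw [← Finset.sum_image (f := fun m => r ^ m) (g := fun i => N - n i) hinj']
    refine le_trans (Finset.sum_le_sum_of_subset_of_nonneg (t := Finset.range (N + 1)) ?_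
      (fun _ _ _ => by positivity)) (geom_sum_le_inv hr0.le hr1 _)
    intro m hm
    obtain ⟨i, -, rfl⟩ := Finset.mem_image.1 hm
    exact Finset.mem_range.2 (by omega)
  have hsum : ∑ i ∈ S, y i ≤ c * (1 - r)⁻¹ := by
    refine (Finset.sum_le_sum hyi).trans ?_
    rw [← Finset.mul_sum]
    gcongr
  have hsum' := Real.rpow_le_rpow (Finset.sum_nonneg hy) hsum hs.le
  calc (∑ i ∈ S, y i) ^ s * x N ≤ (c * (1 - r)⁻¹) ^ s * x N := by gcongr
    _ = _ := by
      rw [Real.mul_rpow hc0 (by positivity), hc, ← Real.rpow_mul (by positivity),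
        one_div_mul_cancel hs.ne', Real.rpow_one, Real.inv_rpow hr2.le, Real.rpow_neg hr2.le]
      field_simp

/-- The constant in the bound of the quasi-error by the estimator at final iterates. -/
noncomputable def finalFactor (Cstab Crel qalg lamAlg qPic lamPic : ℝ) : ℝ :=
  (1 + Crel * Cstab) * stopFactor (qPic / (1 - qPic)) (qalg / (1 - qalg)) lamAlg lamPic +
    qalg / (1 - qalg) * (lamAlg * (1 + lamPic)) + (1 + Crel)

/-- The constant in the bound of the number of marked elements; `δ` stands for
`1 - lamPic / lamPicThreshold Cstab qPic qalg`. -/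
noncomputable def markFactor (Cstab Crel δ qalg lamAlg qPic lamPic : ℝ) : ℝ :=
  finalFactor Cstab Crel qalg lamAlg qPic lamPic /
    (δ * ((1 - (1 + Cstab ^ 2 * Crel ^ 2)⁻¹) / 2 / (1 + Cstab * Crel)))

/-- The constant `Copt` of the upper bound of the convergence rate. -/
noncomputable def optUpper (Cstab Crel Cmark δ qalg lamAlg qPic lamPic Cmesh Clin qlin s : ℝ) : ℝ :=
  max Clin ((2 * Cmesh * Cmark) ^ s *
    (Clin * (1 - qlin ^ (1 / s)) ^ (-s) * markFactor Cstab Crel δ qalg lamAlg qPic lamPic))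

namespace IsAdmissible

variable {α L Cstab Crel qred qalg θ lamAlg lamPic : ℝ}

theorem finalFactor_pos (hp : IsAdmissible α L Cstab Crel qred qalg θ lamAlg lamPic) :
    0 < finalFactor Cstab Crel qalg lamAlg (qPicard α L) lamPic := by
  have h1 := hp.stopFactor_pos
  have h2 := hp.Calg_pos
  have h3 := hp.lamAlg_pos
  have h4 := hp.lamPic_pos
  have h5 := hp.Cstab_pos
  have h6 := hp.Crel_pos
  unfold finalFactor
  positivity

theorem doerflerGap_pos (hp : IsAdmissible α L Cstab Crel qred qalg θ lamAlg lamPic) :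
    0 < (1 - (1 + Cstab ^ 2 * Crel ^ 2)⁻¹) / 2 / (1 + Cstab * Crel) := by
  have h5 := hp.Cstab_pos
  have h6 := hp.Crel_pos
  have h7 : (1 + Cstab ^ 2 * Crel ^ 2)⁻¹ < 1 :=
    inv_lt_one_of_one_lt₀ (by have : 0 < Cstab ^ 2 * Crel ^ 2 := by positivity
                              linarith)
  have h8 : 0 < 1 - (1 + Cstab ^ 2 * Crel ^ 2)⁻¹ := by linarith
  positivity

theorem delta_pos (hp : IsAdmissible α L Cstab Crel qred qalg θ lamAlg lamPic) :
    0 < 1 - lamPic / lamPicThreshold Cstab (qPicard α L) qalg := by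
  linarith [hp.ratio_lt, hp.θ_lt]

theorem markFactor_pos (hp : IsAdmissible α L Cstab Crel qred qalg θ lamAlg lamPic) :
    0 < markFactor Cstab Crel (1 - lamPic / lamPicThreshold Cstab (qPicard α L) qalg)
      qalg lamAlg (qPicard α L) lamPic :=
  div_pos hp.finalFactor_pos (mul_pos hp.delta_pos hp.doerflerGap_pos)

end IsAdmissible

namespace IsRun

open Iterates Discretization

variable {𝕜 V E : Type*} [RCLike 𝕜] [NormedAddCommGroup V] [InnerProductSpace 𝕜 V]
  {D : Discretization 𝕜 V E} {R : Iterates V E}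
  {α L Cson Cmesh Cstab Crel qred θ lamAlg lamPic Cmark qalg : ℝ}

/-! ### Cardinalities of meshes and of sets of marked elements -/

theorem marked_nonempty (hR : IsRun D α L θ lamAlg lamPic Cmark qalg R) (hθ : 0 < θ) {l : ℕ}
    (hq : (l + 1, 0, 0) ∈ R.Q D lamAlg lamPic) : (R.marked l).Nonempty := by
  obtain ⟨k, j, h1, h2⟩ := prev_mesh hq
  obtain ⟨-, h3, -⟩ := hR.next_mesh l k j h1 h2
  rcases next_eq_some h2 with ⟨-, h⟩ | ⟨-, -, h⟩ | ⟨-, -, -, -, h⟩ | ⟨-, -, -, -, hne, -⟩ <;>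
    try (simp only [Prod.mk.injEq] at h; omega)
  by_contra hempty
  rw [Finset.not_nonempty_iff_eq_empty.1 hempty, estOn_empty] at h3
  have := mul_pos hθ (lt_of_le_of_ne (est_nonneg (D := D) (R.mesh l) (R.u l k j)) hne.symm)
  linarith

variable [DecidableEq E]

theorem card_mesh_lt (hD : D.Assumptions α L Cson Cmesh Cstab Crel qred)
    (hR : IsRun D α L θ lamAlg lamPic Cmark qalg R) (hθ : 0 < θ) {l : ℕ}
    (hq : (l + 1, 0, 0) ∈ R.Q D lamAlg lamPic) :
    (R.mesh l).card < (R.mesh (l + 1)).card := by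
  have h1 := hD.card_sdiff_add_card_le
    (hR.mem_meshes (level_mem_Q_of_le hq (Nat.le_succ l))) (hR.refines hq)
  have h2 := Finset.card_le_card (marked_subset hR hD hq)
  have h3 := (marked_nonempty hR hθ hq).card_pos
  omega

theorem card_add_le_card_mesh (hD : D.Assumptions α L Cson Cmesh Cstab Crel qred)
    (hR : IsRun D α L θ lamAlg lamPic Cmark qalg R) (hθ : 0 < θ) {l : ℕ}
    (hq : (l, 0, 0) ∈ R.Q D lamAlg lamPic) : D.T0.card + l ≤ (R.mesh l).card := by
  induction l with
  | zero => rw [hR.mesh_zero]; simp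
  | succ l ih =>
    have h1 := ih (level_mem_Q_of_le hq (Nat.le_succ l))
    have h2 := card_mesh_lt hD hR hθ hq
    omega

theorem card_mesh_succ_le (hD : D.Assumptions α L Cson Cmesh Cstab Crel qred)
    (hR : IsRun D α L θ lamAlg lamPic Cmark qalg R) (hCson : 2 ≤ Cson) {l : ℕ}
    (hq : (l + 1, 0, 0) ∈ R.Q D lamAlg lamPic) :
    ((R.mesh (l + 1)).card : ℝ) ≤ Cson * (R.mesh l).card := by
  obtain ⟨k, j, h1, h2⟩ := prev_mesh hq
  obtain ⟨hM, -, -, hm, -⟩ := hR.next_mesh l k j h1 h2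
  have h3 := (hD.splitting _ (hR.mem_meshes (level_mem_Q h1)) _ hM).2
  rw [← hm] at h3
  have h4 : ((R.mesh l).card : ℝ) =
      (R.mesh l \ R.mesh (l + 1)).card + (R.mesh l ∩ R.mesh (l + 1)).card := by
    exact_mod_cast (Finset.card_sdiff_add_card_inter _ _).symm
  rw [h4]
  have h5 : (0 : ℝ) ≤ (R.mesh l ∩ R.mesh (l + 1)).card := Nat.cast_nonneg _
  nlinarith

theorem card_mesh_le_sum (hD : D.Assumptions α L Cson Cmesh Cstab Crel qred)
    (hR : IsRun D α L θ lamAlg lamPic Cmark qalg R) {l : ℕ}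
    (hq : (l, 0, 0) ∈ R.Q D lamAlg lamPic) :
    ((R.mesh l).card : ℝ) - D.T0.card ≤
      Cmesh * ∑ i ∈ Finset.range l, ((R.marked i).card : ℝ) := by
  -- the closure estimate is for infinite sequences of meshes: mark nothing from level `l` on
  let M : ℕ → Finset E := fun i => if i < l then R.marked i else ∅
  let T : ℕ → Finset E := fun i => Nat.rec D.T0 (fun i T => D.refine T (M i)) i
  have hT : ∀ i ≤ l, T i = R.mesh i := by
    intro i
    induction i with
    | zero => intro _; exact hR.mesh_zero.symm
    | succ i ih =>
      intro hi
      obtain ⟨k, j, h1, h2⟩ := prev_mesh (level_mem_Q_of_le hq hi)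
      rw [(hR.next_mesh i k j h1 h2).2.2.2.1, ← ih (by omega)]
      change D.refine (T i) (M i) = _
      simp only [M, if_pos (show i < l by omega)]
  have h1 := hD.closure T M rfl (fun i => ⟨?_, rfl⟩) l
  · rw [hT l le_rfl] at h1
    have h2 : ∑ i ∈ Finset.range l, ((M i).card : ℝ) =
        ∑ i ∈ Finset.range l, ((R.marked i).card : ℝ) :=
      Finset.sum_congr rfl fun i hi => by simp only [M, if_pos (Finset.mem_range.1 hi)]
    rwa [h2] at h1
  · by_cases hi : i < l
    · simp only [M, if_pos hi]
      rw [hT i hi.le]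
      exact (marked_subset hR hD (level_mem_Q_of_le hq hi)).trans Finset.sdiff_subset
    · simp only [M, if_neg hi]
      exact Finset.empty_subset _

variable [CompleteSpace V]

/-- The number of marked elements is bounded by means of the comparison lemma, since the Dörfler
criterion for the Galerkin solution with a larger parameter implies the one for the final iterate. -/
theorem card_marked_le (hp : IsAdmissible α L Cstab Crel qred qalg θ lamAlg lamPic)
    (hD : D.Assumptions α L Cson Cmesh Cstab Crel qred)
    (hR : IsRun D α L θ lamAlg lamPic Cmark qalg R) (hCmark : 1 ≤ Cmark) {s : ℝ} (hs : 0 < s)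
    (hA : D.approxNorm s ≠ ⊤) {l k j : ℕ} (hq : (l, k, j) ∈ R.Q D lamAlg lamPic)
    (hn : R.next D lamAlg lamPic (l, k, j) = some (l + 1, 0, 0)) :
    ((R.marked l).card : ℝ) ^ s * R.Delta D α L (l, k, j) ≤ Cmark ^ s *
      (markFactor Cstab Crel (1 - lamPic / lamPicThreshold Cstab (qPicard α L) qalg)
        qalg lamAlg (qPicard α L) lamPic * (D.approxNorm s).toReal) := by
  obtain ⟨-, -, hmin, -⟩ := hR.next_mesh l k j hq hn
  rcases next_eq_some hn with ⟨-, h⟩ | ⟨-, -, h⟩ | ⟨-, -, -, -, h⟩ | ⟨hk, hj, hst, hst', hne, -⟩ <;>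
    try (simp only [Prod.mk.injEq] at h; omega)
  have hm := hR.mem_meshes (level_mem_Q hq)
  set η := D.est (R.mesh l) (R.u l k j) with hη
  have hη0 : 0 < η := lt_of_le_of_ne (est_nonneg _ _) hne.symm
  obtain ⟨hg1, -⟩ := est_le_of_final hp hD hR hk hj hq hst hst'
  have hδ := hp.delta_pos
  have hgap := hp.doerflerGap_pos
  have hF := hp.finalFactor_pos
  have hθ' := hp.thetaPrime_pos_lt rfl
  have hfin : R.Delta D α L (l, k, j) ≤ finalFactor Cstab Crel qalg lamAlg (qPicard α L) lamPic * η :=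
    Delta_le_of_final hp hD hR hk hj hq hst hst'
  unfold markFactor
  unfold thetaPrime at hθ'
  set δ := 1 - lamPic / lamPicThreshold Cstab (qPicard α L) qalg with hδdef
  have hg0 : 0 < D.est (R.mesh l) (D.uStarOn (R.mesh l)) :=
    (mul_pos hδ hη0).trans_le hg1
  obtain ⟨S, hS, hdS, hcS⟩ := hD.exists_doerfler_card_le hp.α_pos hp.α_le hp.Cstab_pos hp.Crel_pos
    hp.qred_pos hp.qred_lt hs hA hm hg0 rfl
  generalize D.est (R.mesh l) (D.uStarOn (R.mesh l)) = g at *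
  generalize (1 - (1 + Cstab ^ 2 * Crel ^ 2)⁻¹) / 2 / (1 + Cstab * Crel) = κ at *
  generalize finalFactor Cstab Crel qalg lamAlg (qPicard α L) lamPic = c at *
  set a := (D.approxNorm s).toReal with ha
  have ha0 : 0 ≤ a := ENNReal.toReal_nonneg
  have hMS : ((R.marked l).card : ℝ) ≤ Cmark * S.card := by
    refine hmin S hS ?_
    have h1 := (abs_le.1 (final_estOn_sub_le hp hD hR hk hj hq hst hst' hS)).2
    have h2 := hθ'.2.le
    rw [div_le_iff₀ hδ] at h2
    have h3 := mul_le_mul_of_nonneg_right h2 hη0.le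
    have h4 : (1 + Cstab ^ 2 * Crel ^ 2)⁻¹ * δ * η ≤ (1 + Cstab ^ 2 * Crel ^ 2)⁻¹ * g := by
      rw [mul_assoc]
      gcongr
    rw [stopFactor] at h1
    linarith
  have hSs : (S.card : ℝ) ^ s * (κ * g) ≤ a := by
    have h1 := Real.rpow_le_rpow (Nat.cast_nonneg _) hcS hs.le
    rwa [← Real.rpow_mul (by positivity), one_div_mul_cancel hs.ne', Real.rpow_one,
      le_div_iff₀ (mul_pos hgap hg0)] at h1
  have hMS' : ((R.marked l).card : ℝ) ^ s ≤ Cmark ^ s * (S.card : ℝ) ^ s := by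
    rw [← Real.mul_rpow (by linarith) (Nat.cast_nonneg _)]
    exact Real.rpow_le_rpow (Nat.cast_nonneg _) hMS hs.le
  have hΔ : R.Delta D α L (l, k, j) ≤ c / δ * g := by
    refine hfin.trans ?_
    rw [div_mul_eq_mul_div, le_div_iff₀ hδ]
    calc c * η * δ = c * (δ * η) := by ring
      _ ≤ c * g := by gcongr
  calc _ ≤ (Cmark ^ s * (S.card : ℝ) ^ s) * (c / δ * g) := by
        gcongr
        exact Delta_nonneg _
    _ = Cmark ^ s * (c / (δ * κ) * ((S.card : ℝ) ^ s * (κ * g))) := by field_simp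
    _ ≤ _ := by
      have : 0 < Cmark := by linarith
      gcongr

end IsRun

/-! ### Convergence rates -/

namespace IsRun

open Iterates Discretization

variable {𝕜 V E : Type*} [RCLike 𝕜] [NormedAddCommGroup V] [InnerProductSpace 𝕜 V]
  {D : Discretization 𝕜 V E} {R : Iterates V E}
  {α L Cson Cmesh Cstab Crel qred θ lamAlg lamPic Cmark qalg Clin qlin s : ℝ}

theorem dof_rpow_mul_Delta_le_of_zero (hR : IsRun D α L θ lamAlg lamPic Cmark qalg R)
    (hC : 1 ≤ Clin) (hq0 : 0 < qlin) (hq1 : qlin < 1)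
    (hlin : ∀ {N : ℕ} {q : ℕ × ℕ × ℕ}, R.step D lamAlg lamPic N = some q → ∀ n ≤ N,
      R.Delta D α L q ≤ Clin * qlin ^ (N - n) * R.Delta D α L (R.path D lamAlg lamPic n))
    {q : ℕ × ℕ × ℕ} (hq : q ∈ R.Q D lamAlg lamPic) (hl : q.1 = 0) :
    (((R.mesh q.1).card : ℝ) - D.T0.card + 1) ^ s * R.Delta D α L q ≤
      Clin * R.Delta D α L (0, 0, 0) := by
  obtain ⟨N, hN⟩ := hq
  have h1 := hlin hN 0 (Nat.zero_le _)
  rw [path_eq (show R.step D lamAlg lamPic 0 = some (0, 0, 0) from rfl)] at h1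
  rw [hl, hR.mesh_zero, sub_self, zero_add, Real.one_rpow, one_mul]
  refine h1.trans (mul_le_mul_of_nonneg_right ?_ (Delta_nonneg _))
  exact mul_le_of_le_one_right (by linarith) (pow_le_one₀ hq0.le hq1.le)

variable [DecidableEq E]

/-- A bound of the quasi-error with respect to the number of degrees of freedom, on the levels from
`l₀` on, yields one with respect to the cumulative number of elements on these levels. -/
theorem sum_card_rpow_mul_Delta_le (hD : D.Assumptions α L Cson Cmesh Cstab Crel qred)
    (hR : IsRun D α L θ lamAlg lamPic Cmark qalg R) (hθ : 0 < θ)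
    (hs : 0 < s) (hC : 1 ≤ Clin) (hq0 : 0 < qlin) (hq1 : qlin < 1)
    (hlin : ∀ {N : ℕ} {q : ℕ × ℕ × ℕ}, R.step D lamAlg lamPic N = some q → ∀ n ≤ N,
      R.Delta D α L q ≤ Clin * qlin ^ (N - n) * R.Delta D α L (R.path D lamAlg lamPic n))
    {l₀ : ℕ} {B : ℝ} (hB0 : 0 ≤ B) (hB : ∀ q ∈ R.Q D lamAlg lamPic, l₀ ≤ q.1 →
      (((R.mesh q.1).card : ℝ) - D.T0.card + 1) ^ s * R.Delta D α L q ≤ B)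
    {N : ℕ} {q : ℕ × ℕ × ℕ} (hN : R.step D lamAlg lamPic N = some q) :
    (∑ m ∈ Finset.range (N + 1) with l₀ ≤ (R.path D lamAlg lamPic m).1,
      ((R.mesh (R.path D lamAlg lamPic m).1).card : ℝ)) ^ s * R.Delta D α L q ≤
      Clin * (1 - qlin ^ (1 / s)) ^ (-s) * ((D.T0.card : ℝ) ^ s * B) := by
  have h1 := sum_rpow_mul_le_of_linear_convergence (ι := ℕ)
    (x := fun n => R.Delta D α L (R.path D lamAlg lamPic n))
    (y := fun i => ((R.mesh (R.path D lamAlg lamPic i).1).card : ℝ)) (C := Clin) (q := qlin)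
    (s := s) (B := (D.T0.card : ℝ) ^ s * B) (N := N) (by linarith) hq0 hq1 hs
    (by positivity) (Delta_nonneg _) (fun n hn => by
      have := hlin hN n hn
      rwa [← path_eq hN] at this)
    (S := {m ∈ Finset.range (N + 1) | l₀ ≤ (R.path D lamAlg lamPic m).1}) (n := id)
    (fun i hi => by
      have := Finset.mem_range.1 (Finset.mem_filter.1 hi).1
      simp only [id]; omega) Function.injective_id.injOn (fun _ _ => Nat.cast_nonneg _) ?_
  · simpa only [path_eq hN] using h1
  · intro i hi
    obtain ⟨hi1, hi2⟩ := Finset.mem_filter.1 hi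
    have hmem := path_mem hN (m := i) (by have := Finset.mem_range.1 hi1; omega)
    have hlev : ((R.path D lamAlg lamPic i).1, 0, 0) ∈ R.Q D lamAlg lamPic := level_mem_Q hmem
    have h2 := hB _ hmem hi2
    have h3 : (D.T0.card : ℝ) ≤ (R.mesh (R.path D lamAlg lamPic i).1).card := by
      have := card_add_le_card_mesh hD hR hθ hlev
      exact_mod_cast (show D.T0.card ≤ (R.mesh (R.path D lamAlg lamPic i).1).card by omega)
    have h4 : (1 : ℝ) ≤ D.T0.card := by exact_mod_cast hD.nonempty.card_pos
    have h5 : ((R.mesh (R.path D lamAlg lamPic i).1).card : ℝ) ^ s ≤ (D.T0.card : ℝ) ^ s *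
        (((R.mesh (R.path D lamAlg lamPic i).1).card : ℝ) - D.T0.card + 1) ^ s := by
      rw [← Real.mul_rpow (by linarith) (by linarith)]
      exact Real.rpow_le_rpow (Nat.cast_nonneg _) (by nlinarith) hs.le
    calc _ ≤ _ := mul_le_mul_of_nonneg_right h5 (Delta_nonneg _)
      _ = (D.T0.card : ℝ) ^ s * ((((R.mesh (R.path D lamAlg lamPic i).1).card : ℝ) -
          D.T0.card + 1) ^ s * R.Delta D α L (R.path D lamAlg lamPic i)) := by
        simp only [id_eq]; ring
      _ ≤ _ := by gcongr

variable [CompleteSpace V]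

/-- The rate with respect to the number of degrees of freedom on the levels `l ≥ 1`. -/
theorem dof_rpow_mul_Delta_le (hp : IsAdmissible α L Cstab Crel qred qalg θ lamAlg lamPic)
    (hD : D.Assumptions α L Cson Cmesh Cstab Crel qred)
    (hR : IsRun D α L θ lamAlg lamPic Cmark qalg R) (hCmark : 1 ≤ Cmark) (hCmesh : 0 < Cmesh)
    (hs : 0 < s) (hC : 1 ≤ Clin) (hq0 : 0 < qlin) (hq1 : qlin < 1)
    (hlin : ∀ {N : ℕ} {q : ℕ × ℕ × ℕ}, R.step D lamAlg lamPic N = some q → ∀ n ≤ N,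
      R.Delta D α L q ≤ Clin * qlin ^ (N - n) * R.Delta D α L (R.path D lamAlg lamPic n))
    (hA : D.approxNorm s ≠ ⊤) {q : ℕ × ℕ × ℕ} (hq : q ∈ R.Q D lamAlg lamPic) (hl : 1 ≤ q.1) :
    (((R.mesh q.1).card : ℝ) - D.T0.card + 1) ^ s * R.Delta D α L q ≤
      optUpper Cstab Crel Cmark (1 - lamPic / lamPicThreshold Cstab (qPicard α L) qalg)
        qalg lamAlg (qPicard α L) lamPic Cmesh Clin qlin s * (D.approxNorm s).toReal := by
  obtain ⟨N, hN⟩ := hq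
  have hlev := level_mem_Q (l := q.1) (k := q.2.1) (j := q.2.2) ⟨N, hN⟩
  -- the final iterates of the preceding levels
  have hprev : ∀ i : ℕ, ∃ n : ℕ, i < q.1 → n < N ∧ (R.path D lamAlg lamPic n).1 = i ∧
      ((R.marked i).card : ℝ) ^ s * R.Delta D α L (R.path D lamAlg lamPic n) ≤ Cmark ^ s *
        (markFactor Cstab Crel (1 - lamPic / lamPicThreshold Cstab (qPicard α L) qalg)
          qalg lamAlg (qPicard α L) lamPic * (D.approxNorm s).toReal) := by
    intro i
    by_cases hi : i < q.1
    · obtain ⟨k, j, h1, h2⟩ := prev_mesh (level_mem_Q_of_le hlev hi)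
      have h3 := card_marked_le hp hD hR hCmark hs hA h1 h2
      obtain ⟨n, hn⟩ := h1
      refine ⟨n, fun _ => ⟨?_, by rw [path_eq hn], by rwa [path_eq hn]⟩⟩
      by_contra! hle
      have := level_le_of_step hle hN hn
      simp only at this
      omega
    · exact ⟨0, fun h => absurd h hi⟩
  choose n hn using hprev
  have hmk := hp.markFactor_pos
  set m := markFactor Cstab Crel (1 - lamPic / lamPicThreshold Cstab (qPicard α L) qalg)
    qalg lamAlg (qPicard α L) lamPic with hm
  have hCm : 0 < Cmark := by linarith
  have ha0 : 0 ≤ (D.approxNorm s).toReal := ENNReal.toReal_nonneg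
  have h1 := sum_rpow_mul_le_of_linear_convergence (ι := ℕ)
    (x := fun n => R.Delta D α L (R.path D lamAlg lamPic n))
    (y := fun i => ((R.marked i).card : ℝ)) (C := Clin) (q := qlin) (s := s)
    (B := Cmark ^ s * (m * (D.approxNorm s).toReal)) (N := N) (by linarith) hq0 hq1 hs
    (by positivity) (Delta_nonneg _) (fun n hn => by
      have := hlin hN n hn
      rwa [← path_eq hN] at this) (S := Finset.range q.1) (n := n)
    (fun i hi => (hn i (Finset.mem_range.1 hi)).1.le)
    (fun i hi i' hi' heq => by
      rw [← (hn i (by simpa using hi)).2.1, ← (hn i' (by simpa using hi')).2.1, heq])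
    (fun i _ => Nat.cast_nonneg _) (fun i hi => (hn i (Finset.mem_range.1 hi)).2.2)
  simp only [path_eq hN] at h1
  have h2 := card_mesh_le_sum hD hR hlev
  have h3 : (D.T0.card : ℝ) + 1 ≤ (R.mesh q.1).card := by
    have := card_add_le_card_mesh hD hR hp.θ_pos hlev
    exact_mod_cast (show D.T0.card + 1 ≤ (R.mesh q.1).card by omega)
  have h4 : (((R.mesh q.1).card : ℝ) - D.T0.card + 1) ^ s ≤
      (2 * Cmesh) ^ s * (∑ i ∈ Finset.range q.1, ((R.marked i).card : ℝ)) ^ s := by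
    rw [← Real.mul_rpow (by positivity) (Finset.sum_nonneg fun _ _ => Nat.cast_nonneg _)]
    exact Real.rpow_le_rpow (by linarith) (by linarith) hs.le
  calc _ ≤ _ := mul_le_mul_of_nonneg_right h4 (Delta_nonneg q)
    _ = (2 * Cmesh) ^ s * ((∑ i ∈ Finset.range q.1, ((R.marked i).card : ℝ)) ^ s *
        R.Delta D α L q) := by ring
    _ ≤ (2 * Cmesh) ^ s * (Clin * (1 - qlin ^ (1 / s)) ^ (-s) *
        (Cmark ^ s * (m * (D.approxNorm s).toReal))) := by gcongr
    _ = (2 * Cmesh * Cmark) ^ s * (Clin * (1 - qlin ^ (1 / s)) ^ (-s) * m) *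
        (D.approxNorm s).toReal := by
      rw [Real.mul_rpow (by positivity) hCm.le]; ring
    _ ≤ _ := mul_le_mul_of_nonneg_right (le_max_right _ _) ha0

/-! ### The lower bound of the convergence rate -/

/-- The error and the estimator of the Galerkin solution are bounded by the quasi-error. -/
theorem galerkin_total_error_le (hp : IsAdmissible α L Cstab Crel qred qalg θ lamAlg lamPic)
    (hD : D.Assumptions α L Cson Cmesh Cstab Crel qred)
    (hR : IsRun D α L θ lamAlg lamPic Cmark qalg R) {q : ℕ × ℕ × ℕ}
    (hq : q ∈ R.Q D lamAlg lamPic) :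
    ‖D.uStar - D.uStarOn (R.mesh q.1)‖ + D.est (R.mesh q.1) (D.uStarOn (R.mesh q.1)) ≤
      (L / α + (1 + Cstab * (1 + L / α))) * R.Delta D α L q := by
  obtain ⟨l, k, j⟩ := q
  have h1 := est_uStarOn_le_Delta hp hD hR hq
  have h2 := hD.cea hp.α_pos hp.α_le (hR.mem_meshes (level_mem_Q hq)) (mem_space hR hD hq)
  have h3 : ‖D.uStar - R.u l k j‖ ≤ R.Delta D α L (l, k, j) := by
    have := norm_nonneg (R.uLin D α L l k - R.u l k j)
    have := est_nonneg (D := D) (R.mesh l) (R.u l k j)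
    simp only [Delta]; linarith
  have h4 : 0 ≤ L / α := (div_pos (hp.α_pos.trans_le hp.α_le) hp.α_pos).le
  have h5 := mul_le_mul_of_nonneg_left h3 h4
  linarith

/-- The quasi-error becomes arbitrarily small: if the algorithm stops, then because the estimator of
the final iterate, and with it the quasi-error, vanishes. -/
theorem exists_Delta_lt (hp : IsAdmissible α L Cstab Crel qred qalg θ lamAlg lamPic)
    (hD : D.Assumptions α L Cson Cmesh Cstab Crel qred)
    (hR : IsRun D α L θ lamAlg lamPic Cmark qalg R) (hq0 : 0 < qlin) (hq1 : qlin < 1)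
    (hlin : ∀ {N : ℕ} {q : ℕ × ℕ × ℕ}, R.step D lamAlg lamPic N = some q → ∀ n ≤ N,
      R.Delta D α L q ≤ Clin * qlin ^ (N - n) * R.Delta D α L (R.path D lamAlg lamPic n))
    {ε : ℝ} (hε : 0 < ε) : ∃ q ∈ R.Q D lamAlg lamPic, R.Delta D α L q < ε := by
  by_cases hAlg : ∃ n, R.step D lamAlg lamPic n = none
  · classical
    obtain ⟨n, hn, hmin⟩ : ∃ n, R.step D lamAlg lamPic n = none ∧
        ∀ m < n, R.step D lamAlg lamPic m ≠ none :=
      ⟨Nat.find hAlg, Nat.find_spec hAlg, fun m hm => Nat.find_min hAlg hm⟩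
    cases n with
    | zero => simp [step] at hn
    | succ n =>
      obtain ⟨⟨l, k, j⟩, hq⟩ := Option.ne_none_iff_exists'.1 (hmin n (Nat.lt_succ_self n))
      rw [step_succ, hq] at hn
      obtain ⟨hk, hj, h1, h2, h3⟩ := next_eq_none hn
      have h4 := Delta_le_of_final hp hD hR hk hj ⟨n, hq⟩ h1 h2
      rw [h3, mul_zero] at h4
      exact ⟨_, ⟨n, hq⟩, by linarith⟩
  · push Not at hAlg
    have hlim : Tendsto (fun n : ℕ => Clin * qlin ^ n * R.Delta D α L (0, 0, 0)) atTop (𝓝 0) := by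
      have := ((tendsto_pow_atTop_nhds_zero_of_lt_one hq0.le hq1).const_mul Clin).mul_const
        (R.Delta D α L (0, 0, 0))
      simpa using this
    obtain ⟨n, hn⟩ := (hlim.eventually_lt_const hε).exists
    obtain ⟨q, hq⟩ := Option.ne_none_iff_exists'.1 (hAlg n)
    have h1 := hlin hq 0 (Nat.zero_le _)
    rw [path_eq (show R.step D lamAlg lamPic 0 = some (0, 0, 0) from rfl)] at h1
    exact ⟨q, ⟨n, hq⟩, h1.trans_lt hn⟩

/-- The lower bound of the rate: for given `N`, the last generated mesh with at most `N` additional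
elements competes in the infimum, and its successor has more than `N` additional elements. -/
theorem approxNorm_le (hp : IsAdmissible α L Cstab Crel qred qalg θ lamAlg lamPic)
    (hD : D.Assumptions α L Cson Cmesh Cstab Crel qred)
    (hR : IsRun D α L θ lamAlg lamPic Cmark qalg R) (hCson : 2 ≤ Cson) (hs : 0 < s)
    (hq0 : 0 < qlin) (hq1 : qlin < 1)
    (hlin : ∀ {N : ℕ} {q : ℕ × ℕ × ℕ}, R.step D lamAlg lamPic N = some q → ∀ n ≤ N,
      R.Delta D α L q ≤ Clin * qlin ^ (N - n) * R.Delta D α L (R.path D lamAlg lamPic n)) :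
    D.approxNorm s ≤ ENNReal.ofReal ((L / α + (1 + Cstab * (1 + L / α))) *
      (Cson * D.T0.card) ^ s) * R.dofRate D α L s (R.Q D lamAlg lamPic) := by
  have hLα : 0 < L / α := div_pos (hp.α_pos.trans_le hp.α_le) hp.α_pos
  have hCs := hp.Cstab_pos
  set c := L / α + (1 + Cstab * (1 + L / α)) with hc
  have hc0 : 0 < c := by positivity
  have hinf : ∀ (N : ℕ), ∀ q ∈ R.Q D lamAlg lamPic, (R.mesh q.1).card ≤ D.T0.card + N →
      (⨅ T ∈ {T | T ∈ D.meshes ∧ T.card ≤ D.T0.card + N},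
        ENNReal.ofReal (‖D.uStar - D.uStarOn T‖ + D.est T (D.uStarOn T))) ≤
        ENNReal.ofReal (c * R.Delta D α L q) := fun N q hq hcard =>
    (iInf₂_le (R.mesh q.1) ⟨hR.mem_meshes (level_mem_Q hq), hcard⟩).trans
      (ENNReal.ofReal_le_ofReal (galerkin_total_error_le hp hD hR hq))
  refine iSup_le fun N => ?_
  have hN : ((N : ℝ≥0∞) + 1) ^ s = ENNReal.ofReal (((N : ℝ) + 1) ^ s) := by
    rw [← ENNReal.ofReal_rpow_of_pos (by positivity), ENNReal.ofReal_add (by positivity) one_pos.le,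
      ENNReal.ofReal_natCast, ENNReal.ofReal_one]
  rw [hN]
  by_cases hbig : ∃ l, (l, 0, 0) ∈ R.Q D lamAlg lamPic ∧ D.T0.card + N < (R.mesh l).card
  · -- the last level whose mesh is admissible for `N`
    classical
    obtain ⟨l, ⟨hl, hlN⟩, hmin⟩ : ∃ l, ((l, 0, 0) ∈ R.Q D lamAlg lamPic ∧
        D.T0.card + N < (R.mesh l).card) ∧ ∀ m < l, ¬ ((m, 0, 0) ∈ R.Q D lamAlg lamPic ∧
        D.T0.card + N < (R.mesh m).card) :=
      ⟨Nat.find hbig, Nat.find_spec hbig, fun m hm => Nat.find_min hbig hm⟩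
    cases l with
    | zero => rw [hR.mesh_zero] at hlN; omega
    | succ l =>
      have hl' := level_mem_Q_of_le hl (Nat.le_succ l)
      have hlN' : (R.mesh l).card ≤ D.T0.card + N := by
        by_contra! hlt
        exact hmin l (Nat.lt_succ_self l) ⟨hl', hlt⟩
      have h1 := card_mesh_succ_le hD hR hCson hl
      have h2 : (D.T0.card : ℝ) + N + 1 ≤ (R.mesh (l + 1)).card := by exact_mod_cast hlN
      have h3 : (D.T0.card : ℝ) ≤ (R.mesh l).card := by
        have := card_add_le_card_mesh hD hR hp.θ_pos hl'
        exact_mod_cast (show D.T0.card ≤ (R.mesh l).card by omega)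
      have h4 : (1 : ℝ) ≤ D.T0.card := by exact_mod_cast hD.nonempty.card_pos
      have h5 : (N : ℝ) + 1 ≤ Cson * D.T0.card * (((R.mesh l).card : ℝ) - D.T0.card + 1) := by
        have h6 : ((R.mesh l).card : ℝ) ≤
            D.T0.card * (((R.mesh l).card : ℝ) - D.T0.card + 1) := by nlinarith
        have h7 := mul_le_mul_of_nonneg_left h6 (show 0 ≤ Cson by linarith)
        linarith
      have h8 : ((N : ℝ) + 1) ^ s ≤ (Cson * D.T0.card) ^ s *
          (((R.mesh l).card : ℝ) - D.T0.card + 1) ^ s := by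
        rw [← Real.mul_rpow (by positivity) (by linarith)]
        exact Real.rpow_le_rpow (by positivity) h5 hs.le
      have hΔ := Delta_nonneg (D := D) (R := R) (α := α) (L := L) (l, 0, 0)
      calc _ ≤ ENNReal.ofReal (((N : ℝ) + 1) ^ s) *
            ENNReal.ofReal (c * R.Delta D α L (l, 0, 0)) := by
            gcongr; exact hinf N (l, 0, 0) hl' hlN'
        _ = ENNReal.ofReal (((N : ℝ) + 1) ^ s * (c * R.Delta D α L (l, 0, 0))) :=
            (ENNReal.ofReal_mul (by positivity)).symm
        _ ≤ ENNReal.ofReal (c * (Cson * D.T0.card) ^ s *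
            ((((R.mesh l).card : ℝ) - D.T0.card + 1) ^ s * R.Delta D α L (l, 0, 0))) := by
            refine ENNReal.ofReal_le_ofReal ?_
            calc _ ≤ ((Cson * D.T0.card) ^ s * (((R.mesh l).card : ℝ) - D.T0.card + 1) ^ s) *
                  (c * R.Delta D α L (l, 0, 0)) := by gcongr
              _ = _ := by ring
        _ = ENNReal.ofReal (c * (Cson * D.T0.card) ^ s) * ENNReal.ofReal
            ((((R.mesh l).card : ℝ) - D.T0.card + 1) ^ s * R.Delta D α L (l, 0, 0)) := by
            rw [ENNReal.ofReal_mul (by positivity)]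
        _ ≤ _ := by
            gcongr
            exact le_iSup₂ (f := fun (q : ℕ × ℕ × ℕ) (_ : q ∈ R.Q D lamAlg lamPic) =>
              ENNReal.ofReal ((((R.mesh q.1).card : ℝ) - (D.T0.card : ℝ) + 1) ^ s *
                R.Delta D α L q)) (l, 0, 0) hl'
  · -- all meshes are admissible for `N`, and the quasi-error becomes arbitrarily small
    push Not at hbig
    have h0 : (⨅ T ∈ {T | T ∈ D.meshes ∧ T.card ≤ D.T0.card + N},
        ENNReal.ofReal (‖D.uStar - D.uStarOn T‖ + D.est T (D.uStarOn T))) = 0 := by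
      refine le_antisymm (ENNReal.le_of_forall_pos_le_add fun ε hε _ => ?_) zero_le
      obtain ⟨q, hq, hlt⟩ := exists_Delta_lt hp hD hR hq0 hq1 hlin
        (show 0 < (ε : ℝ) / c from div_pos (by exact_mod_cast hε) hc0)
      refine (hinf N q hq (hbig q.1 (level_mem_Q hq))).trans ?_
      rw [lt_div_iff₀ hc0] at hlt
      rw [zero_add]
      refine ENNReal.ofReal_le_of_le_toReal ?_
      rw [ENNReal.coe_toReal]
      linarith
    rw [h0, mul_zero]
    exact zero_le

end IsRun

/-! ### Cumulative cost -/

/-- The constant `copt` of the lower bound of the convergence rate. -/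
noncomputable def optLower (CCea Cstab Cson : ℝ) (cardT0 : ℕ) (s : ℝ) : ℝ :=
  (CCea + (1 + Cstab * (1 + CCea))) * (Cson * cardT0) ^ s

namespace IsRun

open Iterates Discretization

variable {𝕜 V E : Type*} [RCLike 𝕜] [NormedAddCommGroup V] [InnerProductSpace 𝕜 V]
  {D : Discretization 𝕜 V E} {R : Iterates V E}
  {α L lamAlg lamPic s : ℝ}

theorem cost_rpow_mul {N : ℕ} {q : ℕ × ℕ × ℕ} (hs : 0 < s)
    (hN : R.step D lamAlg lamPic N = some q) :
    R.cost D lamAlg lamPic q ^ s * ENNReal.ofReal (R.Delta D α L q) =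
      ENNReal.ofReal ((∑ m ∈ Finset.range (N + 1) with 0 ≤ (R.path D lamAlg lamPic m).1,
        ((R.mesh (R.path D lamAlg lamPic m).1).card : ℝ)) ^ s * R.Delta D α L q) := by
  rw [ENNReal.ofReal_mul (by positivity), ← ENNReal.ofReal_rpow_of_nonneg
    (Finset.sum_nonneg fun _ _ => Nat.cast_nonneg _) hs.le, cost_step hN, ← Nat.cast_sum,
    ← Nat.cast_sum, ENNReal.ofReal_natCast]
  simp

theorem costAfterZero_rpow_mul {N : ℕ} {q : ℕ × ℕ × ℕ} (hs : 0 < s)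
    (hN : R.step D lamAlg lamPic N = some q) :
    R.costAfterZero D lamAlg lamPic q ^ s * ENNReal.ofReal (R.Delta D α L q) =
      ENNReal.ofReal ((∑ m ∈ Finset.range (N + 1) with 1 ≤ (R.path D lamAlg lamPic m).1,
        ((R.mesh (R.path D lamAlg lamPic m).1).card : ℝ)) ^ s * R.Delta D α L q) := by
  rw [ENNReal.ofReal_mul (by positivity), ← ENNReal.ofReal_rpow_of_nonneg
    (Finset.sum_nonneg fun _ _ => Nat.cast_nonneg _) hs.le, costAfterZero_step hN, ← Nat.cast_sum,
    ← Nat.cast_sum, ENNReal.ofReal_natCast]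

/-- The rate with respect to the degrees of freedom is bounded by the one with respect to the cost,
since the elements of the current mesh contribute to the cost. -/
theorem dofRate_le_iSup_cost [DecidableEq E] {Cson Cmesh Cstab Crel qred θ Cmark qalg : ℝ}
    (hD : D.Assumptions α L Cson Cmesh Cstab Crel qred)
    (hR : IsRun D α L θ lamAlg lamPic Cmark qalg R) (hθ : 0 < θ) (hs : 0 < s) :
    R.dofRate D α L s (R.Q D lamAlg lamPic) ≤
      ⨆ q ∈ R.Q D lamAlg lamPic,
        R.cost D lamAlg lamPic q ^ s * ENNReal.ofReal (R.Delta D α L q) := by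
  refine iSup₂_mono fun q hq => ?_
  obtain ⟨N, hN⟩ := hq
  have h1 : D.T0.card ≤ (R.mesh q.1).card := by
    have h2 : (q.1, 0, 0) ∈ R.Q D lamAlg lamPic := level_mem_Q (k := q.2.1) (j := q.2.2) ⟨N, hN⟩
    have := card_add_le_card_mesh hD hR hθ h2
    omega
  have h2 : (D.T0.card : ℝ) ≤ (R.mesh q.1).card := by exact_mod_cast h1
  have h3 : (1 : ℝ) ≤ D.T0.card := by exact_mod_cast hD.nonempty.card_pos
  have h4 : ((R.mesh q.1).card : ℝ) ≤
      ∑ m ∈ Finset.range (N + 1) with 0 ≤ (R.path D lamAlg lamPic m).1,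
        ((R.mesh (R.path D lamAlg lamPic m).1).card : ℝ) := by
    have := Finset.single_le_sum
      (f := fun m => ((R.mesh (R.path D lamAlg lamPic m).1).card : ℝ))
      (s := {m ∈ Finset.range (N + 1) | 0 ≤ (R.path D lamAlg lamPic m).1})
      (fun _ _ => Nat.cast_nonneg _) (Finset.mem_filter.2
        ⟨Finset.mem_range.2 (Nat.lt_succ_self N), Nat.zero_le _⟩)
    simpa only [path_eq hN] using this
  rw [cost_rpow_mul hs hN]
  refine ENNReal.ofReal_le_ofReal (mul_le_mul_of_nonneg_right ?_ (Delta_nonneg _))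
  exact Real.rpow_le_rpow (by linarith) (by linarith) hs.le

end IsRun

end AdaptiveFEM

open AdaptiveFEM Iterates IsRun in
theorem theorem4 :
    -- the thresholds and constants, as functions of the quantities on which they depend
    ∃ (lamAlgS : (qPic qalg : ℝ) → ℝ)
      (lamPicS : (Cstab qPic qalg : ℝ) → ℝ)
      (thetaS : (Cstab Crel qPic qalg : ℝ) → ℝ)
      (ClinF qlinF : (Crel Cstab qred θ qalg lamAlg qPic lamPic α L : ℝ) → ℝ)
      (CoptF : (Cstab Crel Cmark δ CCea qalg lamAlg qPic lamPic Cmesh Clin qlin : ℝ) →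
        (cardT0 : ℕ) → (s : ℝ) → ℝ)
      (coptF : (CCea Cstab Crel Cson : ℝ) → (cardT0 : ℕ) → (s : ℝ) → (lastLevel : ℕ∞) → ℝ),
      (∀ qPic qalg, 0 < lamAlgS qPic qalg) ∧
      (∀ Cstab qPic qalg, 0 < lamPicS Cstab qPic qalg) ∧
      (∀ Cstab Crel qPic qalg, 0 < thetaS Cstab Crel qPic qalg) ∧
      -- the constants of the assumptions, the rate, and the parameters of the algorithm
      ∀ (α L Cson Cmesh Cstab Crel qred qalg θ lamAlg lamPic Cmark s : ℝ),
        0 < α → α ≤ L → 2 ≤ Cson → 0 < Cmesh → 0 < Cstab → 0 < Crel →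
        0 < qred → qred < 1 → 0 < qalg → qalg < 1 → 1 ≤ Cmark → 0 < s →
        ∀ (qPic lamAlgStar lamPicStar thetaStar : ℝ),
        qPic = AdaptiveFEM.qPicard α L → lamAlgStar = lamAlgS qPic qalg →
        lamPicStar = lamPicS Cstab qPic qalg → thetaStar = thetaS Cstab Crel qPic qalg →
        0 < θ → θ < min 1 thetaStar → 0 < lamAlg → lamAlg < 1 → 0 < lamPic →
        lamAlg + lamAlg / lamPic < lamAlgStar → lamPic / θ < lamPicStar →
        ∀ (θ' Clin qlin : ℝ),
        θ' = AdaptiveFEM.thetaPrime Cstab (qPic / (1 - qPic)) (qalg / (1 - qalg))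
          θ lamAlg lamPic lamPicStar →
        Clin = ClinF Crel Cstab qred θ qalg lamAlg qPic lamPic α L →
        qlin = qlinF Crel Cstab qred θ qalg lamAlg qPic lamPic α L →
        (0 < θ' ∧ θ' < (1 + Cstab ^ 2 * Crel ^ 2)⁻¹) ∧ 1 ≤ Clin ∧ 0 < qlin ∧ qlin < 1 ∧
        -- the problem, its discretization, and a run of the algorithm
        ∀ (𝕜 V E : Type*) [RCLike 𝕜] [NormedAddCommGroup V] [InnerProductSpace 𝕜 V]
          [CompleteSpace V] [DecidableEq E]
          (D : AdaptiveFEM.Discretization 𝕜 V E) (R : AdaptiveFEM.Iterates V E),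
          D.Assumptions α L Cson Cmesh Cstab Crel qred →
          AdaptiveFEM.IsRun D α L θ lamAlg lamPic Cmark qalg R →
          ∀ (Q : Set (ℕ × ℕ × ℕ)) (Δ : ℕ × ℕ × ℕ → ℝ) (Copt copt Copt' : ℝ),
          Q = R.Q D lamAlg lamPic → Δ = R.Delta D α L →
          Copt = CoptF Cstab Crel Cmark (1 - lamPic / lamPicStar) (L / α)
            qalg lamAlg qPic lamPic Cmesh Clin qlin D.T0.card s →
          copt = coptF (L / α) Cstab Crel Cson D.T0.card s (R.lastLevel D lamAlg lamPic) →
          Copt' = (D.T0.card : ℝ) ^ s * Copt * Clin * (1 - qlin ^ (1 / s)) ^ (-s) →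
          0 < Copt ∧ 0 < copt ∧
          -- `Clin` and `qlin` are the constants of linear convergence
          (∀ q ∈ Q, ∀ q' ∈ Q, R.BeforeEq D lamAlg lamPic q q' →
            Δ q' ≤ Clin * qlin ^ (R.stepNumber D lamAlg lamPic q' -
              R.stepNumber D lamAlg lamPic q) * Δ q) ∧
          -- `copt` and `Copt` are the constants of the optimal rate w.r.t. degrees of freedom
          ENNReal.ofReal copt⁻¹ * D.approxNorm s ≤ R.dofRate D α L s Q ∧
          R.dofRate D α L s Q ≤
            ENNReal.ofReal Copt * max (D.approxNorm s) (ENNReal.ofReal (Δ (0, 0, 0))) ∧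
          R.dofRate D α L s {q | q ∈ Q ∧ 1 ≤ q.1} ≤ ENNReal.ofReal Copt * D.approxNorm s ∧
          -- optimal rate w.r.t. the cumulative cost
          ENNReal.ofReal copt⁻¹ * D.approxNorm s ≤
            ⨆ q ∈ Q, R.cost D lamAlg lamPic q ^ s * ENNReal.ofReal (Δ q) ∧
          (⨆ q ∈ Q, R.cost D lamAlg lamPic q ^ s * ENNReal.ofReal (Δ q)) ≤
            ENNReal.ofReal Copt' * max (D.approxNorm s) (ENNReal.ofReal (Δ (0, 0, 0))) ∧
          (⨆ q ∈ {q | q ∈ Q ∧ 1 ≤ q.1},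
              R.costAfterZero D lamAlg lamPic q ^ s * ENNReal.ofReal (Δ q)) ≤
            ENNReal.ofReal Copt' * D.approxNorm s := by
  choose ClinF qlinF hlinF using IsRun.exists_linear_convergence.{u_1, u_2, u_3}
  refine ⟨lamAlgThreshold, lamPicThreshold, fun Cstab Crel _ _ => thetaThreshold Cstab Crel,
    fun Crel Cstab qred θ qalg lamAlg _ lamPic α L =>
      ClinF α L Cstab Crel qred qalg θ lamAlg lamPic,
    fun Crel Cstab qred θ qalg lamAlg _ lamPic α L =>
      qlinF α L Cstab Crel qred qalg θ lamAlg lamPic,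
    fun Cstab Crel Cmark δ _ qalg lamAlg qPic lamPic Cmesh Clin qlin _ s =>
      optUpper Cstab Crel Cmark δ qalg lamAlg qPic lamPic Cmesh Clin qlin s,
    fun CCea Cstab _ Cson cardT0 s _ => optLower CCea Cstab Cson cardT0 s,
    lamAlgThreshold_pos, lamPicThreshold_pos, fun Cstab Crel _ _ => thetaThreshold_pos Cstab Crel,
    ?_⟩
  intro α L Cson Cmesh Cstab Crel qred qalg θ lamAlg lamPic Cmark s hα hαL hCson hCmesh hCstab hCrel
    hqred0 hqred1 hqalg0 hqalg1 hCmark hs qPic lamAlgStar lamPicStar thetaStar hqPic hAlgS hPicS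
    hthetaS hθ0 hθ1 hla0 hla1 hlp0 hAlg hPic θ' Clin qlin hθ' hClin hqlin
  subst hqPic hAlgS hPicS hthetaS
  beta_reduce at hθ1 hClin hqlin
  have hp : IsAdmissible α L Cstab Crel qred qalg θ lamAlg lamPic :=
    ⟨hα, hαL, hCstab, hCrel, hqred0, hqred1, hqalg0, hqalg1, hθ0, hθ1.trans_le (min_le_left _ _),
      hθ1.trans_le (min_le_right _ _), hla0, hlp0, hAlg, hPic⟩
  obtain ⟨hC1, hq0, hq1, hconv⟩ := hlinF α L Cstab Crel qred qalg θ lamAlg lamPic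
  rw [← hClin] at hC1 hconv
  rw [← hqlin] at hq0 hq1 hconv
  refine ⟨hp.thetaPrime_pos_lt hθ', hC1, hq0, hq1, ?_⟩
  intro 𝕜 V E _ _ _ _ _ D R hD hR Q Δ Copt copt Copt' hQ hΔ hCopt hcopt hCopt'
  subst hQ hΔ
  beta_reduce at hCopt hcopt
  have hlin := fun {N : ℕ} {q : ℕ × ℕ × ℕ} => hconv hp hD hR (N := N) (q := q)
  have hT0 : (0 : ℝ) < D.T0.card := by exact_mod_cast hD.nonempty.card_pos
  have hCopt_le : Clin ≤ Copt := hCopt ▸ le_max_left _ _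
  have hCopt0 : 0 < Copt := by linarith
  have hLα : 0 < L / α := div_pos (hα.trans_le hαL) hα
  have hcopt0 : 0 < copt := by
    rw [hcopt, optLower]
    positivity
  have hΔ0 : ∀ q, 0 ≤ R.Delta D α L q := Delta_nonneg
  have hr : 0 < 1 - qlin ^ (1 / s) := by
    have := Real.rpow_lt_one hq0.le hq1 (show 0 < 1 / s by positivity)
    linarith
  have hCopt'0 : 0 < Copt' := by
    rw [hCopt']
    positivity
  have htop : ∀ {C : ℝ}, 0 < C → ENNReal.ofReal C * ⊤ = ⊤ := fun hC =>
    ENNReal.mul_top (ENNReal.ofReal_pos.2 hC).ne'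
  -- the lower bounds
  have hlow : ENNReal.ofReal copt⁻¹ * D.approxNorm s ≤
      R.dofRate D α L s (R.Q D lamAlg lamPic) := by
    have h1 := approxNorm_le hp hD hR hCson hs hq0 hq1 hlin
    rw [ENNReal.ofReal_inv_of_pos hcopt0, mul_comm, ← div_eq_mul_inv]
    refine ENNReal.div_le_of_le_mul ?_
    rw [mul_comm, hcopt]
    exact h1
  -- the real-valued forms of the upper bounds, on the levels `l ≥ 1` and on all levels
  have hup1 : D.approxNorm s ≠ ⊤ → ∀ q ∈ R.Q D lamAlg lamPic, 1 ≤ q.1 →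
      (((R.mesh q.1).card : ℝ) - D.T0.card + 1) ^ s * R.Delta D α L q ≤
        Copt * (D.approxNorm s).toReal := fun hA q hq hl => by
    rw [hCopt]
    exact dof_rpow_mul_Delta_le hp hD hR hCmark hCmesh hs hC1 hq0 hq1 hlin hA hq hl
  set M := max (D.approxNorm s) (ENNReal.ofReal (R.Delta D α L (0, 0, 0))) with hM
  have hMtop : M ≠ ⊤ → D.approxNorm s ≠ ⊤ := fun h h' => h (by rw [hM, h']; exact max_eq_left le_top)
  have hup0 : M ≠ ⊤ → ∀ q ∈ R.Q D lamAlg lamPic, 0 ≤ q.1 →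
      (((R.mesh q.1).card : ℝ) - D.T0.card + 1) ^ s * R.Delta D α L q ≤ Copt * M.toReal := by
    intro hA q hq _
    rcases Nat.eq_zero_or_pos q.1 with h0 | h0
    · refine (dof_rpow_mul_Delta_le_of_zero hR hC1 hq0 hq1 hlin hq h0).trans ?_
      have h1 : R.Delta D α L (0, 0, 0) ≤ M.toReal :=
        (ENNReal.ofReal_le_iff_le_toReal hA).1 (le_max_right _ _)
      have h2 := hΔ0 (0, 0, 0)
      gcongr
    · refine (hup1 (hMtop hA) q hq h0).trans ?_
      have : (D.approxNorm s).toReal ≤ M.toReal := ENNReal.toReal_mono hA (le_max_left _ _)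
      gcongr
  have hofReal : ∀ {C : ℝ} {B : ℝ≥0∞} {x : ℝ}, 0 < C → B ≠ ⊤ → x ≤ C * B.toReal →
      ENNReal.ofReal x ≤ ENNReal.ofReal C * B := by
    intro C B x hC hB hx
    refine (ENNReal.ofReal_le_ofReal hx).trans ?_
    rw [ENNReal.ofReal_mul hC.le, ENNReal.ofReal_toReal hB]
  have hcost : ∀ {B : ℝ}, Clin * (1 - qlin ^ (1 / s)) ^ (-s) * ((D.T0.card : ℝ) ^ s * (Copt * B)) =
      Copt' * B := by
    intro B
    rw [hCopt']
    ring
  refine ⟨hCopt0, hcopt0, ?_, hlow, ?_, ?_, hlow.trans (dofRate_le_iSup_cost hD hR hθ0 hs), ?_, ?_⟩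
  · intro q hq q' hq' hqq'
    obtain ⟨N, hN⟩ := hq'
    obtain ⟨n, hn, hqn⟩ := (beforeEq_step hN).1 hqq'
    rw [stepNumber_step hN, stepNumber_step hqn]
    have := hlin hN n hn
    rwa [path_eq hqn] at this
  · by_cases hA : M = ⊤
    · rw [hA, htop hCopt0]; exact le_top
    · exact iSup₂_le fun q hq => hofReal hCopt0 hA (hup0 hA q hq (Nat.zero_le _))
  · by_cases hA : D.approxNorm s = ⊤
    · rw [hA, htop hCopt0]; exact le_top
    · exact iSup₂_le fun q hq => hofReal hCopt0 hA (hup1 hA q hq.1 hq.2)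
  · by_cases hA : M = ⊤
    · rw [hA, htop hCopt'0]; exact le_top
    · refine iSup₂_le fun q hq => ?_
      obtain ⟨N, hN⟩ := hq
      rw [cost_rpow_mul hs hN]
      refine hofReal hCopt'0 hA ?_
      rw [← hcost]
      exact sum_card_rpow_mul_Delta_le hD hR hθ0 hs hC1 hq0 hq1 hlin (by positivity) (hup0 hA) hN
  · by_cases hA : D.approxNorm s = ⊤
    · rw [hA, htop hCopt'0]; exact le_top
    · refine iSup₂_le fun q hq => ?_
      obtain ⟨⟨N, hN⟩, hl⟩ := hq
      rw [costAfterZero_rpow_mul hs hN]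
      refine hofReal hCopt'0 hA ?_
      rw [← hcost]
      exact sum_card_rpow_mul_Delta_le hD hR hθ0 hs hC1 hq0 hq1 hlin (by positivity) (hup1 hA) hN
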